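/- **Setting.** Let $K$ be a field, $\theta$ an automorphism of $K$ of finite order $r$, $F=K^\theta$ its fixed field, and assume that the characteristic of $K$ does not divide $r$. Let $F^{\mathrm s}$ be a separable closure of $F$. Put $\mathcal A=K[X^{\pm1};\theta]$ (so $Xa=\theta(a)X$ for $a\in K$), $Y=X^r$, and $\mathrm{Frac}(\mathcal A)=F(Y)\otimes_{F[Y]}\mathcal A$; its centre is $F(Y)$ and the centralizer of $K$ is $F(Y)\otimes_F K=K(Y)$. For $z\in F^{\mathrm s}$, $z\ne0$, let $N_z\in F[Y]$ be its minimal polynomial. The canonical Taylor morphism $\tau_{z,\mathrm{can}}:\mathrm{Frac}(\mathcal A)\to(\mathcal A/N_z\mathcal A)(\!(T)\!)$ is the unique morphism of $K$-algebras with $Y\mapsto Y+T$ and $X\mapsto cX$ for some $c\in (F[Y]/N_z)[[T]]$, $c\equiv1\pmod T$; the canonical skew residue $\mathrm{sres}_{z,\mathrm{can}}(f)\in\mathcal A/N_z\mathcal A$ is the coefficient of $T^{-1}$ in $\tau_{z,\mathrm{can}}(f)$. Let $\gamma:\mathrm{Frac}(\mathcal A)\to\mathrm{Frac}(\mathcal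 A)$ be an endomorphism of $K$-algebras. Then $\gamma(X)=CX$ with $C\in F(Y)\otimes_F K$, the norm $n=C\,\theta(C)\cdots\theta^{r-1}(C)$ lies in $F(Y)$, and $\gamma(Y)=nY\in F(Y)$. A point $z\in F^{\mathrm s}$, $z\neq 0$, is called *$\gamma$-regular* if $\gamma(Y)$ has neither a zero nor a pole at $Y=z$, $\frac{d\gamma(Y)}{dY}$ does not vanish at $z$, and $C=a/b$ for some $a\in K[Y]$, $b\in F[Y]$ with $b(z)\ne0$. Then put $\gamma_\star z=\gamma(Y)(z)\in F^{\mathrm s}\setminus\{0\}$; $\gamma$ induces a morphism of $K$-algebras $\bar\gamma:\mathcal A/N_{\gamma_\star z}\mathcal A\to\mathcal A/N_z\mathcal A$, $X\mapsto \bar C X$, where $\bar C$ is the reduction of $C$ modulo $N_z$. Let $\mathcal Z'=F(Y)(\rho)$ be an extension field of $F(Y)$ generated by an $r$-th root $\rho$ of $n$, and let $U$ be an invertible element of $\mathcal Z'\otimes_F K$ with $\rho^{-1}C=(\mathrm{id}\otimes\theta)(U)/U$ (such a $U$ exists by Hilbert's Theorem 90 and is unique up to $\mathcal Z'^\times$).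 For a $\gamma$-regular point $z\ne0$, let $\mathcal O'_z=F[Y]_{(N_z)}[\rho]\subset\mathcal Z'$. The morphism $\tau_{z,\mathrm{can}}$ extends uniquely to a morphism of $K$-algebras $\mathcal Z'\otimes_{F[Y]}\mathcal A\to(\mathcal O'_z/N_z\otimes_{F[Y]}\mathcal A)(\!(T)\!)$ that maps $\mathcal O'_z$ to $(\mathcal O'_z/N_z)[[T]]$ and induces there the reduction modulo $N_z$ when $T=0$; $\mathrm{sres}_{z,\mathrm{can}}$ again denotes the coefficient of $T^{-1}$. **Theorem.** For every $\gamma$-regular $z\in F^{\mathrm s}$, $z\neq0$: there is $\lambda\in\mathcal Z'^\times$ such that $\lambda U$ is an invertible element of $\mathcal O'_z\otimes_F K$; and for every such $\lambda$, writing $\bar U$ for the image of $\lambda U$ in $(\mathcal O'_z/N_z)\otimes_F K$, one has for all $f\in\mathrm{Frac}(\mathcal A)$ $$\bar\gamma\big(\mathrm{sres}_{\gamma_\star z,\mathrm{can}}(f)\big)=\bar U^{-1}\cdot \mathrm{sres}_{z,\mathrm{can}}\Big(U\,\gamma(f)\,U^{-1}\,\frac{d\gamma(Y)}{dY}\Big)\cdot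 \bar U$$ in $(\mathcal O'_z/N_z)\otimes_{F[Y]}\mathcal A$. -/

import Mathlib

open Polynomial TensorProduct

noncomputable section

namespace SkewRes

section Ring

variable {F K : Type*} [Field F] [Field K] [Algebra F K]

/-- The underlying type of the ring `K[X^{±1}; θ]` of skew Laurent polynomials. -/
def SkewLaurent (_θ : K ≃ₐ[F] K) : Type _ := SkewMonoidAlgebra K (Multiplicative ℤ)

/-- The action of `ℤ` on `K` through the powers of `θ`. -/
abbrev powAction (θ : K ≃ₐ[F] K) : MulSemiringAction (Multiplicative ℤ) K :=
  MulSemiringAction.compHom K (zpowersHom (K ≃ₐ[F] K) θ)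

/-- The ring structure: `(a X^i) (b X^j) = a θ^i(b) X^{i+j}`. -/
instance (θ : K ≃ₐ[F] K) : Ring (SkewLaurent θ) :=
  letI := powAction θ
  inferInstanceAs (Ring (SkewMonoidAlgebra K (Multiplicative ℤ)))

namespace SkewLaurent

variable (θ : K ≃ₐ[F] K)

/-- The constants `K ⊆ K[X^{±1}; θ]`. -/
def const : K →+* SkewLaurent θ where
  toFun a := (SkewMonoidAlgebra.single 1 a : SkewMonoidAlgebra K (Multiplicative ℤ))
  map_one' := rfl
  map_mul' a b := by
    let := powAction θ
    refine Eq.symm ((SkewMonoidAlgebra.single_mul_single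
      (a₁ := (1 : Multiplicative ℤ)) (a₂ := (1 : Multiplicative ℤ))
      (b₁ := a) (b₂ := b)).trans ?_)
    simp
  map_zero' := SkewMonoidAlgebra.single_zero _
  map_add' a b := SkewMonoidAlgebra.single_add _ _ _

/-- The monomial `X ^ n`, for `n : ℤ`. -/
def monom : Multiplicative ℤ →* SkewLaurent θ where
  toFun n := (SkewMonoidAlgebra.single n 1 : SkewMonoidAlgebra K (Multiplicative ℤ))
  map_one' := rfl
  map_mul' a b := by
    let := powAction θ
    refine Eq.symm ((SkewMonoidAlgebra.single_mul_single
      (a₁ := a) (a₂ := b) (b₁ := (1 : K)) (b₂ := (1 : K))).trans ?_)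
    simp

/-- The variable `X`, a unit of `K[X^{±1}; θ]`. -/
def X : (SkewLaurent θ)ˣ where
  val := monom θ (Multiplicative.ofAdd 1)
  inv := monom θ (Multiplicative.ofAdd (-1))
  val_inv := by rw [← map_mul]; exact map_one _
  inv_val := by rw [← map_mul]; exact map_one _

variable {θ}

theorem X_mul_const (a : K) : (X θ : SkewLaurent θ) * const θ a = const θ (θ a) * X θ := by
  let := powAction θ
  refine (SkewMonoidAlgebra.single_mul_single (a₁ := Multiplicative.ofAdd (1 : ℤ))
      (a₂ := (1 : Multiplicative ℤ)) (b₁ := (1 : K)) (b₂ := a)).trans ?_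
  refine Eq.trans ?_ (SkewMonoidAlgebra.single_mul_single (a₁ := (1 : Multiplicative ℤ))
      (a₂ := Multiplicative.ofAdd (1 : ℤ)) (b₁ := θ a) (b₂ := (1 : K))).symm
  have : (Multiplicative.ofAdd (1 : ℤ)) • a = θ a := by
    show (zpowersHom (K ≃ₐ[F] K) θ (Multiplicative.ofAdd 1)) • a = θ a
    simp
  simp [this]

theorem zpow_rel {R : Type*} [Ring R] (φ : K →+* R) (x : Rˣ)
    (h : ∀ a, (x : R) * φ a = φ (θ a) * x) (n : ℤ) (a : K) :
    ((x ^ n : Rˣ) : R) * φ a = φ ((θ ^ n) a) * ((x ^ n : Rˣ) : R) := by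
  have hi : ∀ a, ((x⁻¹ : Rˣ) : R) * φ a = φ (θ⁻¹ a) * ((x⁻¹ : Rˣ) : R) := by
    intro a
    rw [Units.inv_mul_eq_iff_eq_mul, ← mul_assoc, h, mul_assoc, Units.mul_inv, mul_one]
    congr 2
    exact (θ.apply_symm_apply a).symm
  induction n generalizing a with
  | zero => simp
  | succ n ih =>
    rw [zpow_add_one, zpow_add_one, Units.val_mul, mul_assoc, h, ← mul_assoc, ih, mul_assoc]; rfl
  | pred n ih =>
    rw [zpow_sub_one, zpow_sub_one, Units.val_mul, mul_assoc, hi, ← mul_assoc, ih, mul_assoc]; rfl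

/-- Universal property of `K[X^{±1}; θ]`. -/
def lift {R : Type*} [Ring R] (φ : K →+* R) (x : Rˣ)
    (h : ∀ a, (x : R) * φ a = φ (θ a) * x) : SkewLaurent θ →+* R :=
  letI := powAction θ
  SkewMonoidAlgebra.liftNCRingHom φ ((Units.coeHom R).comp (zpowersHom Rˣ x)) (by
    intro a n
    exact (zpow_rel φ x h (Multiplicative.toAdd n) a).symm)

theorem lift_const {R : Type*} [Ring R] (φ : K →+* R) (x : Rˣ)
    (h : ∀ a, (x : R) * φ a = φ (θ a) * x) (a : K) : lift φ x h (const θ a) = φ a := by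
  let := powAction θ
  refine (SkewMonoidAlgebra.liftNC_single (φ : K →+ R)
    ((Units.coeHom R).comp (zpowersHom Rˣ x)) (1 : Multiplicative ℤ) a).trans ?_
  simp

theorem lift_X {R : Type*} [Ring R] (φ : K →+* R) (x : Rˣ)
    (h : ∀ a, (x : R) * φ a = φ (θ a) * x) : lift φ x h (X θ) = x := by
  let := powAction θ
  refine (SkewMonoidAlgebra.liftNC_single (φ : K →+ R)
    ((Units.coeHom R).comp (zpowersHom Rˣ x)) (Multiplicative.ofAdd 1) 1).trans ?_
  simp

/-- Induction principle: every skew Laurent polynomial is a sum of terms `a X^n`. -/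
theorem induction {P : SkewLaurent θ → Prop} (hadd : ∀ f g, P f → P g → P (f + g))
    (hmul : ∀ f g, P f → P g → P (f * g)) (hc : ∀ a, P (const θ a)) (hX : P (X θ))
    (hXi : P ((X θ)⁻¹ : (SkewLaurent θ)ˣ)) (f : SkewLaurent θ) : P f := by
  have hm : ∀ n : ℤ, P ((X θ ^ n : (SkewLaurent θ)ˣ) : SkewLaurent θ) := by
    intro n
    induction n with
    | zero => simpa using hc 1
    | succ n ih => rw [zpow_add_one, Units.val_mul]; exact hmul _ _ ih hX
    | pred n ih => rw [zpow_sub_one, Units.val_mul]; exact hmul _ _ ih hXi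
  have hz : ∀ n : ℤ, ((X θ ^ n : (SkewLaurent θ)ˣ) : SkewLaurent θ)
      = monom θ (Multiplicative.ofAdd n) := by
    have hu : X θ = Units.map (monom θ) (toUnits (Multiplicative.ofAdd 1)) := Units.ext rfl
    intro n
    rw [hu, ← map_zpow, ← map_zpow, ← ofAdd_zsmul]
    simp
  refine SkewMonoidAlgebra.induction_on (k := K) (G := Multiplicative ℤ) (p := P) f ?_ ?_ ?_
  · have := hc 0
    rwa [map_zero] at this
  · intro n a
    have h1 := hmul _ _ (hc a) (hm (Multiplicative.toAdd n))
    rw [hz] at h1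
    let := powAction θ
    have h2 := SkewMonoidAlgebra.single_mul_single (a₁ := (1 : Multiplicative ℤ))
      (a₂ := n) (b₁ := a) (b₂ := (1 : K))
    have h3 : (SkewMonoidAlgebra.single n a : SkewMonoidAlgebra K (Multiplicative ℤ))
        = const θ a * monom θ n := by
      refine Eq.trans ?_ h2.symm
      simp
    have h4 : P (const θ a * monom θ n) := h1
    rw [← h3] at h4
    exact h4
  · intro f g hf hg
    exact hadd _ _ hf hg

variable (θ)

/-- The structure map `F[Y] → K[X^{±1}; θ]`, `Y ↦ X ^ r`, where `r` is the order of `θ`. -/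
def ofCentre : F[X] →+* SkewLaurent θ :=
  Polynomial.eval₂RingHom' ((const θ).comp (algebraMap F K))
    ((X θ : SkewLaurent θ) ^ orderOf θ) (by
      intro a
      refine Commute.pow_right ?_ _
      show _ * _ = _ * _
      rw [RingHom.comp_apply, X_mul_const, AlgEquiv.commutes])

theorem ofCentre_C (a : F) : ofCentre θ (C a) = const θ (algebraMap F K a) := by
  show eval₂ _ _ _ = _
  simp

theorem ofCentre_X : ofCentre θ Polynomial.X = (X θ : SkewLaurent θ) ^ orderOf θ := by
  show eval₂ _ _ _ = _
  simp

theorem ofCentre_commute (p : F[X]) (f : SkewLaurent θ) : Commute (ofCentre θ p) f := by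
  have hr : ∀ n : ℕ, ∀ b : K, Commute (((X θ : SkewLaurent θ) ^ orderOf θ) ^ n) (const θ b) := by
    intro n b
    refine Commute.pow_left ?_ n
    have h := zpow_rel (const θ) (X θ) X_mul_const (orderOf θ : ℤ) b
    rw [zpow_natCast, zpow_natCast, pow_orderOf_eq_one, Units.val_pow_eq_pow_val] at h
    exact h
  induction p using Polynomial.induction_on' with
  | add p q hp hq => rw [map_add]; exact hp.add_left hq
  | monomial n a =>
    rw [← C_mul_X_pow_eq_monomial, map_mul, map_pow, ofCentre_C, ofCentre_X]
    have ha : Commute (const θ (algebraMap F K a)) (X θ : SkewLaurent θ) := by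
      have h := X_mul_const (θ := θ) (algebraMap F K a)
      rw [AlgEquiv.commutes] at h
      exact h.symm
    have hX : Commute (const θ (algebraMap F K a) * ((X θ : SkewLaurent θ) ^ orderOf θ) ^ n)
        (X θ : SkewLaurent θ) :=
      ha.mul_left (((Commute.refl _).pow_left _).pow_left _)
    refine induction (P := fun f => Commute _ f) (fun _ _ h h' => h.add_right h')
      (fun _ _ h h' => h.mul_right h') ?_ hX hX.units_inv_right f
    intro b
    refine Commute.mul_left ?_ (hr n b)
    show _ * _ = _ * _
    rw [← map_mul, ← map_mul, mul_comm]

instance : Algebra F[X] (SkewLaurent θ) :=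
  (ofCentre θ).toAlgebra' (fun p f => (ofCentre_commute θ p f).eq)

theorem algebraMap_def (p : F[X]) : algebraMap F[X] (SkewLaurent θ) p = ofCentre θ p := rfl

end SkewLaurent

/-- Ring homomorphisms out of a tensor product `A ⊗[R] B`, from commuting homomorphisms. -/
def tensorLift {R A B S : Type*} [CommRing R] [CommRing A] [Ring B] [Ring S] [Algebra R A]
    [Algebra R B] (ψ : A →+* S) (φ : B →+* S) (hc : ∀ a b, Commute (ψ a) (φ b))
    (hR : ∀ r, ψ (algebraMap R A r) = φ (algebraMap R B r)) : A ⊗[R] B →+* S :=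
  let f : A ⊗[R] B →+ S := TensorProduct.liftAddHom
    ((AddMonoidHom.mul.comp ψ.toAddMonoidHom).compr₂ (AddMonoidHom.id S) |>.compl₂
      φ.toAddMonoidHom) (by
        intro r a b
        show ψ (r • a) * φ b = ψ a * φ (r • b)
        rw [Algebra.smul_def, Algebra.smul_def, mul_comm (algebraMap R A r) a, map_mul, map_mul,
          mul_assoc, hR])
  have hf : ∀ a b, f (a ⊗ₜ b) = ψ a * φ b := fun a b => rfl
  { f with
    map_one' := by
      show f 1 = 1
      rw [Algebra.TensorProduct.one_def, hf, map_one, map_one, one_mul]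
    map_mul' := by
      intro x y
      show f (x * y) = f x * f y
      induction x using TensorProduct.induction_on with
      | zero => simp
      | add x x' hx hx' => rw [add_mul, map_add, map_add, add_mul, hx, hx']
      | tmul a b =>
        induction y using TensorProduct.induction_on with
        | zero => simp
        | add x x' hx hx' => rw [mul_add, map_add, map_add, mul_add, hx, hx']
        | tmul a' b' =>
          rw [Algebra.TensorProduct.tmul_mul_tmul, hf, hf, hf, map_mul, map_mul, mul_assoc,
            mul_assoc, ← mul_assoc (ψ a'), (hc a' b).eq, mul_assoc] }

theorem tensorLift_tmul {R A B S : Type*} [CommRing R] [CommRing A] [Ring B] [Ring S] [Algebra R A]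
    [Algebra R B] (ψ : A →+* S) (φ : B →+* S) (hc : ∀ a b, Commute (ψ a) (φ b))
    (hR : ∀ r, ψ (algebraMap R A r) = φ (algebraMap R B r)) (a : A) (b : B) :
    tensorLift ψ φ hc hR (a ⊗ₜ b) = ψ a * φ b := rfl

/-- The base change `B ⊗_{F[Y]} K[X^{±1}; θ]` along a commutative `F[Y]`-algebra `B`. -/
abbrev BC (B : Type*) [CommRing B] [Algebra F[X] B] (θ : K ≃ₐ[F] K) : Type _ :=
  B ⊗[F[X]] SkewLaurent θ

/-- `Frac(K[X^{±1}; θ]) = F(Y) ⊗_{F[Y]} K[X^{±1}; θ]`. -/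
abbrev SkewFrac (θ : K ≃ₐ[F] K) : Type _ := BC (RatFunc F) θ


namespace BC

variable (B : Type*) [CommRing B] [Algebra F[X] B] (θ : K ≃ₐ[F] K)

/-- The inclusion `B → B ⊗_{F[Y]} K[X^{±1}; θ]`. -/
def inl : B →+* BC B θ := Algebra.TensorProduct.includeLeftRingHom

/-- The canonical map `K[X^{±1}; θ] → B ⊗_{F[Y]} K[X^{±1}; θ]`. -/
def inr : SkewLaurent θ →+* BC B θ :=
  (Algebra.TensorProduct.includeRight : SkewLaurent θ →ₐ[F[X]] BC B θ).toRingHom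

/-- The constants `K → B ⊗_{F[Y]} K[X^{±1}; θ]`. -/
def const : K →+* BC B θ := (inr B θ).comp (SkewLaurent.const θ)

/-- The variable `X` in `B ⊗_{F[Y]} K[X^{±1}; θ]`. -/
def X : (BC B θ)ˣ := Units.map (inr B θ : SkewLaurent θ →* BC B θ) (SkewLaurent.X θ)

variable {B θ}

theorem tmul_eq (b : B) (f : SkewLaurent θ) :
    (b ⊗ₜ f : BC B θ) = inl B θ b * inr B θ f := by
  show _ = (b ⊗ₜ 1 : BC B θ) * (1 ⊗ₜ f)
  rw [Algebra.TensorProduct.tmul_mul_tmul, mul_one, one_mul]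

theorem inl_algebraMap (p : F[X]) :
    inl B θ (algebraMap F[X] B p) = inr B θ (SkewLaurent.ofCentre θ p) := by
  show (algebraMap F[X] B p ⊗ₜ 1 : BC B θ) = 1 ⊗ₜ (algebraMap F[X] (SkewLaurent θ) p)
  rw [Algebra.algebraMap_eq_smul_one, Algebra.algebraMap_eq_smul_one, TensorProduct.smul_tmul]

theorem inl_commute (b : B) (x : BC B θ) : Commute (inl B θ b) x := by
  induction x using TensorProduct.induction_on with
  | zero => exact Commute.zero_right _
  | add x y hx hy => exact hx.add_right hy
  | tmul c f =>
    show (b ⊗ₜ 1 : BC B θ) * (c ⊗ₜ f) = (c ⊗ₜ f : BC B θ) * (b ⊗ₜ 1)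
    rw [Algebra.TensorProduct.tmul_mul_tmul, Algebra.TensorProduct.tmul_mul_tmul, mul_one, one_mul,
      mul_comm]

theorem X_mul_const (a : K) :
    (X B θ : BC B θ) * const B θ a = const B θ (θ a) * X B θ := by
  show inr B θ _ * inr B θ _ = inr B θ _ * inr B θ _
  rw [← map_mul, ← map_mul, SkewLaurent.X_mul_const]

theorem inl_Y : inl B θ (algebraMap F[X] B Polynomial.X) = (X B θ : BC B θ) ^ orderOf θ := by
  rw [inl_algebraMap, SkewLaurent.ofCentre_X, map_pow]; rfl

theorem inl_C (a : F) :
    inl B θ (algebraMap F[X] B (C a)) = const B θ (algebraMap F K a) := by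
  rw [inl_algebraMap, SkewLaurent.ofCentre_C]; rfl

variable (B θ) in
/-- The inclusion `B ⊗_F K = B ⊗_{F[Y]} K[Y] → B ⊗_{F[Y]} K[X^{±1}; θ]`. -/
def comm [Algebra F B] [IsScalarTower F F[X] B] : B ⊗[F] K →+* BC B θ :=
  tensorLift (inl B θ) (const B θ) (fun _ _ => inl_commute _ _) (fun a => by
    rw [IsScalarTower.algebraMap_apply F F[X] B]; exact inl_C a)

variable (θ) in
/-- Functoriality of the base change. -/
def map {B' : Type*} [CommRing B'] [Algebra F[X] B'] (g : B →ₐ[F[X]] B') : BC B θ →+* BC B' θ :=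
  (Algebra.TensorProduct.map g (AlgHom.id F[X] (SkewLaurent θ))).toRingHom

/-- Homomorphisms out of the base change. -/
def lift {S : Type*} [Ring S] (ψ : B →+* S) (φ : K →+* S) (x : Sˣ)
    (h : ∀ a, (x : S) * φ a = φ (θ a) * x) (hφ : ∀ b a, Commute (ψ b) (φ a))
    (hx : ∀ b, Commute (ψ b) x)
    (hY : ψ (algebraMap F[X] B Polynomial.X) = (x : S) ^ orderOf θ)
    (hC : ∀ a : F, ψ (algebraMap F[X] B (C a)) = φ (algebraMap F K a)) : BC B θ →+* S :=
  tensorLift ψ (SkewLaurent.lift φ x h) (by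
    intro b f
    refine SkewLaurent.induction (P := fun f => Commute (ψ b) (SkewLaurent.lift φ x h f))
      ?_ ?_ ?_ ?_ ?_ f
    · intro f g hf hg; rw [map_add]; exact hf.add_right hg
    · intro f g hf hg; rw [map_mul]; exact hf.mul_right hg
    · intro a; rw [SkewLaurent.lift_const]; exact hφ b a
    · rw [SkewLaurent.lift_X]; exact hx b
    · have : SkewLaurent.lift φ x h ((SkewLaurent.X θ)⁻¹ : (SkewLaurent θ)ˣ) = (x⁻¹ : Sˣ) := by
        rw [← Units.mul_eq_one_iff_eq_inv, ← SkewLaurent.lift_X φ x h, ← map_mul, Units.inv_mul,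
          map_one]
      rw [this]; exact (hx b).units_inv_right) (by
    intro p
    rw [SkewLaurent.algebraMap_def]
    have : ψ.comp (algebraMap F[X] B) = (SkewLaurent.lift φ x h).comp (SkewLaurent.ofCentre θ) := by
      refine Polynomial.ringHom_ext ?_ ?_
      · intro a
        simp only [RingHom.comp_apply]
        rw [hC, SkewLaurent.ofCentre_C, SkewLaurent.lift_const]
      · simp only [RingHom.comp_apply]
        rw [hY, SkewLaurent.ofCentre_X, map_pow, SkewLaurent.lift_X]
    exact DFunLike.congr_fun this p)

section lift

variable {S : Type*} [Ring S] (ψ : B →+* S) (φ : K →+* S) (x : Sˣ)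
    (h : ∀ a, (x : S) * φ a = φ (θ a) * x) (hφ : ∀ b a, Commute (ψ b) (φ a))
    (hx : ∀ b, Commute (ψ b) x)
    (hY : ψ (algebraMap F[X] B Polynomial.X) = (x : S) ^ orderOf θ)
    (hC : ∀ a : F, ψ (algebraMap F[X] B (C a)) = φ (algebraMap F K a))

theorem lift_inl (b : B) : lift ψ φ x h hφ hx hY hC (inl B θ b) = ψ b := by
  exact (congrArg (ψ b * ·) (map_one (SkewLaurent.lift φ x h))).trans (mul_one _)

theorem lift_inr (f : SkewLaurent θ) :
    lift ψ φ x h hφ hx hY hC (inr B θ f) = SkewLaurent.lift φ x h f := by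
  exact (congrArg (· * SkewLaurent.lift φ x h f) (map_one ψ)).trans (one_mul _)

theorem lift_const (a : K) : lift ψ φ x h hφ hx hY hC (const B θ a) = φ a := by
  show lift ψ φ x h hφ hx hY hC (inr B θ _) = _
  rw [lift_inr, SkewLaurent.lift_const]

theorem lift_X : lift ψ φ x h hφ hx hY hC (X B θ) = x := by
  show lift ψ φ x h hφ hx hY hC (inr B θ _) = _
  rw [lift_inr, SkewLaurent.lift_X]

end lift

end BC

end Ring

section Series

theorem exists_root_step {R : Type*} [CommRing R] (r : ℕ) (s : R) (hs : (r : R) * s = 1)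
    (u c : PowerSeries R) (hc : PowerSeries.constantCoeff c = 1) (n : ℕ)
    (h : (PowerSeries.X : PowerSeries R) ^ (n + 1) ∣ c ^ r - u) :
    ∃ c' : PowerSeries R, PowerSeries.constantCoeff c' = 1 ∧ (PowerSeries.X : PowerSeries R) ^ (n + 1) ∣ c' - c ∧
      (PowerSeries.X : PowerSeries R) ^ (n + 2) ∣ c' ^ r - u := by
  obtain ⟨e, he⟩ := h
  set y : PowerSeries R := -(PowerSeries.X ^ (n + 1) * PowerSeries.C (s * PowerSeries.constantCoeff e)) with hy
  refine ⟨c + y, by simp [hy, hc], ⟨-PowerSeries.C (s * PowerSeries.constantCoeff e), by rw [hy]; ring⟩, ?_⟩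
  obtain ⟨k, hk⟩ := Polynomial.powAddExpansion c y r
  have h1 : (PowerSeries.X : PowerSeries R) ∣ e - (r : PowerSeries R) * c ^ (r - 1) * PowerSeries.C (s * PowerSeries.constantCoeff e) := by
    rw [PowerSeries.X_dvd_iff]
    simp only [map_sub, map_mul, map_pow, hc, one_pow, mul_one, PowerSeries.constantCoeff_C, map_natCast]
    rw [← mul_assoc, hs, one_mul, sub_self]
  obtain ⟨g, hg⟩ := h1
  refine ⟨g + k * PowerSeries.X ^ n * PowerSeries.C (s * PowerSeries.constantCoeff e) ^ 2, ?_⟩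
  have h2 : (c + y) ^ r - u = PowerSeries.X ^ (n + 1) *
      (e - (r : PowerSeries R) * c ^ (r - 1) * PowerSeries.C (s * PowerSeries.constantCoeff e)) + k * y ^ 2 := by
    rw [hk, show c ^ r + (r : PowerSeries R) * c ^ (r - 1) * y + k * y ^ 2 - u
      = (c ^ r - u) + (r : PowerSeries R) * c ^ (r - 1) * y + k * y ^ 2 by ring, he, hy]
    ring
  rw [h2, hg, hy]
  ring

/-- A power series with constant coefficient `1` has an `r`-th root with constant coefficient `1`
when `r` is invertible. -/
theorem exists_root {R : Type*} [CommRing R] (r : ℕ) (hr : IsUnit (r : R)) (u : PowerSeries R)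
    (hu : PowerSeries.constantCoeff u = 1) : ∃ c : PowerSeries R, PowerSeries.constantCoeff c = 1 ∧ c ^ r = u := by
  obtain ⟨s, hs⟩ := hr.exists_right_inv
  let P : ℕ → PowerSeries R → Prop := fun n c =>
    PowerSeries.constantCoeff c = 1 ∧ (PowerSeries.X : PowerSeries R) ^ (n + 1) ∣ c ^ r - u
  have step : ∀ n (c : {c // P n c}), ∃ c' : {c // P (n + 1) c},
      (PowerSeries.X : PowerSeries R) ^ (n + 1) ∣ c'.1 - c.1 := by
    rintro n ⟨c, hc, h⟩
    obtain ⟨c', h1, h2, h3⟩ := exists_root_step r s hs u c hc n h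
    exact ⟨⟨c', h1, h3⟩, h2⟩
  choose f hf using step
  have h0 : P 0 1 := ⟨by simp, by
    rw [zero_add, pow_one, PowerSeries.X_dvd_iff]; simp [hu]⟩
  let c : (n : ℕ) → {c // P n c} := fun n => Nat.rec ⟨1, h0⟩ (fun n c => f n c) n
  have hcs : ∀ n, (PowerSeries.X : PowerSeries R) ^ (n + 1) ∣ (c (n + 1)).1 - (c n).1 :=
    fun n => hf n (c n)
  have hstab : ∀ k m, PowerSeries.coeff k (c (k + m)).1 = PowerSeries.coeff k (c k).1 := by
    intro k m
    induction m with
    | zero => rfl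
    | succ m ih =>
      rw [← ih, ← sub_eq_zero, ← map_sub]
      exact (PowerSeries.X_pow_dvd_iff.1 (hcs (k + m))) k (by omega)
  let d : PowerSeries R := PowerSeries.mk fun n => PowerSeries.coeff n (c n).1
  have hd : ∀ n, (PowerSeries.X : PowerSeries R) ^ (n + 1) ∣ d - (c n).1 := by
    intro n
    rw [PowerSeries.X_pow_dvd_iff]
    intro k hk
    obtain ⟨m, rfl⟩ : ∃ m, n = k + m := ⟨n - k, by omega⟩
    rw [map_sub, PowerSeries.coeff_mk, hstab, sub_self]
  refine ⟨d, ?_, ?_⟩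
  · rw [← PowerSeries.coeff_zero_eq_constantCoeff_apply, PowerSeries.coeff_mk,
      PowerSeries.coeff_zero_eq_constantCoeff_apply]
    exact (c 0).2.1
  · rw [← sub_eq_zero]
    ext n
    have h1 : (PowerSeries.X : PowerSeries R) ^ (n + 1) ∣ d ^ r - u := by
      have h2 := (hd n).trans (sub_dvd_pow_sub_pow d (c n).1 r)
      have := dvd_add h2 (c n).2.2
      rwa [sub_add_sub_cancel] at this
    exact (PowerSeries.X_pow_dvd_iff.1 h1) n (by omega)

variable {F : Type*} [Field F] (E : Type*) [CommRing E] [Algebra F[X] E]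

/-- The expansion `p(Y) ↦ p(y + T)` of polynomials, where `y` is the image of `Y` in `E`. -/
def shift : F[X] →+* PowerSeries E :=
  Polynomial.eval₂RingHom ((PowerSeries.C).comp ((algebraMap F[X] E).comp Polynomial.C))
    (PowerSeries.C (algebraMap F[X] E Polynomial.X) + PowerSeries.X)

theorem shift_C (a : F) : shift E (C a) = PowerSeries.C (algebraMap F[X] E (C a)) := by
  simp [shift]

theorem shift_X : shift (F := F) E Polynomial.X =
    PowerSeries.C (algebraMap F[X] E Polynomial.X) + PowerSeries.X := by
  simp [shift]

theorem constantCoeff_shift (p : F[X]) :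
    PowerSeries.constantCoeff (shift E p) = algebraMap F[X] E p := by
  have : (PowerSeries.constantCoeff).comp (shift (F := F) E) = algebraMap F[X] E := by
    refine Polynomial.ringHom_ext ?_ ?_
    · intro a; simp [shift_C]
    · simp [shift_X]
  exact DFunLike.congr_fun this p

theorem shift_expansion (p : F[X]) : ∃ k, shift E p = PowerSeries.C (algebraMap F[X] E p) +
    PowerSeries.C (algebraMap F[X] E (derivative p)) * PowerSeries.X + k * PowerSeries.X ^ 2 := by
  set i : F →+* PowerSeries E := (PowerSeries.C).comp ((algebraMap F[X] E).comp Polynomial.C)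
  have hev : ∀ q : F[X], (q.map i).eval (PowerSeries.C (algebraMap F[X] E Polynomial.X))
      = PowerSeries.C (algebraMap F[X] E q) := by
    intro q
    rw [eval_map]
    have : Polynomial.eval₂RingHom i (PowerSeries.C (algebraMap F[X] E Polynomial.X))
        = (PowerSeries.C).comp (algebraMap F[X] E) := by
      refine Polynomial.ringHom_ext ?_ ?_
      · intro a; simp [i]
      · simp
    exact DFunLike.congr_fun this q
  obtain ⟨k, hk⟩ := Polynomial.binomExpansion (p.map i)
    (PowerSeries.C (algebraMap F[X] E Polynomial.X)) PowerSeries.X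
  refine ⟨k, ?_⟩
  rw [derivative_map, hev, hev, eval_map] at hk
  exact hk

variable {E}

theorem isUnit_of_isCoprime {N : F[X]} (hN : algebraMap F[X] E N = 0) {q : F[X]}
    (h : IsCoprime q N) : IsUnit (algebraMap F[X] E q) := by
  obtain ⟨a, b, hab⟩ := h
  refine IsUnit.of_mul_eq_one (algebraMap F[X] E a) ?_
  have := congrArg (algebraMap F[X] E) hab
  rw [map_add, map_mul, map_mul, hN, mul_zero, add_zero, map_one] at this
  rw [mul_comm, this]

theorem isUnit_shift {N : F[X]} (hN : algebraMap F[X] E N = 0) (hirr : Irreducible N)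
    (hsep : N.Separable) {p : F[X]} (hp : p ≠ 0) :
    IsUnit (HahnSeries.ofPowerSeries ℤ E (shift E p)) := by
  have hX : IsUnit (HahnSeries.ofPowerSeries ℤ E PowerSeries.X) := by
    rw [HahnSeries.ofPowerSeries_X]
    refine IsUnit.of_mul_eq_one (HahnSeries.single (-1) 1) ?_
    rw [HahnSeries.single_mul_single]
    simp
  obtain ⟨k, q, hq, rfl⟩ := WfDvdMonoid.max_power_factor hp hirr
  rw [map_mul, map_mul, map_pow, map_pow]
  refine IsUnit.mul (IsUnit.pow _ ?_) (IsUnit.map _ ?_)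
  · obtain ⟨e, he⟩ := shift_expansion E N
    rw [hN, map_zero, zero_add, pow_two, ← mul_assoc, ← add_mul] at he
    rw [he, map_mul]
    refine IsUnit.mul (IsUnit.map _ ?_) hX
    rw [PowerSeries.isUnit_iff_constantCoeff]
    simp only [map_add, map_mul, PowerSeries.constantCoeff_C, PowerSeries.constantCoeff_X,
      mul_zero, add_zero]
    exact isUnit_of_isCoprime hN hsep.symm
  · rw [PowerSeries.isUnit_iff_constantCoeff, constantCoeff_shift]
    exact isUnit_of_isCoprime hN ((hirr.coprime_iff_not_dvd.2 hq).symm)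

/-- The expansion `f(Y) ↦ f(y + T)` of rational functions. -/
def ratTaylor {N : F[X]} (hN : algebraMap F[X] E N = 0) (hirr : Irreducible N)
    (hsep : N.Separable) : RatFunc F →+* LaurentSeries E :=
  IsLocalization.lift (M := nonZeroDivisors F[X])
    (g := (HahnSeries.ofPowerSeries ℤ E).comp (shift E))
    (fun p => isUnit_shift hN hirr hsep (nonZeroDivisors.ne_zero p.2))

theorem ratTaylor_algebraMap {N : F[X]} (hN : algebraMap F[X] E N = 0) (hirr : Irreducible N)
    (hsep : N.Separable) (p : F[X]) : ratTaylor hN hirr hsep (algebraMap F[X] (RatFunc F) p)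
      = HahnSeries.ofPowerSeries ℤ E (shift E p) :=
  IsLocalization.lift_eq _ _

end Series

section Taylor

variable {F K : Type*} [Field F] [Field K] [Algebra F K]

/-- The properties of a canonical Taylor morphism
`τ : L ⊗ K[X^{±1}; θ] → (E ⊗ K[X^{±1}; θ])((T))`: it is `K`-linear, it maps `Y` to `Y + T`, and it
maps `X` to `c X` for some series `c ∈ E[[T]]` with `c ≡ 1` modulo `T`. -/
structure IsCanonicalTaylor (L E : Type*) [CommRing L] [CommRing E] [Algebra F[X] L]
    [Algebra F[X] E] (θ : K ≃ₐ[F] K) (τ : BC L θ →+* LaurentSeries (BC E θ)) : Prop where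
  map_const : ∀ a : K, τ (BC.const L θ a) = HahnSeries.C (BC.const E θ a)
  map_Y : τ (BC.inl L θ (algebraMap F[X] L Polynomial.X)) =
    HahnSeries.C (BC.inl E θ (algebraMap F[X] E Polynomial.X)) + HahnSeries.single 1 1
  map_X : ∃ c : PowerSeries E, PowerSeries.constantCoeff c = 1 ∧
    τ (BC.X L θ) = HahnSeries.ofPowerSeries ℤ (BC E θ) (PowerSeries.map (BC.inl E θ) c) *
      HahnSeries.C (BC.X E θ : BC E θ)

/-- Coefficientwise application of a ring homomorphism to Laurent series. -/
def laurentMap {R S : Type*} [Ring R] [Ring S] (f : R →+* S) :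
    LaurentSeries R →+* LaurentSeries S where
  toFun x := HahnSeries.map x f
  map_one' := HahnSeries.map_one f.toMonoidWithZeroHom
  map_mul' x y := HahnSeries.map_mul (f : R →ₙ+* S)
  map_zero' := by ext; simp
  map_add' x y := by ext; simp

theorem coeff_ofPowerSeries_neg {R : Type*} [Ring R] (p : PowerSeries R) {n : ℤ}
    (hn : ¬ 0 ≤ n) : (HahnSeries.ofPowerSeries ℤ R p).coeff n = 0 := by
  rw [HahnSeries.ofPowerSeries_apply]
  refine HahnSeries.embDomain_of_notMem_range ?_
  rintro ⟨k, hk⟩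
  simp at hk
  omega

theorem laurentMap_ofPowerSeries {R S : Type*} [Ring R] [Ring S] (f : R →+* S)
    (p : PowerSeries R) : laurentMap f (HahnSeries.ofPowerSeries ℤ R p) =
      HahnSeries.ofPowerSeries ℤ S (PowerSeries.map f p) := by
  ext n
  show f _ = _
  by_cases hn : 0 ≤ n
  · obtain ⟨k, rfl⟩ := Int.eq_ofNat_of_zero_le hn
    have h1 := HahnSeries.ofPowerSeries_apply_coeff (Γ := ℤ) p k
    have h2 := HahnSeries.ofPowerSeries_apply_coeff (Γ := ℤ) (PowerSeries.map f p) k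
    exact (congrArg f h1).trans (h2.trans (PowerSeries.coeff_map f k p)).symm
  · rw [coeff_ofPowerSeries_neg _ hn, coeff_ofPowerSeries_neg _ hn, map_zero]

theorem laurentMap_C {R S : Type*} [Ring R] [Ring S] (f : R →+* S) (a : R) :
    laurentMap f (HahnSeries.C a) = HahnSeries.C (f a) := by
  rw [← HahnSeries.ofPowerSeries_C, laurentMap_ofPowerSeries, PowerSeries.map_C,
    HahnSeries.ofPowerSeries_C]

theorem laurentMap_commute_C {R S : Type*} [Ring R] [Ring S] (f : R →+* S)
    (x : LaurentSeries R) (a : S) (h : ∀ b, Commute (f b) a) :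
    Commute (laurentMap f x) (HahnSeries.C a) := by
  ext n
  show (laurentMap f x * HahnSeries.single 0 a).coeff n =
    (HahnSeries.single 0 a * laurentMap f x).coeff n
  rw [HahnSeries.coeff_mul_single_zero, HahnSeries.coeff_single_zero_mul]
  exact h _

theorem exists_isCanonicalTaylor {L E : Type*} [CommRing L] [CommRing E] [Algebra F[X] L]
    [Algebra F[X] E] (θ : K ≃ₐ[F] K) (hr : (orderOf θ : F) ≠ 0)
    (hy : IsUnit (algebraMap F[X] E Polynomial.X)) (l : L →+* LaurentSeries E)
    (hl : ∀ p : F[X], l (algebraMap F[X] L p) = HahnSeries.ofPowerSeries ℤ E (shift E p)) :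
    ∃ τ : BC L θ →+* LaurentSeries (BC E θ), IsCanonicalTaylor L E θ τ ∧
      ∀ b : L, τ (BC.inl L θ b) = laurentMap (BC.inl E θ) (l b) := by
  have hrE : IsUnit ((orderOf θ : ℕ) : E) := by
    have := (IsUnit.mk0 _ hr).map ((algebraMap F[X] E).comp Polynomial.C)
    rwa [map_natCast] at this
  obtain ⟨y, hy⟩ := hy
  obtain ⟨c, hc, hcr⟩ := exists_root (orderOf θ) hrE
    (1 + PowerSeries.C ((y⁻¹ : Eˣ) : E) * PowerSeries.X) (by simp)
  set c' : LaurentSeries (BC E θ) := laurentMap (BC.inl E θ) (HahnSeries.ofPowerSeries ℤ E c)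
    with hc'
  have hcu : IsUnit c' := by
    refine IsUnit.map _ (IsUnit.map _ ?_)
    rw [PowerSeries.isUnit_iff_constantCoeff, hc]
    exact isUnit_one
  have hXu : IsUnit (HahnSeries.C (Γ := ℤ) (BC.X E θ : BC E θ)) := (BC.X E θ).isUnit.map _
  obtain ⟨x, hx⟩ := hcu.mul hXu
  have hcomm : ∀ (e : LaurentSeries E) (a : BC E θ),
      Commute (laurentMap (BC.inl E θ) e) (HahnSeries.C a) :=
    fun e a => laurentMap_commute_C _ _ _ (fun b => BC.inl_commute b a)
  have hcc : ∀ e e' : LaurentSeries E,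
      Commute (laurentMap (BC.inl E θ) e) (laurentMap (BC.inl E θ) e') := by
    intro e e'
    show _ * _ = _ * _
    rw [← map_mul, ← map_mul, mul_comm]
  have hY : (laurentMap (BC.inl E θ)) (l (algebraMap F[X] L Polynomial.X)) =
      (x : LaurentSeries (BC E θ)) ^ orderOf θ := by
    rw [hx, (hcomm _ _).mul_pow, ← map_pow, ← map_pow, hcr, hl, shift_X, ← map_pow, ← BC.inl_Y,
      ← laurentMap_C, ← map_mul, ← HahnSeries.ofPowerSeries_C, ← map_mul, ← hy]
    congr 2
    rw [add_mul, one_mul, mul_right_comm, ← map_mul, Units.inv_mul, map_one, one_mul]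
  have hC : ∀ a : F, (laurentMap (BC.inl E θ)) (l (algebraMap F[X] L (C a))) =
      (HahnSeries.C (Γ := ℤ)).comp (BC.const E θ) (algebraMap F K a) := by
    intro a
    rw [hl, shift_C, HahnSeries.ofPowerSeries_C, laurentMap_C, BC.inl_C]; rfl
  refine ⟨BC.lift ((laurentMap (BC.inl E θ)).comp l)
    ((HahnSeries.C (Γ := ℤ)).comp (BC.const E θ)) x ?_ ?_ ?_ hY hC, ⟨?_, ?_, c, hc, ?_⟩, ?_⟩
  · intro a
    simp only [RingHom.comp_apply]
    rw [hx, mul_assoc, ← map_mul, BC.X_mul_const, map_mul, ← mul_assoc, (hcomm _ _).eq, mul_assoc]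
  · intro b a
    exact hcomm _ _
  · intro b
    rw [hx]
    exact (hcc _ _).mul_right (hcomm _ _)
  · intro a
    rw [BC.lift_const]; rfl
  · rw [BC.lift_inl]
    simp only [RingHom.comp_apply]
    rw [hl, shift_X, map_add, map_add, HahnSeries.ofPowerSeries_C, laurentMap_C,
      laurentMap_ofPowerSeries, PowerSeries.map_X, HahnSeries.ofPowerSeries_X]
  · rw [BC.lift_X, hx, hc', laurentMap_ofPowerSeries]
  · intro b
    rw [BC.lift_inl]; rfl

end Taylor

section Points

variable {F K Fs : Type*} [Field F] [Field K] [Algebra F K] [Field Fs] [Algebra F Fs]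

/-- The residue field `F[Y] / N` of a closed point, where `N` is the minimal polynomial of `z`. -/
def ResField (F : Type*) {Fs : Type*} [Field F] [Field Fs] [Algebra F Fs] (z : Fs) : Type _ :=
  F[X] ⧸ Ideal.span {minpoly F z}

instance (z : Fs) : CommRing (ResField F z) :=
  inferInstanceAs (CommRing (F[X] ⧸ Ideal.span {minpoly F z}))

instance (z : Fs) : Algebra F[X] (ResField F z) :=
  inferInstanceAs (Algebra F[X] (F[X] ⧸ Ideal.span {minpoly F z}))

instance (z : Fs) : Algebra F (ResField F z) :=
  inferInstanceAs (Algebra F (F[X] ⧸ Ideal.span {minpoly F z}))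

instance (z : Fs) : IsScalarTower F F[X] (ResField F z) :=
  inferInstanceAs (IsScalarTower F F[X] (F[X] ⧸ Ideal.span {minpoly F z}))

theorem algebraMap_resField_minpoly (z : Fs) :
    algebraMap F[X] (ResField F z) (minpoly F z) = 0 :=
  Ideal.Quotient.eq_zero_iff_mem.2 (Ideal.mem_span_singleton_self _)

/-- Homomorphisms out of the residue field `F[Y] / N`. -/
def ResField.lift {R S : Type*} [CommRing R] [Algebra R F[X]] [CommRing S] [Algebra R S] {z : Fs}
    [Algebra R (ResField F z)] [IsScalarTower R F[X] (ResField F z)]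
    (g : F[X] →ₐ[R] S) (hg : g (minpoly F z) = 0) : ResField F z →ₐ[R] S where
  __ := Ideal.Quotient.lift (Ideal.span {minpoly F z}) (g : F[X] →+* S) (fun p hp => by
    obtain ⟨q, rfl⟩ := Ideal.mem_span_singleton'.1 hp
    show g (q * minpoly F z) = 0
    rw [map_mul, hg, mul_zero])
  commutes' a := by
    rw [IsScalarTower.algebraMap_apply R F[X] (ResField F z)]
    exact g.commutes a

theorem ResField.lift_algebraMap {R S : Type*} [CommRing R] [Algebra R F[X]] [CommRing S]
    [Algebra R S] {z : Fs} [Algebra R (ResField F z)] [IsScalarTower R F[X] (ResField F z)]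
    (g : F[X] →ₐ[R] S) (hg : g (minpoly F z) = 0) (p : F[X]) :
    ResField.lift g hg (algebraMap F[X] (ResField F z) p) = g p := rfl

section Ext

variable {L : Type*} [Field L] [Algebra F[X] L]

variable (F) in
/-- The localisation `F[Y]_{(N)}[ρ] ⊆ L`, where `N` is the minimal polynomial of `z`: the elements
`x` of `L` such that `b x` is a polynomial in `ρ` with coefficients in `F[Y]` for some `b ∈ F[Y]`
with `b(z) ≠ 0`. -/
def localRing (z : Fs) (ρ : L) : Subalgebra F[X] L where
  carrier := {x | ∃ b : F[X], aeval z b ≠ 0 ∧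
    algebraMap F[X] L b * x ∈ Algebra.adjoin F[X] {ρ}}
  mul_mem' := by
    rintro x y ⟨b, hb, hx⟩ ⟨c, hc, hy⟩
    refine ⟨b * c, by rw [map_mul]; exact mul_ne_zero hb hc, ?_⟩
    rw [map_mul, mul_mul_mul_comm]
    exact mul_mem hx hy
  add_mem' := by
    rintro x y ⟨b, hb, hx⟩ ⟨c, hc, hy⟩
    refine ⟨b * c, by rw [map_mul]; exact mul_ne_zero hb hc, ?_⟩
    have : algebraMap F[X] L (b * c) * (x + y) = algebraMap F[X] L c * (algebraMap F[X] L b * x) +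
        algebraMap F[X] L b * (algebraMap F[X] L c * y) := by
      rw [map_mul]; ring
    rw [this]
    exact add_mem (mul_mem (Subalgebra.algebraMap_mem _ _) hx)
      (mul_mem (Subalgebra.algebraMap_mem _ _) hy)
  algebraMap_mem' p := ⟨1, by simp, by
    rw [map_one, one_mul]; exact Subalgebra.algebraMap_mem _ _⟩

variable (F) in
/-- The residue ring `F[Y]_{(N)}[ρ] / N`, where `N` is the minimal polynomial of `z`. -/
def ResRing (z : Fs) (ρ : L) : Type _ :=
  localRing F z ρ ⧸ Ideal.span {algebraMap F[X] (localRing F z ρ) (minpoly F z)}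

instance (z : Fs) (ρ : L) : CommRing (ResRing F z ρ) :=
  inferInstanceAs (CommRing (localRing F z ρ ⧸
    Ideal.span {algebraMap F[X] (localRing F z ρ) (minpoly F z)}))

instance (z : Fs) (ρ : L) : Algebra F[X] (ResRing F z ρ) :=
  inferInstanceAs (Algebra F[X] (localRing F z ρ ⧸
    Ideal.span {algebraMap F[X] (localRing F z ρ) (minpoly F z)}))

instance (z : Fs) (ρ : L) [Algebra F L] [IsScalarTower F F[X] L] : Algebra F (ResRing F z ρ) :=
  inferInstanceAs (Algebra F (localRing F z ρ ⧸
    Ideal.span {algebraMap F[X] (localRing F z ρ) (minpoly F z)}))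

instance (z : Fs) (ρ : L) [Algebra F L] [IsScalarTower F F[X] L] :
    IsScalarTower F F[X] (ResRing F z ρ) :=
  inferInstanceAs (IsScalarTower F F[X] (localRing F z ρ ⧸
    Ideal.span {algebraMap F[X] (localRing F z ρ) (minpoly F z)}))

theorem algebraMap_resRing_minpoly (z : Fs) (ρ : L) :
    algebraMap F[X] (ResRing F z ρ) (minpoly F z) = 0 :=
  Ideal.Quotient.eq_zero_iff_mem.2 (Ideal.mem_span_singleton_self _)

/-- The canonical map `F[Y] / N → F[Y]_{(N)}[ρ] / N`. -/
def resMap (z : Fs) (ρ : L) : ResField F z →ₐ[F[X]] ResRing F z ρ :=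
  ResField.lift (Algebra.ofId F[X] (ResRing F z ρ)) (algebraMap_resRing_minpoly z ρ)

theorem isUnit_resRing {z : Fs} (hz : IsSeparable F z) (ρ : L) {p : F[X]}
    (hp : aeval z p ≠ 0) : IsUnit (algebraMap F[X] (ResRing F z ρ) p) := by
  refine isUnit_of_isCoprime (algebraMap_resRing_minpoly z ρ) ?_
  · refine (((minpoly.irreducible hz.isIntegral).coprime_iff_not_dvd).2 ?_).symm
    rintro ⟨q, rfl⟩
    exact hp (by simp)

theorem isUnit_resField {z : Fs} (hz : IsSeparable F z) {p : F[X]}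
    (hp : aeval z p ≠ 0) : IsUnit (algebraMap F[X] (ResField F z) p) := by
  refine isUnit_of_isCoprime (algebraMap_resField_minpoly z) ?_
  · refine (((minpoly.irreducible hz.isIntegral).coprime_iff_not_dvd).2 ?_).symm
    rintro ⟨q, rfl⟩
    exact hp (by simp)

theorem taylorExt_reduces {E : Type*} [CommRing E] [Algebra F[X] E] {z : Fs} {ρ : L}
    (hE : ∀ p : F[X], aeval z p ≠ 0 → IsUnit (algebraMap F[X] E p))
    (π : localRing F z ρ →ₐ[F[X]] E) (l : L →+* LaurentSeries E)
    (hl : ∀ p : F[X], l (algebraMap F[X] L p) = HahnSeries.ofPowerSeries ℤ E (shift E p))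
    {p₀ : F[X]} (hp₀ : aeval z p₀ ≠ 0) (b₁ : localRing F z ρ)
    (hb₁ : (b₁ : L) = algebraMap F[X] L p₀ * ρ) {s : PowerSeries E}
    (hs : PowerSeries.constantCoeff s = π b₁) (hls : l b₁ = HahnSeries.ofPowerSeries ℤ E s)
    (b : localRing F z ρ) : ∃ t : PowerSeries E,
      PowerSeries.constantCoeff t = π b ∧ l b = HahnSeries.ofPowerSeries ℤ E t := by
  let Good : L → Prop := fun x => ∃ hx : x ∈ localRing F z ρ, ∃ t : PowerSeries E,
    PowerSeries.constantCoeff t = π ⟨x, hx⟩ ∧ l x = HahnSeries.ofPowerSeries ℤ E t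
  have good_alg : ∀ p, Good (algebraMap F[X] L p) := fun p =>
    ⟨Subalgebra.algebraMap_mem _ _, shift E p,
      (constantCoeff_shift E p).trans (π.commutes p).symm, hl p⟩
  have good_add : ∀ x y, Good x → Good y → Good (x + y) := by
    rintro x y ⟨hx, t, ht, hlt⟩ ⟨hy, u, hu, hlu⟩
    refine ⟨add_mem hx hy, t + u, ?_, by rw [map_add, map_add, hlt, hlu]⟩
    rw [map_add, ht, hu, ← map_add]; rfl
  have good_mul : ∀ x y, Good x → Good y → Good (x * y) := by
    rintro x y ⟨hx, t, ht, hlt⟩ ⟨hy, u, hu, hlu⟩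
    refine ⟨mul_mem hx hy, t * u, ?_, by rw [map_mul, map_mul, hlt, hlu]⟩
    rw [map_mul, ht, hu, ← map_mul]; rfl
  have good_div : ∀ (p : F[X]) (x : L), aeval z p ≠ 0 → x ∈ localRing F z ρ →
      Good (algebraMap F[X] L p * x) → Good x := by
    rintro p x hp hx ⟨hy, t, ht, hlt⟩
    have hu : IsUnit (shift E p) := by
      rw [PowerSeries.isUnit_iff_constantCoeff, constantCoeff_shift]
      exact hE p hp
    obtain ⟨v, hv⟩ := hu
    refine ⟨hx, ((v⁻¹ : (PowerSeries E)ˣ) : PowerSeries E) * t, ?_, ?_⟩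
    · have h1 : PowerSeries.constantCoeff (v : PowerSeries E) *
          PowerSeries.constantCoeff (((v⁻¹ : (PowerSeries E)ˣ) : PowerSeries E) * t) =
          PowerSeries.constantCoeff (v : PowerSeries E) * π ⟨x, hx⟩ := by
        rw [← map_mul, Units.mul_inv_cancel_left, ht, hv, constantCoeff_shift, ← π.commutes,
          ← map_mul]
        rfl
      rw [hv, constantCoeff_shift] at h1
      exact (hE p hp).mul_left_cancel h1
    · have h1 : l (algebraMap F[X] L p) * l x = HahnSeries.ofPowerSeries ℤ E t := by
        rw [← map_mul, hlt]
      rw [hl, ← hv] at h1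
      rw [map_mul, ← h1, ← mul_assoc, ← map_mul, Units.inv_mul, map_one, one_mul]
  have hρB : ρ ∈ localRing F z ρ := ⟨1, by simp, by
    rw [map_one, one_mul]; exact Algebra.self_mem_adjoin_singleton _ _⟩
  have good_ρ : Good ρ := good_div p₀ ρ hp₀ hρB (by
    rw [← hb₁]; exact ⟨b₁.2, s, hs, hls⟩)
  obtain ⟨x, hx⟩ := b
  obtain ⟨p, hp, hpx⟩ := id hx
  have : Good (algebraMap F[X] L p * x) := by
    refine Algebra.adjoin_induction (p := fun y _ => Good y) ?_ good_alg
      (fun x y _ _ => good_add x y) (fun x y _ _ => good_mul x y) hpx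
    rintro y rfl
    exact good_ρ
  obtain ⟨hx', t, ht, hlt⟩ := good_div p x hp hx this
  exact ⟨t, ht, hlt⟩

/-- The reduction map `F[Y]_{(N)}[ρ] → F[Y]_{(N)}[ρ] / N`. -/
def resMk (z : Fs) (ρ : L) : localRing F z ρ →ₐ[F[X]] ResRing F z ρ :=
  Ideal.Quotient.mkₐ F[X] (Ideal.span {algebraMap F[X] (localRing F z ρ) (minpoly F z)})

variable [Algebra (RatFunc F) L] [IsScalarTower F[X] (RatFunc F) L]

theorem algebraMap_injective_of_tower : Function.Injective (algebraMap F[X] L) := by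
  rw [IsScalarTower.algebraMap_eq F[X] (RatFunc F) L]
  exact (algebraMap (RatFunc F) L).injective.comp (IsFractionRing.injective F[X] (RatFunc F))

theorem exists_taylorExt_aux {E : Type*} [CommRing E] [Algebra F[X] E] {N : F[X]}
    (hN : algebraMap F[X] E N = 0) (hirr : Irreducible N) (hsep : N.Separable)
    {r : ℕ} (hr : (r : F) ≠ 0) {ρ₁ : L} {d : F[X]} (hρ₁r : ρ₁ ^ r = algebraMap F[X] L d)
    {e₁ : E} (hme : aeval e₁ (minpoly F[X] ρ₁) = 0) (he₁r : e₁ ^ r = algebraMap F[X] E d)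
    (hdu : IsUnit (algebraMap F[X] E d))
    (hgen₁ : IntermediateField.adjoin (RatFunc F) {ρ₁} = ⊤) :
    ∃ (l : L →+* LaurentSeries E) (s : PowerSeries E),
      (∀ p : F[X], l (algebraMap F[X] L p) = HahnSeries.ofPowerSeries ℤ E (shift E p)) ∧
      PowerSeries.constantCoeff s = e₁ ∧ l ρ₁ = HahnSeries.ofPowerSeries ℤ E s := by
  have hr0 : r ≠ 0 := by rintro rfl; simp at hr
  have hrE : IsUnit ((r : ℕ) : E) := by
    have := (IsUnit.mk0 _ hr).map ((algebraMap F[X] E).comp Polynomial.C)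
    rwa [map_natCast] at this
  have hinj : Function.Injective (algebraMap F[X] L) := algebraMap_injective_of_tower
  have : Module.IsTorsionFree F[X] L := by
    rw [Module.isTorsionFree_iff_algebraMap_injective]
    exact hinj
  have he₁u : IsUnit e₁ := by
    rw [← isUnit_pow_iff hr0, he₁r]; exact hdu
  have hint : IsIntegral F[X] ρ₁ := by
    refine IsIntegral.of_pow (Nat.pos_of_ne_zero hr0) ?_
    rw [hρ₁r]; exact isIntegral_algebraMap
  obtain ⟨q, hq⟩ : minpoly F[X] ρ₁ ∣ (Polynomial.X ^ r - C d : F[X][X]) :=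
    minpoly.isIntegrallyClosed_dvd hint (by simp [hρ₁r])
  set m := minpoly F[X] ρ₁ with hm
  have hqu : IsUnit (aeval e₁ q) := by
    have h1 := congrArg (fun f => aeval e₁ (derivative f)) hq
    simp only [derivative_sub, derivative_X_pow, derivative_C, sub_zero, derivative_mul, map_add,
      map_mul, hme, zero_mul, add_zero, map_pow, aeval_X, map_natCast] at h1
    have h2 : IsUnit ((r : E) * e₁ ^ (r - 1)) := hrE.mul (he₁u.pow _)
    rw [h1] at h2
    exact isUnit_of_mul_isUnit_right h2
  obtain ⟨v, hv⟩ := hdu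
  obtain ⟨c, hc, hcr⟩ := exists_root r hrE (PowerSeries.C ((v⁻¹ : Eˣ) : E) * shift E d) (by
      rw [map_mul, PowerSeries.constantCoeff_C, constantCoeff_shift, ← hv, Units.inv_mul])
  have hsr : (PowerSeries.C e₁ * c) ^ r = shift E d := by
    rw [mul_pow, hcr, ← map_pow, he₁r, ← mul_assoc, ← map_mul, ← hv, Units.mul_inv, map_one,
      one_mul]
  have hs0 : PowerSeries.constantCoeff (PowerSeries.C e₁ * c) = e₁ := by
    rw [map_mul, hc, PowerSeries.constantCoeff_C, mul_one]
  set s : PowerSeries E := PowerSeries.C e₁ * c with hs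
  have hcs : ∀ g : F[X][X], PowerSeries.constantCoeff (eval₂ (shift E) s g) = aeval e₁ g := by
    intro g
    have h : (PowerSeries.constantCoeff (R := E)).comp (shift E) = algebraMap F[X] E :=
      RingHom.ext fun p => constantCoeff_shift E p
    rw [Polynomial.hom_eval₂, hs0, aeval_def, h]
  have hms : eval₂ (shift E) s m = 0 := by
    have h1 := congrArg (eval₂ (shift E) s) hq
    rw [eval₂_sub, eval₂_X_pow, eval₂_C, hsr, sub_self, eval₂_mul] at h1
    have h2 : IsUnit (eval₂ (shift E) s q) := by
      rw [PowerSeries.isUnit_iff_constantCoeff, hcs]; exact hqu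
    exact (h2.mul_left_eq_zero).1 h1.symm
  set R := ratTaylor hN hirr hsep with hR
  have hmR : minpoly (RatFunc F) ρ₁ = m.map (algebraMap F[X] (RatFunc F)) :=
    minpoly.isIntegrallyClosed_eq_field_fractions' (RatFunc F) hint
  have hroot : eval₂ R (HahnSeries.ofPowerSeries ℤ E s) (minpoly (RatFunc F) ρ₁) = 0 := by
    have h1 : R.comp (algebraMap F[X] (RatFunc F)) =
        (HahnSeries.ofPowerSeries ℤ E).comp (shift E) :=
      RingHom.ext fun p => ratTaylor_algebraMap hN hirr hsep p
    rw [hmR, eval₂_map, h1, ← Polynomial.hom_eval₂, hms, map_zero]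
  have hintR : IsIntegral (RatFunc F) ρ₁ := hint.tower_top
  let e : AdjoinRoot (minpoly (RatFunc F) ρ₁) ≃ₐ[RatFunc F] L :=
    (IntermediateField.adjoinRootEquivAdjoin (RatFunc F) hintR).trans
      ((IntermediateField.equivOfEq hgen₁).trans IntermediateField.topEquiv)
  have heroot : e (AdjoinRoot.root _) = ρ₁ := by
    show IntermediateField.topEquiv (IntermediateField.equivOfEq hgen₁
      (IntermediateField.adjoinRootEquivAdjoin (RatFunc F) hintR (AdjoinRoot.root _))) = _
    rw [IntermediateField.adjoinRootEquivAdjoin_apply_root]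
    rfl
  let l : L →+* LaurentSeries E := (AdjoinRoot.lift R (HahnSeries.ofPowerSeries ℤ E s) hroot).comp
    (e.symm : L →+* AdjoinRoot (minpoly (RatFunc F) ρ₁))
  refine ⟨l, s, ?_, hs0, ?_⟩
  · intro p
    show AdjoinRoot.lift R _ hroot (e.symm _) = _
    rw [IsScalarTower.algebraMap_apply F[X] (RatFunc F) L, AlgEquiv.commutes,
      AdjoinRoot.algebraMap_eq, AdjoinRoot.lift_of]
    exact ratTaylor_algebraMap hN hirr hsep p
  · show AdjoinRoot.lift R _ hroot (e.symm ρ₁) = _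
    have h1 : e.symm ρ₁ = AdjoinRoot.root (minpoly (RatFunc F) ρ₁) := by
      rw [AlgEquiv.symm_apply_eq]; exact heroot.symm
    rw [h1, AdjoinRoot.lift_root]

theorem exists_taylorExt_of {E : Type*} [CommRing E] [Algebra F[X] E] {z : Fs}
    (hz : IsSeparable F z) {r : ℕ} (hr : (r : F) ≠ 0) {ρ : L}
    {n : RatFunc F} (hρ : ρ ^ r = algebraMap (RatFunc F) L n)
    (hnum : aeval z n.num ≠ 0) (hden : aeval z n.denom ≠ 0)
    (hgen : IntermediateField.adjoin (RatFunc F) {ρ} = ⊤)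
    (hE : ∀ p : F[X], aeval z p ≠ 0 → IsUnit (algebraMap F[X] E p))
    (hN : algebraMap F[X] E (minpoly F z) = 0) (π : localRing F z ρ →ₐ[F[X]] E) :
    ∃ l : L →+* LaurentSeries E,
      (∀ p : F[X], l (algebraMap F[X] L p) = HahnSeries.ofPowerSeries ℤ E (shift E p)) ∧
      ∀ b : localRing F z ρ, ∃ t : PowerSeries E,
        PowerSeries.constantCoeff t = π b ∧ l b = HahnSeries.ofPowerSeries ℤ E t := by
  have hr0 : r ≠ 0 := by rintro rfl; simp at hr
  have hinj : Function.Injective (algebraMap F[X] L) := algebraMap_injective_of_tower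
  set d : F[X] := n.num * n.denom ^ (r - 1) with hd
  set ρ₁ : L := algebraMap F[X] L n.denom * ρ with hρ₁
  have hden0 : algebraMap F[X] L n.denom ≠ 0 := by
    rw [Ne, map_eq_zero_iff _ hinj]; exact n.denom_ne_zero
  have hρ₁r : ρ₁ ^ r = algebraMap F[X] L d := by
    have h1 : algebraMap F[X] L n.denom * algebraMap (RatFunc F) L n = algebraMap F[X] L n.num := by
      rw [IsScalarTower.algebraMap_apply F[X] (RatFunc F) L n.denom, ← map_mul,
        IsScalarTower.algebraMap_apply F[X] (RatFunc F) L n.num]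
      congr 1
      have h2 := RatFunc.num_div_denom n
      rw [div_eq_iff (by
        rw [Ne, map_eq_zero_iff _ (IsFractionRing.injective F[X] (RatFunc F))]
        exact n.denom_ne_zero)] at h2
      rw [h2, mul_comm]
    rw [hρ₁, mul_pow, hρ, hd, map_mul, map_pow, ← h1]
    obtain ⟨k, rfl⟩ := Nat.exists_eq_succ_of_ne_zero hr0
    rw [Nat.succ_sub_one, pow_succ]; ring
  have hρB : ρ ∈ localRing F z ρ := ⟨1, by simp, by
    rw [map_one, one_mul]; exact Algebra.self_mem_adjoin_singleton _ _⟩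
  have hρ₁B : ρ₁ ∈ localRing F z ρ := mul_mem (Subalgebra.algebraMap_mem _ _) hρB
  have he₁r : (π ⟨ρ₁, hρ₁B⟩) ^ r = algebraMap F[X] E d := by
    have : (⟨ρ₁, hρ₁B⟩ : localRing F z ρ) ^ r = algebraMap F[X] (localRing F z ρ) d :=
      Subtype.ext hρ₁r
    rw [← map_pow, this, AlgHom.commutes]
  have hdz : aeval z d ≠ 0 := by
    rw [hd, map_mul, map_pow]; exact mul_ne_zero hnum (pow_ne_zero _ hden)
  have hme : aeval (π ⟨ρ₁, hρ₁B⟩) (minpoly F[X] ρ₁) = 0 := by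
    have h1 : aeval (⟨ρ₁, hρ₁B⟩ : localRing F z ρ) (minpoly F[X] ρ₁) = 0 := by
      have : (aeval ((localRing F z ρ).val ⟨ρ₁, hρ₁B⟩)) (minpoly F[X] ρ₁) = 0 :=
        minpoly.aeval F[X] ρ₁
      rw [Polynomial.aeval_algHom_apply] at this
      exact Subtype.ext this
    rw [Polynomial.aeval_algHom_apply, h1, map_zero]
  have hgen₁ : IntermediateField.adjoin (RatFunc F) {ρ₁} = ⊤ := by
    rw [eq_top_iff, ← hgen, IntermediateField.adjoin_simple_le_iff]
    have h1 : ρ₁ ∈ IntermediateField.adjoin (RatFunc F) {ρ₁} :=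
      IntermediateField.mem_adjoin_simple_self _ _
    have h2 : algebraMap F[X] L n.denom ∈ IntermediateField.adjoin (RatFunc F) {ρ₁} := by
      rw [IsScalarTower.algebraMap_apply F[X] (RatFunc F) L]
      exact IntermediateField.algebraMap_mem _ _
    have h3 : ρ = (algebraMap F[X] L n.denom)⁻¹ * ρ₁ := by
      rw [hρ₁, inv_mul_cancel_left₀ hden0]
    rw [h3]
    exact mul_mem (inv_mem h2) h1
  obtain ⟨l, s, hl, hs, hls⟩ := exists_taylorExt_aux (N := minpoly F z)
    hN (minpoly.irreducible hz.isIntegral) hz hr hρ₁r hme he₁r (hE d hdz) hgen₁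
  exact ⟨l, hl, taylorExt_reduces hE π l hl hden
    ⟨ρ₁, hρ₁B⟩ rfl hs hls⟩

theorem exists_taylorExt {z : Fs} (hz : IsSeparable F z) {r : ℕ} (hr : (r : F) ≠ 0) {ρ : L}
    {n : RatFunc F} (hρ : ρ ^ r = algebraMap (RatFunc F) L n)
    (hnum : aeval z n.num ≠ 0) (hden : aeval z n.denom ≠ 0)
    (hgen : IntermediateField.adjoin (RatFunc F) {ρ} = ⊤) :
    ∃ l : L →+* LaurentSeries (ResRing F z ρ),
      (∀ p : F[X], l (algebraMap F[X] L p) =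
        HahnSeries.ofPowerSeries ℤ (ResRing F z ρ) (shift (ResRing F z ρ) p)) ∧
      ∀ b : localRing F z ρ, ∃ t : PowerSeries (ResRing F z ρ),
        PowerSeries.constantCoeff t = resMk z ρ b ∧
        l b = HahnSeries.ofPowerSeries ℤ (ResRing F z ρ) t :=
  exists_taylorExt_of hz hr hρ hnum hden hgen (fun _ hp => isUnit_resRing hz ρ hp)
    (algebraMap_resRing_minpoly z ρ) (resMk z ρ)

end Ext

end Points

section Endomorphism

variable {F K Fs : Type*} [Field F] [Field K] [Algebra F K] [Field Fs] [Algebra F Fs]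

/-- The value at `z` of a rational function (meaningful if `z` is not a pole). -/
def evalAt (z : Fs) (f : RatFunc F) : Fs := aeval z f.num / aeval z f.denom

/-- The derivative of a rational function with respect to the variable. -/
def ratDeriv (f : RatFunc F) : RatFunc F :=
  algebraMap F[X] (RatFunc F) (derivative f.num * f.denom - f.num * derivative f.denom) /
    algebraMap F[X] (RatFunc F) f.denom ^ 2

section Galois

variable {B B' : Type*} [CommRing B] [Algebra F B] [CommRing B'] [Algebra F B']

variable (B) in
/-- The automorphism `id ⊗ θ` of `B ⊗_F K`. -/
def galAct (θ : K ≃ₐ[F] K) : B ⊗[F] K →ₐ[F] B ⊗[F] K :=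
  Algebra.TensorProduct.map (AlgHom.id F B) (θ : K →ₐ[F] K)

/-- The norm `c · θ(c) ⋯ θ^{r-1}(c)` of an element of `B ⊗_F K`, where `r` is the order of `θ`. -/
def galNorm (θ : K ≃ₐ[F] K) (c : B ⊗[F] K) : B ⊗[F] K :=
  ∏ i ∈ Finset.range (orderOf θ), (galAct B θ)^[i] c

variable (K) in
/-- The map `g ⊗ id : B ⊗_F K → B' ⊗_F K`. -/
def baseMap (g : B →ₐ[F] B') : B ⊗[F] K →ₐ[F] B' ⊗[F] K :=
  Algebra.TensorProduct.map g (AlgHom.id F K)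

theorem baseMap_tmul (g : B →ₐ[F] B') (b : B) (a : K) : baseMap K g (b ⊗ₜ a) = g b ⊗ₜ a := rfl

theorem galAct_tmul (θ : K ≃ₐ[F] K) (b : B) (a : K) : galAct B θ (b ⊗ₜ a) = b ⊗ₜ θ a := rfl

theorem galAct_baseMap (θ : K ≃ₐ[F] K) (g : B →ₐ[F] B') (x : B ⊗[F] K) :
    galAct B' θ (baseMap K g x) = baseMap K g (galAct B θ x) := by
  induction x using TensorProduct.induction_on with
  | zero => simp
  | add x y hx hy => simp only [map_add, hx, hy]
  | tmul b a => rfl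

end Galois

/-- The element `c` of `(F[Y] / N) ⊗_F K` is the reduction modulo `N` of the element `x` of
`F(Y) ⊗_F K`, where `N` is the minimal polynomial of `z`: one can write `x = a / b` with
`a ∈ F[Y] ⊗_F K`, `b ∈ F[Y]` and `b(z) ≠ 0`, and `c` is the quotient of the reductions. -/
def IsReduction (z : Fs) (x : RatFunc F ⊗[F] K) (c : ResField F z ⊗[F] K) : Prop :=
  ∃ (b : F[X]) (a : F[X] ⊗[F] K), aeval z b ≠ 0 ∧
    (algebraMap F[X] (RatFunc F) b ⊗ₜ 1) * x =
      baseMap K (IsScalarTower.toAlgHom F F[X] (RatFunc F)) a ∧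
    (algebraMap F[X] (ResField F z) b ⊗ₜ 1) * c =
      baseMap K (IsScalarTower.toAlgHom F F[X] (ResField F z)) a

namespace IsReduction

variable {z : Fs} {x y : RatFunc F ⊗[F] K} {c d : ResField F z ⊗[F] K}

theorem mul (h : IsReduction z x c) (h' : IsReduction z y d) : IsReduction z (x * y) (c * d) := by
  obtain ⟨b, a, hb, h1, h2⟩ := h
  obtain ⟨b', a', hb', h1', h2'⟩ := h'
  refine ⟨b * b', a * a', by rw [map_mul]; exact mul_ne_zero hb hb', ?_, ?_⟩
  · rw [map_mul (baseMap K _), ← h1, ← h1', map_mul (algebraMap F[X] (RatFunc F)),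
      ← one_mul (1 : K), ← Algebra.TensorProduct.tmul_mul_tmul, one_mul]
    exact mul_mul_mul_comm _ _ _ _
  · rw [map_mul (baseMap K _), ← h2, ← h2', map_mul (algebraMap F[X] (ResField F z)),
      ← one_mul (1 : K), ← Algebra.TensorProduct.tmul_mul_tmul, one_mul]
    exact mul_mul_mul_comm _ _ _ _

theorem one : IsReduction (F := F) (K := K) z 1 1 :=
  ⟨1, 1, by simp, by rw [map_one (baseMap K _), mul_one, map_one]; rfl,
    by rw [map_one (baseMap K _), map_one]; exact mul_one _⟩

theorem galAct (θ : K ≃ₐ[F] K) (h : IsReduction z x c) :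
    IsReduction z (SkewRes.galAct _ θ x) (SkewRes.galAct _ θ c) := by
  obtain ⟨b, a, hb, h1, h2⟩ := h
  refine ⟨b, SkewRes.galAct _ θ a, hb, ?_, ?_⟩
  · have := congrArg (SkewRes.galAct _ θ) h1
    rwa [map_mul, galAct_tmul, map_one, galAct_baseMap] at this
  · have := congrArg (SkewRes.galAct _ θ) h2
    rwa [map_mul, galAct_tmul, map_one, galAct_baseMap] at this

theorem galNorm (θ : K ≃ₐ[F] K) (h : IsReduction z x c) :
    IsReduction z (SkewRes.galNorm θ x) (SkewRes.galNorm θ c) := by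
  have hi : ∀ i : ℕ, IsReduction z ((SkewRes.galAct _ θ)^[i] x) ((SkewRes.galAct _ θ)^[i] c) := by
    intro i
    induction i with
    | zero => exact h
    | succ i ih =>
      rw [Function.iterate_succ_apply', Function.iterate_succ_apply']
      exact ih.galAct θ
  unfold SkewRes.galNorm
  generalize orderOf θ = r
  induction r with
  | zero => exact one
  | succ r ih =>
    rw [Finset.prod_range_succ, Finset.prod_range_succ]
    exact ih.mul (hi r)

theorem unique (hz : IsSeparable F z) (h : IsReduction z x c) (h' : IsReduction z x d) :
    c = d := by
  obtain ⟨b, a, hb, h1, h2⟩ := h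
  obtain ⟨b', a', hb', h1', h2'⟩ := h'
  have hinj : Function.Injective (baseMap K (IsScalarTower.toAlgHom F F[X] (RatFunc F))) :=
    Module.Flat.rTensor_preserves_injective_linearMap (M := K)
      (IsScalarTower.toAlgHom F F[X] (RatFunc F)).toLinearMap
      (IsFractionRing.injective F[X] (RatFunc F))
  have h3 : (b' ⊗ₜ 1) * a = (b ⊗ₜ 1) * a' := by
    apply hinj
    rw [map_mul, map_mul, ← h1, ← h1', baseMap_tmul, baseMap_tmul]
    exact mul_left_comm _ _ _
  have h4 := congrArg (baseMap K (IsScalarTower.toAlgHom F F[X] (ResField F z))) h3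
  rw [map_mul, map_mul, ← h2, ← h2', baseMap_tmul, baseMap_tmul] at h4
  have hu : ∀ p : F[X], aeval z p ≠ 0 →
      IsUnit (algebraMap F[X] (ResField F z) p ⊗ₜ 1 : ResField F z ⊗[F] K) := fun p hp =>
    (isUnit_resField hz hp).map
      (Algebra.TensorProduct.includeLeft : ResField F z →ₐ[F] ResField F z ⊗[F] K)
  have h5 := h4.trans (mul_left_comm _ _ _)
  have h6 := (hu b' hb').mul_left_cancel h5
  exact (hu b hb).mul_left_cancel h6

end IsReduction

theorem BC.comm_tmul {B : Type*} [CommRing B] [Algebra F[X] B] [Algebra F B]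
    [IsScalarTower F F[X] B] (θ : K ≃ₐ[F] K) (b : B) (a : K) :
    BC.comm B θ (b ⊗ₜ a) = BC.inl B θ b * BC.const B θ a := rfl

theorem BC.comm_commute {B : Type*} [CommRing B] [Algebra F[X] B] [Algebra F B]
    [IsScalarTower F F[X] B] (θ : K ≃ₐ[F] K) (c d : B ⊗[F] K) :
    Commute (BC.comm B θ c) (BC.comm B θ d) := by
  show _ * _ = _ * _
  rw [← map_mul, ← map_mul, mul_comm]

theorem BC.X_mul_comm {B : Type*} [CommRing B] [Algebra F[X] B] [Algebra F B]
    [IsScalarTower F F[X] B] (θ : K ≃ₐ[F] K) (c : B ⊗[F] K) :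
    (BC.X B θ : BC B θ) * BC.comm B θ c = BC.comm B θ (galAct B θ c) * BC.X B θ := by
  induction c using TensorProduct.induction_on with
  | zero => simp
  | add x y hx hy => simp only [map_add, mul_add, add_mul, hx, hy]
  | tmul b a =>
    rw [galAct_tmul, BC.comm_tmul, BC.comm_tmul, ← mul_assoc, ← (BC.inl_commute b _).eq, mul_assoc,
      BC.X_mul_const, mul_assoc]

theorem BC.comm_mul_X_pow {B : Type*} [CommRing B] [Algebra F[X] B] [Algebra F B]
    [IsScalarTower F F[X] B] (θ : K ≃ₐ[F] K) (c : B ⊗[F] K) (k : ℕ) :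
    (BC.comm B θ c * BC.X B θ) ^ k =
      BC.comm B θ (∏ i ∈ Finset.range k, (galAct B θ)^[i] c) * (BC.X B θ : BC B θ) ^ k := by
  have hX : ∀ (k : ℕ) (d : B ⊗[F] K), (BC.X B θ : BC B θ) ^ k * BC.comm B θ d =
      BC.comm B θ ((galAct B θ)^[k] d) * (BC.X B θ : BC B θ) ^ k := by
    intro k d
    induction k with
    | zero => simp
    | succ k ih =>
      rw [pow_succ', mul_assoc, ih, ← mul_assoc, BC.X_mul_comm, mul_assoc,
        Function.iterate_succ_apply']
  induction k with
  | zero => simp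
  | succ k ih =>
    rw [pow_succ, ih, Finset.prod_range_succ, map_mul, pow_succ, ← mul_assoc,
      mul_assoc _ (_ ^ k) (BC.comm B θ c), hX, ← mul_assoc, ← mul_assoc]

/-- Regularity at `z` of an endomorphism `γ` of `Frac(K[X^{±1}; θ])` given by `γ(X) = C X`. Here
`n` is the norm of `C`, so that `γ(Y) = n Y` is a rational function of `Y`: it has neither a zero
nor a pole at `z` and it is not ramified at `z`, and `C` can be reduced at `z`, so that `γ` induces
a map between the residue algebras at `γ(Y)(z)` and at `z`. -/
structure IsGammaRegular (z : Fs) (C : RatFunc F ⊗[F] K) (n : RatFunc F) : Prop where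
  num_ne_zero : aeval z (n * RatFunc.X).num ≠ 0
  denom_ne_zero : aeval z (n * RatFunc.X).denom ≠ 0
  deriv_ne_zero : evalAt z (ratDeriv (n * RatFunc.X)) ≠ 0
  exists_reduction : ∃ c : ResField F z ⊗[F] K, IsReduction z C c

/-- The image `γ_⋆ z` of the point `z`. -/
abbrev pushPoint (z : Fs) (n : RatFunc F) : Fs := evalAt z (n * RatFunc.X)

namespace IsGammaRegular

variable {z : Fs} {C : RatFunc F ⊗[F] K} {n : RatFunc F}

theorem pushPoint_ne_zero (h : IsGammaRegular z C n) : pushPoint z n ≠ 0 :=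
  div_ne_zero h.num_ne_zero h.denom_ne_zero

theorem eq_mul_inv_X (n : RatFunc F) : n = n * RatFunc.X * RatFunc.X⁻¹ := by
  rw [mul_assoc, mul_inv_cancel₀ RatFunc.X_ne_zero, mul_one]

theorem num_norm_ne_zero (h : IsGammaRegular z C n) : aeval z n.num ≠ 0 := by
  have h1 : n.num ∣ (n * RatFunc.X).num * 1 := by
    refine (dvd_of_eq (congrArg RatFunc.num (eq_mul_inv_X n))).trans ?_
    refine (RatFunc.num_mul_dvd _ _).trans (mul_dvd_mul_left _ ?_)
    refine (RatFunc.num_inv_dvd RatFunc.X_ne_zero).trans ?_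
    rw [RatFunc.denom_X]
  obtain ⟨q, hq⟩ := h1
  intro h0
  apply h.num_ne_zero
  rw [mul_one] at hq
  rw [hq, map_mul, h0, zero_mul]

theorem denom_norm_ne_zero (hz : z ≠ 0) (h : IsGammaRegular z C n) : aeval z n.denom ≠ 0 := by
  have h1 : n.denom ∣ (n * RatFunc.X).denom * Polynomial.X := by
    refine (dvd_of_eq (congrArg RatFunc.denom (eq_mul_inv_X n))).trans ?_
    refine (RatFunc.denom_mul_dvd _ _).trans (mul_dvd_mul_left _ ?_)
    refine (RatFunc.denom_inv_dvd RatFunc.X_ne_zero).trans ?_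
    rw [RatFunc.num_X]
  obtain ⟨q, hq⟩ := h1
  intro h0
  have := congrArg (aeval z) hq
  rw [map_mul, map_mul, h0, zero_mul, aeval_X] at this
  exact mul_ne_zero h.denom_ne_zero hz this

theorem pushPoint_eq (h : IsGammaRegular z C n) :
    pushPoint z n * aeval z n.denom = aeval z n.num * z := by
  have h1 := RatFunc.num_denom_mul n RatFunc.X
  rw [RatFunc.num_X, RatFunc.denom_X, mul_one] at h1
  have h2 := congrArg (aeval z) h1
  simp only [map_mul, aeval_X] at h2
  have h3 := h.denom_ne_zero
  unfold pushPoint evalAt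
  rw [div_mul_eq_mul_div, div_eq_iff h3]
  exact h2

end IsGammaRegular

/-- The `K`-algebra map between the residue algebras at the points `w` and `z` that is given by
`X ↦ c X`. -/
structure IsResidueMap (θ : K ≃ₐ[F] K) {w z : Fs} (c : ResField F z ⊗[F] K)
    (g : BC (ResField F w) θ →+* BC (ResField F z) θ) : Prop where
  map_const : ∀ a : K, g (BC.const (ResField F w) θ a) = BC.const (ResField F z) θ a
  map_X : g (BC.X (ResField F w) θ : BC (ResField F w) θ) =
    BC.comm (ResField F z) θ c * (BC.X (ResField F z) θ : BC (ResField F z) θ)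

theorem exists_isResidueMap {θ : K ≃ₐ[F] K} (hr : (orderOf θ : F) ≠ 0) {z : Fs} (hz : z ≠ 0)
    (hsep : IsSeparable F z) {C : RatFunc F ⊗[F] K} {n : RatFunc F}
    (hn : galNorm θ C = n ⊗ₜ 1) (h : IsGammaRegular z C n) :
    ∃ g : BC (ResField F (pushPoint z n)) θ →+* BC (ResField F z) θ,
      ∃ c, IsReduction z C c ∧ IsResidueMap θ c g := by
  have hr0 : orderOf θ ≠ 0 := by intro h0; rw [h0] at hr; simp at hr
  obtain ⟨c, hc⟩ := h.exists_reduction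
  have hnum := h.num_norm_ne_zero
  have hden := h.denom_norm_ne_zero hz
  obtain ⟨d, hd⟩ := isUnit_resField hsep hden
  set e : ResField F z := algebraMap F[X] (ResField F z) n.num * ((d⁻¹ : (ResField F z)ˣ) :) with he
  have heu : IsUnit e := (isUnit_resField hsep hnum).mul (Units.isUnit _)
  have hnred : IsReduction z (n ⊗ₜ (1 : K)) (e ⊗ₜ 1) := by
    refine ⟨n.denom, n.num ⊗ₜ 1, hden, ?_, ?_⟩
    · rw [Algebra.TensorProduct.tmul_mul_tmul, one_mul, baseMap_tmul]
      congr 1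
      have h2 := RatFunc.num_div_denom n
      rw [div_eq_iff (by
        rw [Ne, map_eq_zero_iff _ (IsFractionRing.injective F[X] (RatFunc F))]
        exact n.denom_ne_zero)] at h2
      exact (mul_comm _ _).trans h2.symm
    · rw [baseMap_tmul, ← hd]
      refine (Algebra.TensorProduct.tmul_mul_tmul _ _ _ _).trans ?_
      rw [one_mul, he, mul_left_comm, Units.mul_inv, mul_one]
      rfl
  have hcn : galNorm θ c = e ⊗ₜ 1 := by
    refine IsReduction.unique hsep (hc.galNorm θ) ?_
    rw [hn]; exact hnred
  have hcu : IsUnit c := by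
    have h1 : c ∣ galNorm θ c := by
      refine Finset.dvd_prod_of_mem (fun i => (galAct (ResField F z) θ)^[i] c) (a := 0) ?_
      exact Finset.mem_range.2 (Nat.pos_of_ne_zero hr0)
    refine isUnit_of_dvd_unit h1 ?_
    rw [hcn]
    exact heu.map (Algebra.TensorProduct.includeLeft : ResField F z →ₐ[F] ResField F z ⊗[F] K)
  obtain ⟨x, hx⟩ := (hcu.map (BC.comm (ResField F z) θ)).mul (BC.X (ResField F z) θ).isUnit
  set y : ResField F z := e * algebraMap F[X] (ResField F z) Polynomial.X with hy
  let ev : F[X] →ₐ[F] ResField F z := aeval y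
  let v : ResField F z →ₐ[F] Fs := ResField.lift (aeval z) (minpoly.aeval F z)
  have hv : ∀ p : F[X], v (algebraMap F[X] (ResField F z) p) = aeval z p := fun p => rfl
  have hvinj : Function.Injective v := by
    rw [injective_iff_map_eq_zero]
    intro a ha
    obtain ⟨p, rfl⟩ := Ideal.Quotient.mk_surjective a
    refine Ideal.Quotient.eq_zero_iff_mem.2 (Ideal.mem_span_singleton.2 ?_)
    exact minpoly.dvd F z ha
  have hvy : v y = pushPoint z n := by
    have h1 : v e * aeval z n.denom = aeval z n.num := by
      rw [← hv, ← map_mul, ← hd, he, mul_assoc, Units.inv_mul, mul_one, hv]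
    refine mul_right_cancel₀ hden ?_
    rw [h.pushPoint_eq, hy, map_mul, mul_right_comm, h1, hv, aeval_X]
  let κ : ResField F (pushPoint z n) →ₐ[F] ResField F z :=
    ResField.lift ev (by
      apply hvinj
      have h1 : v (ev (minpoly F (pushPoint z n))) = aeval (v y) (minpoly F (pushPoint z n)) :=
        (Polynomial.aeval_algHom_apply v y _).symm
      rw [h1, hvy, minpoly.aeval, map_zero])
  have hκX : κ (algebraMap F[X] (ResField F (pushPoint z n)) Polynomial.X) = y :=
    aeval_X y
  have hκC : ∀ a : F, κ (algebraMap F[X] (ResField F (pushPoint z n)) (Polynomial.C a)) =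
      algebraMap F[X] (ResField F z) (Polynomial.C a) := fun a => aeval_C y a
  refine ⟨BC.lift ((BC.inl (ResField F z) θ).comp κ.toRingHom) (BC.const (ResField F z) θ) x
    ?_ ?_ ?_ ?_ ?_, c, hc, ?_, ?_⟩
  · intro a
    have h1 : Commute (BC.const (ResField F z) θ (θ a)) (BC.comm (ResField F z) θ c) := by
      have := BC.comm_commute θ ((1 : ResField F z) ⊗ₜ[F] (θ a)) c
      rwa [BC.comm_tmul, map_one, one_mul] at this
    rw [hx, mul_assoc, BC.X_mul_const, ← mul_assoc, ← h1.eq, mul_assoc]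
  · intro b a
    exact BC.inl_commute _ _
  · intro b
    exact BC.inl_commute _ _
  · have h1 := BC.comm_mul_X_pow θ c (orderOf θ)
    have h2 : (∏ i ∈ Finset.range (orderOf θ), (galAct (ResField F z) θ)^[i] c) = e ⊗ₜ 1 := hcn
    rw [h2, BC.comm_tmul, map_one, mul_one, ← BC.inl_Y, ← map_mul, ← hy] at h1
    rw [hx, h1]
    exact congrArg (BC.inl (ResField F z) θ) hκX
  · intro a
    rw [← BC.inl_C]
    exact congrArg (BC.inl (ResField F z) θ) (hκC a)
  · intro a
    rw [BC.lift_const]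
  · rw [BC.lift_X, hx]

theorem isSeparable_of_isSepClosure [IsSepClosure F Fs] (z : Fs) : IsSeparable F z :=
  (IsSepClosure.separable (k := F) (K := Fs)).isSeparable' z

section Residue

variable [IsSepClosure F Fs] (θ : K ≃ₐ[F] K)

theorem exists_canonicalTaylor (hr : (orderOf θ : F) ≠ 0) {z : Fs} (hz : z ≠ 0) :
    ∃ τ : SkewFrac θ →+* LaurentSeries (BC (ResField F z) θ),
      IsCanonicalTaylor (RatFunc F) (ResField F z) θ τ := by
  have hsep := isSeparable_of_isSepClosure (F := F) z
  have hy : IsUnit (algebraMap F[X] (ResField F z) Polynomial.X) :=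
    isUnit_resField hsep (by rwa [aeval_X])
  obtain ⟨τ, h, -⟩ := exists_isCanonicalTaylor (L := RatFunc F) θ hr hy
    (ratTaylor (algebraMap_resField_minpoly z) (minpoly.irreducible hsep.isIntegral) hsep)
    (ratTaylor_algebraMap _ _ _)
  exact ⟨τ, h⟩

/-- The canonical Taylor morphism `τ_{z,can}` at the point `z` (it is unique). -/
def canonicalTaylor (hr : (orderOf θ : F) ≠ 0) {z : Fs} (hz : z ≠ 0) :
    SkewFrac θ →+* LaurentSeries (BC (ResField F z) θ) :=
  Classical.choose (exists_canonicalTaylor θ hr hz)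

theorem canonicalTaylor_spec (hr : (orderOf θ : F) ≠ 0) {z : Fs} (hz : z ≠ 0) :
    IsCanonicalTaylor (RatFunc F) (ResField F z) θ (canonicalTaylor θ hr hz) :=
  Classical.choose_spec (exists_canonicalTaylor θ hr hz)

/-- The canonical skew residue `sres_{z,can}`: the coefficient of `T⁻¹` in `τ_{z,can}(f)`. -/
def sresCan (hr : (orderOf θ : F) ≠ 0) {z : Fs} (hz : z ≠ 0) (f : SkewFrac θ) :
    BC (ResField F z) θ :=
  (canonicalTaylor θ hr hz f).coeff (-1)

section Ext

variable {L : Type*} [Field L] [Algebra F[X] L]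

/-- A canonical Taylor morphism on `L ⊗ K[X^{±1}; θ]` which induces the reduction map
`F[Y]_{(N)}[ρ] → F[Y]_{(N)}[ρ] / N` modulo `T`. -/
structure IsCanonicalTaylorExt (z : Fs) (ρ : L)
    (τ : BC L θ →+* LaurentSeries (BC (ResRing F z ρ) θ)) : Prop where
  isCanonical : IsCanonicalTaylor L (ResRing F z ρ) θ τ
  reduces : ∀ b : localRing F z ρ, ∃ t : PowerSeries (ResRing F z ρ),
    PowerSeries.constantCoeff t = resMk z ρ b ∧
    τ (BC.inl L θ b) = HahnSeries.ofPowerSeries ℤ (BC (ResRing F z ρ) θ)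
      (PowerSeries.map (BC.inl (ResRing F z ρ) θ) t)

variable [Algebra (RatFunc F) L] [IsScalarTower F[X] (RatFunc F) L]

theorem exists_canonicalTaylorExt (hr : (orderOf θ : F) ≠ 0) {z : Fs} (hz : z ≠ 0) {ρ : L}
    {C : RatFunc F ⊗[F] K} {n : RatFunc F} (h : IsGammaRegular z C n)
    (hρ : ρ ^ orderOf θ = algebraMap (RatFunc F) L n)
    (hgen : IntermediateField.adjoin (RatFunc F) {ρ} = ⊤) :
    ∃ τ : BC L θ →+* LaurentSeries (BC (ResRing F z ρ) θ), IsCanonicalTaylorExt θ z ρ τ := by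
  have hsep := isSeparable_of_isSepClosure (F := F) z
  have hy : IsUnit (algebraMap F[X] (ResRing F z ρ) Polynomial.X) :=
    isUnit_resRing hsep ρ (by rwa [aeval_X])
  obtain ⟨l, hl, hred⟩ := exists_taylorExt hsep hr hρ h.num_norm_ne_zero
    (h.denom_norm_ne_zero hz) hgen
  obtain ⟨τ, hτ, hτl⟩ := exists_isCanonicalTaylor θ hr hy l hl
  refine ⟨τ, hτ, fun b => ?_⟩
  obtain ⟨t, ht, hlt⟩ := hred b
  exact ⟨t, ht, by rw [hτl, hlt, laurentMap_ofPowerSeries]⟩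

/-- The extension of `τ_{z,can}` to `L ⊗ K[X^{±1}; θ]`, where `L` is generated over `F(Y)` by an
`r`-th root `ρ` of the norm `n` of `C` (it is unique). -/
def canonicalTaylorExt (hr : (orderOf θ : F) ≠ 0) {z : Fs} (hz : z ≠ 0) {ρ : L}
    {C : RatFunc F ⊗[F] K} {n : RatFunc F} (h : IsGammaRegular z C n)
    (hρ : ρ ^ orderOf θ = algebraMap (RatFunc F) L n)
    (hgen : IntermediateField.adjoin (RatFunc F) {ρ} = ⊤) :
    BC L θ →+* LaurentSeries (BC (ResRing F z ρ) θ) :=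
  Classical.choose (exists_canonicalTaylorExt θ hr hz h hρ hgen)

theorem canonicalTaylorExt_spec (hr : (orderOf θ : F) ≠ 0) {z : Fs} (hz : z ≠ 0) {ρ : L}
    {C : RatFunc F ⊗[F] K} {n : RatFunc F} (h : IsGammaRegular z C n)
    (hρ : ρ ^ orderOf θ = algebraMap (RatFunc F) L n)
    (hgen : IntermediateField.adjoin (RatFunc F) {ρ} = ⊤) :
    IsCanonicalTaylorExt θ z ρ (canonicalTaylorExt θ hr hz h hρ hgen) :=
  Classical.choose_spec (exists_canonicalTaylorExt θ hr hz h hρ hgen)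

/-- The extension of `sres_{z,can}` to `L ⊗ K[X^{±1}; θ]`. -/
def sresCanExt (hr : (orderOf θ : F) ≠ 0) {z : Fs} (hz : z ≠ 0) {ρ : L}
    {C : RatFunc F ⊗[F] K} {n : RatFunc F} (h : IsGammaRegular z C n)
    (hρ : ρ ^ orderOf θ = algebraMap (RatFunc F) L n)
    (hgen : IntermediateField.adjoin (RatFunc F) {ρ} = ⊤) (f : BC L θ) :
    BC (ResRing F z ρ) θ :=
  (canonicalTaylorExt θ hr hz h hρ hgen f).coeff (-1)

end Ext

variable {θ}

/-- The map between the residue algebras at `γ_⋆ z` and at `z` that is induced by the endomorphism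
`γ : X ↦ C X`: it is the map of `K`-algebras `X ↦ c X`, where `c` is the reduction of `C`. -/
def inducedMap (hr : (orderOf θ : F) ≠ 0) {z : Fs} (hz : z ≠ 0)
    {C : RatFunc F ⊗[F] K} {n : RatFunc F} (hn : galNorm θ C = n ⊗ₜ 1)
    (h : IsGammaRegular z C n) :
    BC (ResField F (pushPoint z n)) θ →+* BC (ResField F z) θ :=
  Classical.choose (exists_isResidueMap hr hz (isSeparable_of_isSepClosure z) hn h)

theorem inducedMap_spec (hr : (orderOf θ : F) ≠ 0) {z : Fs} (hz : z ≠ 0)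
    {C : RatFunc F ⊗[F] K} {n : RatFunc F} (hn : galNorm θ C = n ⊗ₜ 1)
    (h : IsGammaRegular z C n) :
    ∃ c, IsReduction z C c ∧ IsResidueMap θ c (inducedMap hr hz hn h) :=
  Classical.choose_spec (exists_isResidueMap hr hz (isSeparable_of_isSepClosure z) hn h)

end Residue

section Conjugation

variable {L : Type*} [Field L] [Algebra F[X] L] [Algebra F L] [IsScalarTower F F[X] L]

variable (K) in
/-- The inclusion `F[Y]_{(N)}[ρ] ⊗_F K → L ⊗_F K`. -/
def localIncl (z : Fs) (ρ : L) : localRing F z ρ ⊗[F] K →ₐ[F] L ⊗[F] K :=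
  baseMap K ((localRing F z ρ).val.restrictScalars F)

variable (K) in
/-- The reduction modulo `N`, from `F[Y]_{(N)}[ρ] ⊗_F K` to `(F[Y]_{(N)}[ρ] / N) ⊗_F K`. -/
def localRed (z : Fs) (ρ : L) : localRing F z ρ ⊗[F] K →ₐ[F] ResRing F z ρ ⊗[F] K :=
  baseMap K ((resMk z ρ).restrictScalars F)

end Conjugation

end Endomorphism

end SkewRes

end

open SkewRes

/-! Write $O'$ for $F[Y]_{(N)}[\rho]$ and $V=\lambda U$. The formula compares two $K$-linear
morphisms from $\mathrm{Frac}(\mathcal A)$ to Laurent series over $(O'/N)\otimes\mathcal A$. One is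
$\Phi(f)=\bar V^{-1}\,\tau_z(V\gamma(f)V^{-1})\,\bar V$ (`conjugatedTaylor`). The other is
$\tau_{\gamma_\star z}$ with $\bar\gamma$ applied to its coefficients, followed by the substitution
$T\mapsto S$, where $\gamma(Y)(Y+T)=\gamma(Y)(Y)+S(T)$ is the expansion of $\gamma(Y)$ at $z$. They
turn out to be equal, and the theorem becomes the invariance of residues under a change of
parameter: $\mathrm{res}(H(S)\,dS)=\mathrm{res}(H\,dT)$, with $dS/dT$ the expansion of
$d\gamma(Y)/dY$.

Both morphisms send $Y$ to the same series, so they agree on $F(Y)$. The conjugation is what makes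
them agree on $X$. The relation $\rho\,\theta(V)=CV$ gives $V\,CX\,V^{-1}=\rho X$, and $\rho$ is
central, so $\tau_z$ multiplies $X$ by a series over $O'/N$ with constant term $\bar\rho$.
Conjugating back by $\bar V$ turns $\bar\rho X$ into $\bar CX=\bar\gamma(X)$. Hence both morphisms
send $X$ to $\bar\gamma(X)$ times a central series with constant term $1$. The $r$-th powers of
these two series agree since both morphisms agree on $Y=X^r$; as $r$ is invertible, the series have
the same image (`eq_of_map_pow_mul_eq`). The comparison is carried out in `map_sresCan_eq`, and
`exists_laurent_subst` is the residue formula, valid in every characteristic.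

The existence of $\lambda$ is Hilbert's Theorem 90 over $O'$ instead of a field. The ring $O'$ is
semilocal: $O'/N$ is finite over $F$, and $N$ lies in the Jacobson radical because $O'$ is integral
over $F[Y]_{(N)}$ (`finite_resRing`, `isUnit_of_isUnit_resMk`). For $d=\rho^{-1}C$, of norm $1$, the
solutions of $\theta(v)=dv$ and those of $\theta(w)=d^{-1}w$ pair into $O'$ by multiplication; the
values generate the unit ideal, and the Chinese remainder theorem yields a pair whose product is a
unit (`exists_unit_galAct_eq_mul`). Any two invertible solutions over the field $\mathcal Z'$ are
proportional, so the solution over $O'$ is some $\lambda U$.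

A recurrent tool is a finite family of pairs $(a,b)$ in $K$ with $\sum a\,\theta^i(b)=\delta_{i0}$
for $0\le i<r$ (`exists_dual_family`). It also shows that the centralizer of $K$ is
$F(Y)\otimes_FK$, whence $\gamma(X)=CX$. -/

namespace SkewRes

noncomputable section

/-! ### Normalised trace and dual families for `θ` -/

section Averaging

variable {F K : Type*} [Field F] [Field K] [Algebra F K] (θ : K ≃ₐ[F] K)

theorem orderOf_ne_zero_of_cast (hr : (orderOf θ : F) ≠ 0) : orderOf θ ≠ 0 := by
  intro h
  rw [h, Nat.cast_zero] at hr
  exact hr rfl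

theorem iterate_eq_pow (i : ℕ) (a : K) : (θ ^ i) a = θ^[i] a := by
  induction i with
  | zero => rfl
  | succ i ih => rw [pow_succ', Function.iterate_succ_apply', ← ih]; rfl

theorem sum_iterate_fixed {M : Type*} [AddCommMonoid M] (f : M →+ M) {r : ℕ} {x : M}
    (h : f^[r] x = x) : f (∑ i ∈ Finset.range r, f^[i] x) = ∑ i ∈ Finset.range r, f^[i] x := by
  rw [map_sum]
  cases r with
  | zero => rfl
  | succ r =>
    rw [Finset.sum_range_succ, Finset.sum_range_succ' (fun i => f^[i] x),
      ← Function.iterate_succ_apply' f, h]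
    simp only [← Function.iterate_succ_apply' f]
    rfl

theorem prod_iterate_fixed {M : Type*} [CommMonoid M] (f : M →* M) {r : ℕ} {x : M}
    (h : f^[r] x = x) : f (∏ i ∈ Finset.range r, f^[i] x) = ∏ i ∈ Finset.range r, f^[i] x := by
  rw [map_prod]
  cases r with
  | zero => rfl
  | succ r =>
    rw [Finset.prod_range_succ, Finset.prod_range_succ' (fun i => f^[i] x),
      ← Function.iterate_succ_apply' f, h]
    simp only [← Function.iterate_succ_apply' f]
    rfl

/-- The sum over the powers of `θ` is fixed by `θ`, so `hfix` puts it in `F`. If `r` vanishes in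
`F`, both inverses take the default value `0` and `t` is zero; only `average_one` needs `r` to be
invertible. -/
theorem exists_average (hfix : ∀ a : K, θ a = a → a ∈ Set.range (algebraMap F K)) :
    ∃ t : K →ₗ[F] F, ∀ a : K,
      algebraMap F K (t a) = (orderOf θ : K)⁻¹ * ∑ i ∈ Finset.range (orderOf θ), (θ ^ i) a := by
  let s : K →ₗ[F] K := ∑ i ∈ Finset.range (orderOf θ), (θ ^ i : K ≃ₐ[F] K).toLinearMap
  have hs : ∀ a, s a = ∑ i ∈ Finset.range (orderOf θ), (θ ^ i) a := fun a => by
    simp [s, LinearMap.sum_apply]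
  have hrange : ∀ a, ((orderOf θ : F)⁻¹ • s) a ∈ LinearMap.range (Algebra.linearMap F K) := by
    intro a
    refine Submodule.smul_mem _ _ ?_
    obtain ⟨b, hb⟩ := hfix (s a) (by
      rw [hs]
      simp only [iterate_eq_pow]
      refine sum_iterate_fixed (θ : K →+ K) ?_
      show θ^[orderOf θ] a = a
      rw [← iterate_eq_pow, pow_orderOf_eq_one]; rfl)
    exact ⟨b, hb⟩
  let e : F ≃ₗ[F] LinearMap.range (Algebra.linearMap F K) :=
    LinearEquiv.ofInjective _ (algebraMap F K).injective
  refine ⟨e.symm.toLinearMap.comp (((orderOf θ : F)⁻¹ • s).codRestrict _ hrange), fun a => ?_⟩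
  have h1 : ∀ y, algebraMap F K (e.symm y) = y := by
    intro y
    obtain ⟨x, rfl⟩ := e.surjective y
    rw [LinearEquiv.symm_apply_apply]; rfl
  refine (h1 _).trans ?_
  show ((orderOf θ : F)⁻¹ • s) a = _
  rw [LinearMap.smul_apply, hs, Algebra.smul_def, map_inv₀, map_natCast]

/-- A fixed choice of the normalised trace `K → F`. -/
def average (hfix : ∀ a : K, θ a = a → a ∈ Set.range (algebraMap F K)) : K →ₗ[F] F :=
  Classical.choose (exists_average θ hfix)

variable (B : Type*) [CommRing B] [Algebra F B]

/-- The normalised trace `B ⊗_F K → B`. -/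
def baseAverage (hfix : ∀ a : K, θ a = a → a ∈ Set.range (algebraMap F K)) : B ⊗[F] K →ₗ[B] B :=
  (AlgebraTensorModule.rid F B B).toLinearMap.comp
    (AlgebraTensorModule.map (LinearMap.id : B →ₗ[B] B) (average θ hfix))

variable {B θ} (hfix : ∀ a : K, θ a = a → a ∈ Set.range (algebraMap F K))

theorem algebraMap_average (a : K) : algebraMap F K (average θ hfix a) =
    (orderOf θ : K)⁻¹ * ∑ i ∈ Finset.range (orderOf θ), (θ ^ i) a :=
  Classical.choose_spec (exists_average θ hfix) a

theorem baseAverage_tmul (b : B) (a : K) :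
    baseAverage θ B hfix (b ⊗ₜ a) = average θ hfix a • b := by
  simp [baseAverage]

theorem galAct_iterate_tmul (i : ℕ) (b : B) (a : K) :
    (galAct B θ)^[i] (b ⊗ₜ a) = b ⊗ₜ (θ ^ i) a := by
  induction i with
  | zero => rfl
  | succ i ih => rw [Function.iterate_succ_apply', ih, galAct_tmul, pow_succ']; rfl

theorem galAct_iterate_add (i : ℕ) (x y : B ⊗[F] K) :
    (galAct B θ)^[i] (x + y) = (galAct B θ)^[i] x + (galAct B θ)^[i] y :=
  iterate_map_add (galAct B θ) i x y

theorem galAct_iterate_mul (i : ℕ) (x y : B ⊗[F] K) :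
    (galAct B θ)^[i] (x * y) = (galAct B θ)^[i] x * (galAct B θ)^[i] y :=
  iterate_map_mul (galAct B θ) i x y

theorem galAct_iterate_orderOf (x : B ⊗[F] K) : (galAct B θ)^[orderOf θ] x = x := by
  induction x using TensorProduct.induction_on with
  | zero => exact iterate_map_zero _ _
  | add x y hx hy => rw [galAct_iterate_add, hx, hy]
  | tmul b a => rw [galAct_iterate_tmul, pow_orderOf_eq_one]; rfl

theorem baseAverage_tmul_one (x : B ⊗[F] K) :
    (baseAverage θ B hfix x) ⊗ₜ[F] (1 : K) =
      (orderOf θ : F)⁻¹ • ∑ i ∈ Finset.range (orderOf θ), (galAct B θ)^[i] x := by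
  induction x using TensorProduct.induction_on with
  | zero => simp
  | add x y hx hy =>
    simp only [galAct_iterate_add]
    rw [map_add, TensorProduct.add_tmul, hx, hy, Finset.sum_add_distrib, smul_add]
  | tmul b a =>
    simp only [galAct_iterate_tmul]
    rw [baseAverage_tmul, TensorProduct.smul_tmul, ← TensorProduct.tmul_sum,
      ← TensorProduct.tmul_smul, Algebra.smul_def, algebraMap_average, mul_one, Algebra.smul_def,
      map_inv₀, map_natCast]

/-- Elements of `B ⊗_F K` that are fixed by `id ⊗ θ` come from `B`. -/
theorem eq_baseAverage_tmul_one (hr : (orderOf θ : F) ≠ 0) {x : B ⊗[F] K} (hx : galAct B θ x = x) :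
    x = (baseAverage θ B hfix x) ⊗ₜ[F] (1 : K) := by
  -- The mean of `r` equal terms is the term itself.
  have h : ∀ i, (galAct B θ)^[i] x = x := fun i => Function.iterate_fixed hx i
  rw [baseAverage_tmul_one]
  simp only [h]
  rw [Finset.sum_const, Finset.card_range, ← Nat.cast_smul_eq_nsmul F, smul_smul,
    inv_mul_cancel₀ hr, one_smul]

theorem average_one (hr : (orderOf θ : F) ≠ 0) : average θ hfix 1 = 1 := by
  have hrK : (orderOf θ : K) ≠ 0 := by
    rw [← map_natCast (algebraMap F K)]
    exact (_root_.map_ne_zero _).2 hr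
  apply (algebraMap F K).injective
  rw [algebraMap_average hfix]
  simp [inv_mul_cancel₀ hrK]

theorem baseAverage_one (hr : (orderOf θ : F) ≠ 0) : baseAverage θ B hfix 1 = 1 := by
  rw [Algebra.TensorProduct.one_def, baseAverage_tmul, average_one hfix hr, one_smul]

theorem galAct_galNorm (c : B ⊗[F] K) : galAct B θ (galNorm θ c) = galNorm θ c :=
  prod_iterate_fixed (galAct B θ : B ⊗[F] K →* B ⊗[F] K) (galAct_iterate_orderOf c)

variable (θ) in
-- The maps `μ i : x ⊗ y ↦ x θ^i(y)` are ring homomorphisms on `K ⊗ K`, so one factor per nonzero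
-- `i` suffices. Choosing `a` not fixed by `θ^i`, the factor `(a - θ^i a)⁻¹ (1 ⊗ a - θ^i a ⊗ 1)` is
-- sent to `1` by `μ 0` and to `0` by `μ i`. Any expression of the product as a sum of pure tensors
-- is the desired family.
theorem exists_dual_family : ∃ S : Finset (K × K), ∀ i < orderOf θ,
    ∑ p ∈ S, p.1 * (θ ^ i) p.2 = if i = 0 then 1 else 0 := by
  have hne : ∀ i : ℕ, i < orderOf θ → i ≠ 0 → ∃ a : K, a - (θ ^ i) a ≠ 0 := by
    intro i hi h0
    by_contra! h
    have h1 : θ ^ i = 1 := AlgEquiv.ext fun a => (sub_eq_zero.1 (h a)).symm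
    exact absurd (Nat.le_of_dvd (Nat.pos_of_ne_zero h0) (orderOf_dvd_of_pow_eq_one h1)) hi.not_ge
  choose! a ha using hne
  let μ : ℕ → K ⊗[F] K →ₐ[F] K := fun i =>
    Algebra.TensorProduct.lift (AlgHom.id F K) ((θ ^ i : K ≃ₐ[F] K) : K →ₐ[F] K)
      (fun _ _ => Commute.all _ _)
  have hμ : ∀ i x y, μ i (x ⊗ₜ y) = x * (θ ^ i) y := fun i x y => by
    simp [μ]
  let e : K ⊗[F] K := ∏ i ∈ (Finset.range (orderOf θ)).erase 0,
    ((a i - (θ ^ i) (a i))⁻¹ ⊗ₜ 1) * ((1 : K) ⊗ₜ[F] a i - (θ ^ i) (a i) ⊗ₜ[F] (1 : K))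
  have he : ∀ i < orderOf θ, μ i e = if i = 0 then 1 else 0 := by
    intro i hi
    rw [map_prod]
    split_ifs with h0
    · subst h0
      refine Finset.prod_eq_one fun j hj => ?_
      rw [Finset.mem_erase, Finset.mem_range] at hj
      rw [map_mul, map_sub, hμ, hμ, hμ]
      simpa using inv_mul_cancel₀ (ha j hj.2 hj.1)
    · refine Finset.prod_eq_zero (i := i) (by simp [h0, hi]) ?_
      rw [map_mul, map_sub, hμ, hμ, hμ]
      simp
  obtain ⟨S, hS⟩ := TensorProduct.exists_finset e
  refine ⟨S, fun i hi => ?_⟩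
  rw [← he i hi, hS, map_sum]
  simp only [hμ]

end Averaging

end

end SkewRes

namespace SkewRes

noncomputable section

/-! ### Normal form of elements, the centralizer of `K`, and endomorphisms -/

section Decomposition

variable {F K : Type*} [Field F] [Field K] [Algebra F K] {θ : K ≃ₐ[F] K}

theorem SkewLaurent.monom_eq_zpow (n : ℤ) : SkewLaurent.monom θ (Multiplicative.ofAdd n) =
    ((SkewLaurent.X θ ^ n : (SkewLaurent θ)ˣ) : SkewLaurent θ) := by
  have hu : SkewLaurent.X θ =
      Units.map (SkewLaurent.monom θ) (toUnits (Multiplicative.ofAdd 1)) := Units.ext rfl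
  rw [hu, ← map_zpow, ← map_zpow, ← ofAdd_zsmul]
  simp

/-- Unlike `SkewLaurent.induction`, this asks for no closure under products, which statements about
residues do not have. -/
theorem SkewLaurent.additive_induction {P : SkewLaurent θ → Prop} (h0 : P 0)
    (hadd : ∀ f g, P f → P g → P (f + g))
    (hterm : ∀ (a : K) (n : ℤ), P (SkewLaurent.const θ a *
      ((SkewLaurent.X θ ^ n : (SkewLaurent θ)ˣ) : SkewLaurent θ))) (f : SkewLaurent θ) : P f := by
  refine SkewMonoidAlgebra.induction_on (k := K) (G := Multiplicative ℤ) (p := P) f h0 ?_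
    (fun f g hf hg => hadd f g hf hg)
  intro n a
  let := powAction θ
  have h2 := SkewMonoidAlgebra.single_mul_single (a₁ := (1 : Multiplicative ℤ))
    (a₂ := n) (b₁ := a) (b₂ := (1 : K))
  have h3 : (SkewMonoidAlgebra.single n a : SkewMonoidAlgebra K (Multiplicative ℤ))
      = SkewLaurent.const θ a * SkewLaurent.monom θ n := by
    refine Eq.trans ?_ h2.symm
    simp
  have h4 := hterm a (Multiplicative.toAdd n)
  rw [← SkewLaurent.monom_eq_zpow] at h4
  have h5 : P (SkewLaurent.const θ a * SkewLaurent.monom θ n) := h4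
  rw [← h3] at h5
  exact h5

theorem SkewFrac.inl_X : BC.inl (RatFunc F) θ RatFunc.X =
    (BC.X (RatFunc F) θ : SkewFrac θ) ^ orderOf θ := by
  rw [← BC.inl_Y, RatFunc.algebraMap_X]

/-- Every element of `Frac(K[X^{±1}; θ])` is a sum of terms `h(Y) a X^i` with `0 ≤ i < r`. -/
theorem SkewFrac.additive_induction (hr : orderOf θ ≠ 0) {P : SkewFrac θ → Prop} (h0 : P 0)
    (hadd : ∀ f g, P f → P g → P (f + g))
    (hterm : ∀ (h : RatFunc F) (a : K), ∀ i < orderOf θ, P (BC.inl (RatFunc F) θ h *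
      BC.const (RatFunc F) θ a * (BC.X (RatFunc F) θ : SkewFrac θ) ^ i)) (f : SkewFrac θ) :
    P f := by
  induction f using TensorProduct.induction_on with
  | zero => exact h0
  | add f g hf hg => exact hadd f g hf hg
  | tmul h f =>
    rw [BC.tmul_eq]
    refine SkewLaurent.additive_induction (P := fun f => P (BC.inl _ θ h * BC.inr _ θ f)) ?_ ?_ ?_ f
    · rw [map_zero, mul_zero]; exact h0
    · intro f g hf hg
      rw [map_add, mul_add]; exact hadd _ _ hf hg
    · intro a n
      have hpos : (0 : ℤ) < (orderOf θ : ℤ) := by exact_mod_cast Nat.pos_of_ne_zero hr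
      obtain ⟨s, hs⟩ := Int.eq_ofNat_of_zero_le (Int.emod_nonneg n hpos.ne')
      have hsr : s < orderOf θ := by
        have := Int.emod_lt_of_pos n hpos
        rw [hs] at this
        exact_mod_cast this
      -- Euclidean division `n = r q + s`: the factor `X ^ (r q)` is `Y ^ q`, a central unit that is
      -- absorbed into the coefficient `h`, also for negative `q`.
      have hX : BC.X (RatFunc F) θ ^ n =
          Units.map (BC.inl (RatFunc F) θ : RatFunc F →* SkewFrac θ)
            (Units.mk0 RatFunc.X RatFunc.X_ne_zero) ^ (n / (orderOf θ : ℤ)) *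
            BC.X (RatFunc F) θ ^ s := by
        have h1 : Units.map (BC.inl (RatFunc F) θ : RatFunc F →* SkewFrac θ)
            (Units.mk0 RatFunc.X RatFunc.X_ne_zero) = BC.X (RatFunc F) θ ^ orderOf θ :=
          Units.ext (SkewFrac.inl_X.trans (Units.val_pow_eq_pow_val _ _).symm)
        rw [h1, ← zpow_natCast, ← zpow_mul, ← zpow_natCast, ← zpow_add]
        congr 1
        have := Int.mul_ediv_add_emod n (orderOf θ : ℤ)
        rw [hs] at this
        exact this.symm
      have hinr : BC.inr (RatFunc F) θ ((SkewLaurent.X θ ^ n : (SkewLaurent θ)ˣ) : SkewLaurent θ) =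
          ((BC.X (RatFunc F) θ ^ n : (SkewFrac θ)ˣ) : SkewFrac θ) :=
        congrArg Units.val (map_zpow (Units.map (BC.inr (RatFunc F) θ : SkewLaurent θ →* SkewFrac θ))
          (SkewLaurent.X θ) n)
      have h2 := hterm (h * ((Units.mk0 (RatFunc.X : RatFunc F) RatFunc.X_ne_zero ^
        (n / (orderOf θ : ℤ)) : (RatFunc F)ˣ) : RatFunc F)) a s hsr
      rw [map_mul, hinr, hX, Units.val_mul, ← map_zpow, Units.val_pow_eq_pow_val]
      rw [map_mul, mul_assoc (BC.inl _ θ h), (BC.inl_commute _ (BC.const _ θ a)).eq] at h2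
      simp only [mul_assoc] at h2 ⊢
      exact h2

theorem SkewFrac.exists_eq_sum (hr : orderOf θ ≠ 0) (f : SkewFrac θ) :
    ∃ c : ℕ → RatFunc F ⊗[F] K, f = ∑ i ∈ Finset.range (orderOf θ),
      BC.comm (RatFunc F) θ (c i) * (BC.X (RatFunc F) θ : SkewFrac θ) ^ i := by
  refine SkewFrac.additive_induction hr (P := fun f => ∃ c : ℕ → RatFunc F ⊗[F] K, f =
    ∑ i ∈ Finset.range (orderOf θ), BC.comm (RatFunc F) θ (c i) *
      (BC.X (RatFunc F) θ : SkewFrac θ) ^ i) ⟨0, by simp⟩ ?_ ?_ f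
  · rintro f g ⟨c, rfl⟩ ⟨d, rfl⟩
    refine ⟨c + d, ?_⟩
    rw [← Finset.sum_add_distrib]
    refine Finset.sum_congr rfl fun i _ => ?_
    rw [Pi.add_apply, map_add, add_mul]
  · intro h a i hi
    refine ⟨Pi.single i (h ⊗ₜ a), ?_⟩
    rw [Finset.sum_eq_single i]
    · rw [Pi.single_eq_same, BC.comm_tmul]
    · intro j _ hj
      rw [Pi.single_eq_of_ne hj, map_zero, zero_mul]
    · intro h; exact absurd (Finset.mem_range.2 hi) h

theorem BC.X_pow_mul_const {B : Type*} [CommRing B] [Algebra F[X] B] (i : ℕ) (a : K) :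
    (BC.X B θ : BC B θ) ^ i * BC.const B θ a = BC.const B θ ((θ ^ i) a) * (BC.X B θ : BC B θ) ^ i := by
  induction i generalizing a with
  | zero => simp
  | succ i ih =>
    rw [pow_succ, mul_assoc, BC.X_mul_const, ← mul_assoc, ih, mul_assoc, pow_succ]; rfl

theorem BC.comm_one_tmul {B : Type*} [CommRing B] [Algebra F[X] B] [Algebra F B]
    [IsScalarTower F F[X] B] (a : K) : BC.comm B θ (1 ⊗ₜ a) = BC.const B θ a := by
  rw [BC.comm_tmul, map_one, one_mul]

theorem BC.comm_tmul_one {B : Type*} [CommRing B] [Algebra F[X] B] [Algebra F B]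
    [IsScalarTower F F[X] B] (b : B) : BC.comm B θ (b ⊗ₜ 1) = BC.inl B θ b := by
  rw [BC.comm_tmul, map_one, mul_one]

theorem BC.const_commute_comm {B : Type*} [CommRing B] [Algebra F[X] B] [Algebra F B]
    [IsScalarTower F F[X] B] (a : K) (c : B ⊗[F] K) :
    Commute (BC.const B θ a) (BC.comm B θ c) := by
  rw [← BC.comm_one_tmul]; exact BC.comm_commute θ _ _

/-- The centralizer of `K` in `Frac(K[X^{±1}; θ])` is `F(Y) ⊗_F K`. -/
theorem SkewFrac.exists_comm_of_commute (hr : orderOf θ ≠ 0) {f : SkewFrac θ}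
    (hf : ∀ a, Commute f (BC.const (RatFunc F) θ a)) : ∃ c, f = BC.comm (RatFunc F) θ c := by
  obtain ⟨S, hS⟩ := exists_dual_family θ
  obtain ⟨c, hc⟩ := SkewFrac.exists_eq_sum hr f
  refine ⟨c 0, ?_⟩
  -- The operator `f ↦ ∑ p.1 f p.2` of the dual family is the identity on elements that commute with
  -- `K`; by `h3` it projects the normal form onto its term of degree `0`.
  have h1 : ∑ p ∈ S, BC.const (RatFunc F) θ p.1 * f * BC.const (RatFunc F) θ p.2 = f := by
    have h2 : ∀ p : K × K, BC.const (RatFunc F) θ p.1 * f * BC.const (RatFunc F) θ p.2 =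
        BC.const (RatFunc F) θ (p.1 * (θ ^ 0) p.2) * f := by
      intro p
      rw [mul_assoc, (hf p.2).eq, ← mul_assoc, ← map_mul]; rfl
    simp only [h2]
    rw [← Finset.sum_mul, ← map_sum, hS 0 (Nat.pos_of_ne_zero hr), if_pos rfl, map_one, one_mul]
  have h3 : ∀ i ∈ Finset.range (orderOf θ), ∑ p ∈ S, BC.const (RatFunc F) θ p.1 *
      (BC.comm (RatFunc F) θ (c i) * (BC.X (RatFunc F) θ : SkewFrac θ) ^ i) *
        BC.const (RatFunc F) θ p.2 =
      BC.const (RatFunc F) θ (if i = 0 then 1 else 0) *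
        (BC.comm (RatFunc F) θ (c i) * (BC.X (RatFunc F) θ : SkewFrac θ) ^ i) := by
    intro i hi
    rw [← hS i (Finset.mem_range.1 hi), map_sum, Finset.sum_mul]
    refine Finset.sum_congr rfl fun p _ => ?_
    rw [mul_assoc, mul_assoc (BC.comm _ θ (c i)), BC.X_pow_mul_const,
      ← mul_assoc (BC.comm _ θ (c i)), ← (BC.const_commute_comm _ _).eq, map_mul]
    simp only [mul_assoc]
  rw [← h1]
  conv_lhs => rw [hc]
  simp only [Finset.mul_sum, Finset.sum_mul]
  rw [Finset.sum_comm, Finset.sum_congr rfl h3, Finset.sum_eq_single 0]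
  · rw [if_pos rfl, map_one, one_mul, pow_zero, mul_one]
  · intro i _ hi
    rw [if_neg hi, map_zero, zero_mul]
  · intro h; exact absurd (Finset.mem_range.2 (Nat.pos_of_ne_zero hr)) h

/-- The endomorphisms of the `K`-algebra `Frac(K[X^{±1}; θ])` are of the form `X ↦ C X`. -/
theorem exists_eq_comm_mul_X (hfix : ∀ a : K, θ a = a → a ∈ Set.range (algebraMap F K))
    (hr : (orderOf θ : F) ≠ 0) (γ : SkewFrac θ →+* SkewFrac θ)
    (hγ : ∀ a : K, γ (BC.const (RatFunc F) θ a) = BC.const (RatFunc F) θ a) :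
    ∃ (C : RatFunc F ⊗[F] K) (n : RatFunc F), galNorm θ C = n ⊗ₜ 1 ∧
      γ (BC.X (RatFunc F) θ : SkewFrac θ) =
        BC.comm (RatFunc F) θ C * (BC.X (RatFunc F) θ : SkewFrac θ) ∧
      γ (BC.inl (RatFunc F) θ RatFunc.X) = BC.inl (RatFunc F) θ (n * RatFunc.X) := by
  -- Both `X` and `γ(X)` twist constants by `θ`, so `γ(X) X⁻¹` centralizes `K`.
  obtain ⟨C, hC⟩ := SkewFrac.exists_comm_of_commute (orderOf_ne_zero_of_cast θ hr)
    (f := γ (BC.X (RatFunc F) θ : SkewFrac θ) * ((BC.X (RatFunc F) θ)⁻¹ : (SkewFrac θ)ˣ)) (by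
      intro a
      have h1 : γ (BC.X (RatFunc F) θ : SkewFrac θ) * BC.const (RatFunc F) θ (θ.symm a) =
          BC.const (RatFunc F) θ a * γ (BC.X (RatFunc F) θ : SkewFrac θ) := by
        have := congrArg γ (BC.X_mul_const (B := RatFunc F) (θ := θ) (θ.symm a))
        rwa [map_mul, map_mul, hγ, hγ, AlgEquiv.apply_symm_apply] at this
      have h2 : ((BC.X (RatFunc F) θ)⁻¹ : (SkewFrac θ)ˣ) * BC.const (RatFunc F) θ a =
          BC.const (RatFunc F) θ (θ.symm a) * ((BC.X (RatFunc F) θ)⁻¹ : (SkewFrac θ)ˣ) := by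
        rw [Units.inv_mul_eq_iff_eq_mul, ← mul_assoc, BC.X_mul_const, AlgEquiv.apply_symm_apply,
          mul_assoc, Units.mul_inv, mul_one]
      show _ * _ = _ * _
      rw [mul_assoc, h2, ← mul_assoc, h1, mul_assoc])
  rw [Units.mul_inv_eq_iff_eq_mul] at hC
  -- The norm is invariant under `id ⊗ θ`, and the invariants of `F(Y) ⊗ K` are `F(Y)`.
  obtain ⟨n, hn⟩ : ∃ n : RatFunc F, galNorm θ C = n ⊗ₜ 1 :=
    ⟨_, eq_baseAverage_tmul_one hfix hr (galAct_galNorm (θ := θ) C)⟩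
  refine ⟨C, n, hn, hC, ?_⟩
  rw [SkewFrac.inl_X, map_pow, hC, BC.comm_mul_X_pow]
  have h2 : (∏ i ∈ Finset.range (orderOf θ), (galAct (RatFunc F) θ)^[i] C) = galNorm θ C := rfl
  rw [h2, hn, BC.comm_tmul_one, ← SkewFrac.inl_X, ← map_mul]

end Decomposition

end

end SkewRes

namespace SkewRes

noncomputable section

/-! ### Unit values of bilinear forms over semilocal rings -/

section Semilocal

/-- With `e i` congruent to `1` modulo `I i` and to `0` modulo the other ideals, `∑ e i • m i`
behaves like `m i` at the `i`-th ideal. This argument is insensitive to the size of the residue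
fields, which may be finite. -/
theorem exists_forall_notMem {O M ι : Type*} [CommRing O] [AddCommGroup M] [Module O M] [Finite ι]
    {I : ι → Ideal O} (hI : ∀ i, (I i).IsMaximal) (hinj : Function.Injective I)
    (φ : ι → M →ₗ[O] O) (h : ∀ i, ∃ m, φ i m ∉ I i) : ∃ m, ∀ i, φ i m ∉ I i := by
  classical
  have := Fintype.ofFinite ι
  have hcop : Pairwise (Function.onFun IsCoprime I) := fun i j hij =>
    Ideal.isCoprime_of_isMaximal (hinj.ne hij)
  have he : ∀ i, ∃ e : O, ∀ j, e - (if j = i then 1 else 0) ∈ I j := fun i =>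
    Ideal.exists_forall_sub_mem_ideal hcop _
  choose e he using he
  choose m hm using h
  refine ⟨∑ i, e i • m i, fun i hi => hm i ?_⟩
  have h1 : φ i (∑ j, e j • m j) - φ i (m i) ∈ I i := by
    have h2 : φ i (m i) = ∑ j, (if i = j then (1 : O) else 0) * φ i (m j) := by simp
    rw [h2, map_sum, ← Finset.sum_sub_distrib]
    refine sum_mem fun j _ => ?_
    rw [map_smul, smul_eq_mul, ← sub_mul]
    exact Ideal.mul_mem_right _ _ (he j i)
  exact (Submodule.sub_mem_iff_right _ hi).1 h1

/-- A bilinear form whose values generate the unit ideal takes a unit value, if the ring has only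
finitely many maximal ideals. -/
theorem exists_isUnit_pairing {O E M M' : Type*} [CommRing O] [CommRing E] [AddCommGroup M]
    [Module O M] [AddCommGroup M'] [Module O M'] [Finite (MaximalSpectrum E)] {f : O →+* E}
    (hf : Function.Surjective f) (p : M →ₗ[O] M' →ₗ[O] O)
    (h : ∀ I : Ideal O, I.IsMaximal → ∃ m m', p m m' ∉ I) : ∃ m m', IsUnit (f (p m m')) := by
  let I : MaximalSpectrum E → Ideal O := fun i => i.asIdeal.comap f
  have hI : ∀ i, (I i).IsMaximal := fun i => by
    have := i.isMaximal
    exact Ideal.comap_isMaximal_of_surjective f hf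
  have hinj : Function.Injective I := fun i j hij =>
    MaximalSpectrum.ext (Ideal.comap_injective_of_surjective f hf hij)
  choose m₁ m' hm using fun i => h (I i) (hI i)
  -- The two arguments are glued one after the other: first `m` against the local choices `m' i`,
  -- then `m''` against the global `m`.
  obtain ⟨m, h1⟩ := exists_forall_notMem hI hinj (fun i => p.flip (m' i)) (fun i => ⟨m₁ i, hm i⟩)
  obtain ⟨m'', h2⟩ := exists_forall_notMem hI hinj (fun _ => p m) (fun i => ⟨m' i, h1 i⟩)
  refine ⟨m, m'', ?_⟩
  by_contra hu
  obtain ⟨J, hJ, hmem⟩ := exists_max_ideal_of_mem_nonunits hu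
  exact h2 ⟨J, hJ⟩ hmem

end Semilocal

/-! ### Hilbert's Theorem 90 over a semilocal ring -/

section Hilbert

variable {F K : Type*} [Field F] [Field K] [Algebra F K] {θ : K ≃ₐ[F] K}
  {O : Type*} [CommRing O] [Algebra F O]

theorem galAct_smul (o : O) (x : O ⊗[F] K) : galAct O θ (o • x) = o • galAct O θ x := by
  have h : ∀ y : O ⊗[F] K, o • y = (o ⊗ₜ 1) * y := fun y => by
    rw [Algebra.smul_def]; rfl
  rw [h, h, map_mul, galAct_tmul, map_one]

theorem galNorm_mul (c d : O ⊗[F] K) : galNorm θ (c * d) = galNorm θ c * galNorm θ d := by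
  unfold galNorm
  rw [← Finset.prod_mul_distrib]
  exact Finset.prod_congr rfl fun i _ => galAct_iterate_mul i c d

variable (θ) in
theorem galNorm_one : galNorm θ (1 : O ⊗[F] K) = 1 :=
  Finset.prod_eq_one fun i _ => iterate_map_one (galAct O θ) i

theorem galNorm_tmul_one (b : O) : galNorm θ (b ⊗ₜ[F] (1 : K)) = (b ^ orderOf θ) ⊗ₜ 1 := by
  unfold galNorm
  simp only [galAct_iterate_tmul, map_one]
  rw [Finset.prod_const, Finset.card_range, Algebra.TensorProduct.tmul_pow, one_pow]

theorem baseMap_galNorm {B : Type*} [CommRing B] [Algebra F B] (g : O →ₐ[F] B) (c : O ⊗[F] K) :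
    baseMap K g (galNorm θ c) = galNorm θ (baseMap K g c) := by
  have h : ∀ i, baseMap K g ((galAct O θ)^[i] c) = (galAct B θ)^[i] (baseMap K g c) := by
    intro i
    induction i with
    | zero => rfl
    | succ i ih =>
      rw [Function.iterate_succ_apply', Function.iterate_succ_apply', ← ih, galAct_baseMap]
  unfold galNorm
  rw [map_prod]
  exact Finset.prod_congr rfl fun i _ => h i

theorem baseMap_injective {B : Type*} [CommRing B] [Algebra F B] (g : O →ₐ[F] B)
    (hg : Function.Injective g) : Function.Injective (baseMap K g) :=
  Module.Flat.rTensor_preserves_injective_linearMap (M := K) g.toLinearMap hg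

variable (θ) in
/-- The elements `v` of `O ⊗_F K` with `d θ(v) = v`. -/
def twisted (d : O ⊗[F] K) : Submodule O (O ⊗[F] K) where
  carrier := {v | d * galAct O θ v = v}
  zero_mem' := by
    show _ = _
    rw [map_zero, mul_zero]
  add_mem' {v w} hv hw := by
    show _ = _
    rw [map_add, mul_add, hv, hw]
  smul_mem' o v hv := by
    show _ = _
    rw [galAct_smul, mul_smul_comm, hv]

theorem mem_twisted {d v : O ⊗[F] K} : v ∈ twisted θ d ↔ d * galAct O θ v = v := Iff.rfl

/-- These are Lagrange resolvents. Applying `v ↦ d θ(v)` moves each term to the next one, and the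
term of index `r` is the one of index `0`, because `d` has norm `1` and `θ ^ r = 1`. -/
theorem sum_mem_twisted {d : O ⊗[F] K} (hd : galNorm θ d = 1) (x : O ⊗[F] K) :
    ∑ i ∈ Finset.range (orderOf θ), (∏ k ∈ Finset.range i, (galAct O θ)^[k] d) *
      (galAct O θ)^[i] x ∈ twisted θ d := by
  rw [mem_twisted, map_sum, Finset.mul_sum]
  have h1 : ∀ i, d * galAct O θ ((∏ k ∈ Finset.range i, (galAct O θ)^[k] d) *
      (galAct O θ)^[i] x) = (∏ k ∈ Finset.range (i + 1), (galAct O θ)^[k] d) *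
      (galAct O θ)^[i + 1] x := by
    intro i
    rw [map_mul, map_prod, Finset.prod_range_succ' _ i, ← mul_assoc, mul_comm d]
    simp only [← Function.iterate_succ_apply' (galAct O θ)]
    rfl
  have h2 := Finset.sum_range_succ (fun i => (∏ k ∈ Finset.range i, (galAct O θ)^[k] d) *
      (galAct O θ)^[i] x) (orderOf θ)
  rw [Finset.sum_range_succ'] at h2
  have h3 : (∏ k ∈ Finset.range (orderOf θ), (galAct O θ)^[k] d) = 1 := hd
  rw [h3, galAct_iterate_orderOf, Finset.prod_range_zero, Function.iterate_zero, id] at h2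
  simp only [h1]
  exact add_right_cancel h2

/-- The module of twisted elements generates the unit ideal. -/
theorem exists_one_eq_sum_twisted (hr : orderOf θ ≠ 0) {d : O ⊗[F] K} (hd : galNorm θ d = 1) :
    ∃ (S : Finset (K × K)) (v : K × K → twisted θ d),
      (1 : O ⊗[F] K) = ∑ p ∈ S, (1 ⊗ₜ p.1) * (v p : O ⊗[F] K) := by
  obtain ⟨S, hS⟩ := exists_dual_family θ
  refine ⟨S, fun p => ⟨_, sum_mem_twisted hd (1 ⊗ₜ p.2)⟩, ?_⟩
  simp only [Finset.mul_sum]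
  -- With the sums exchanged, the `i`-th product of conjugates of `d` has coefficient `∑ p.1
  -- θ^i(p.2)`, and only `i = 0` survives.
  rw [Finset.sum_comm, Finset.sum_eq_single 0]
  · have h0 := hS 0 (Nat.pos_of_ne_zero hr)
    rw [if_pos rfl] at h0
    simp only [Finset.prod_range_zero, Function.iterate_zero, id, one_mul,
      Algebra.TensorProduct.tmul_mul_tmul]
    rw [← TensorProduct.tmul_sum]
    exact congrArg (fun a => (1 : O) ⊗ₜ[F] a) h0.symm
  · intro i hi h0
    have h1 := hS i (Finset.mem_range.1 hi)
    rw [if_neg h0] at h1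
    have h2 : ∀ p : K × K, ((1 : O) ⊗ₜ[F] p.1) * ((∏ k ∈ Finset.range i, (galAct O θ)^[k] d) *
        (galAct O θ)^[i] (1 ⊗ₜ p.2)) =
        (∏ k ∈ Finset.range i, (galAct O θ)^[k] d) * (1 ⊗ₜ (p.1 * (θ ^ i) p.2)) := by
      intro p
      rw [mul_left_comm, galAct_iterate_tmul, Algebra.TensorProduct.tmul_mul_tmul, one_mul]
    simp only [h2]
    rw [← Finset.mul_sum, ← TensorProduct.tmul_sum, h1, TensorProduct.tmul_zero, mul_zero]
  · intro h; exact absurd (Finset.mem_range.2 (Nat.pos_of_ne_zero hr)) h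

/-- Hilbert's Theorem 90 over a ring with finitely many maximal ideals. -/
theorem exists_unit_galAct_eq_mul
    (hfix : ∀ a : K, θ a = a → a ∈ Set.range (algebraMap F K)) (hr : (orderOf θ : F) ≠ 0)
    {E : Type*} [CommRing E] [Finite (MaximalSpectrum E)] {f : O →+* E}
    (hf : Function.Surjective f) (hunit : ∀ x, IsUnit (f x) → IsUnit x) {d : O ⊗[F] K}
    (hd : galNorm θ d = 1) : ∃ v : (O ⊗[F] K)ˣ, galAct O θ v = d * v := by
  have hr0 := orderOf_ne_zero_of_cast θ hr
  have hdu : IsUnit d := by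
    refine isUnit_of_dvd_one (hd ▸ ?_)
    exact Finset.dvd_prod_of_mem (fun i => (galAct O θ)^[i] d) (a := 0)
      (Finset.mem_range.2 (Nat.pos_of_ne_zero hr0))
  -- The equation `θ(v) = d v` says that `v` lies in `twisted θ d'`, where `d'` is the inverse of
  -- `d`. Its natural partner is `twisted θ d`, since the twists cancel in a product.
  obtain ⟨d', hdd⟩ := hdu.exists_right_inv
  have hd' : galNorm θ d' = 1 := by
    have := galNorm_mul (θ := θ) d d'
    rwa [hdd, hd, one_mul, galNorm_one, eq_comm] at this
  have hprod : ∀ (v : twisted θ d') (w : twisted θ d),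
      galAct O θ ((v : O ⊗[F] K) * w) = (v : O ⊗[F] K) * w := by
    intro v w
    have hv := mem_twisted.1 v.2
    have hw := mem_twisted.1 w.2
    conv_rhs => rw [← hv, ← hw]
    rw [map_mul, mul_mul_mul_comm, mul_comm d', hdd, one_mul]
  let p : twisted θ d' →ₗ[O] twisted θ d →ₗ[O] O :=
    ((LinearMap.mul O (O ⊗[F] K)).compr₂ (baseAverage θ O hfix)).domRestrict₁₂ _ _
  have hp : ∀ (v : twisted θ d') (w : twisted θ d),
      (v : O ⊗[F] K) * (w : O ⊗[F] K) = p v w ⊗ₜ 1 := fun v w => eq_baseAverage_tmul_one hfix hr (hprod v w)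
  -- If all values of the pairing lay in a maximal ideal `I`, multiplying the expansions of `1` over
  -- the two twisted modules and taking the normalised trace would put `1` in `I`.
  obtain ⟨v, w, huvw⟩ := exists_isUnit_pairing hf p (by
    intro I hI
    by_contra! hall
    obtain ⟨S, v, hv⟩ := exists_one_eq_sum_twisted hr0 hd'
    obtain ⟨T, w, hw⟩ := exists_one_eq_sum_twisted hr0 hd
    refine hI.ne_top ((Ideal.eq_top_iff_one _).2 ?_)
    rw [← baseAverage_one hfix hr (B := O), ← mul_one (1 : O ⊗[F] K)]
    nth_rewrite 1 [hv]
    rw [hw, Finset.sum_mul_sum, map_sum]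
    refine sum_mem fun i _ => ?_
    rw [map_sum]
    refine sum_mem fun j _ => ?_
    rw [mul_mul_mul_comm, hp, Algebra.TensorProduct.tmul_mul_tmul,
      Algebra.TensorProduct.tmul_mul_tmul, baseAverage_tmul, mul_one, one_mul, one_mul,
      Algebra.smul_def]
    exact Ideal.mul_mem_left _ _ (hall _ _))
  have hu : IsUnit (v : O ⊗[F] K) := by
    refine isUnit_of_mul_isUnit_left (y := (w : O ⊗[F] K)) ?_
    rw [hp]
    exact (hunit _ huvw).map (Algebra.TensorProduct.includeLeft : O →ₐ[F] O ⊗[F] K)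
  obtain ⟨u, hu⟩ := hu
  refine ⟨u, ?_⟩
  have h1 := mem_twisted.1 v.2
  rw [hu, ← h1, ← mul_assoc, hdd, one_mul, h1]

end Hilbert

end

end SkewRes

namespace SkewRes

noncomputable section

/-! ### The ring `F[Y]_{(N)}[ρ]` is semilocal -/

section LocalRing

variable {F Fs L : Type*} [Field F] [Field Fs] [Algebra F Fs] [Field L] [Algebra F[X] L]
  {z : Fs} {ρ : L}

variable (z ρ) in
theorem self_mem_localRing : ρ ∈ localRing F z ρ := ⟨1, by simp, by
  rw [map_one, one_mul]; exact Algebra.self_mem_adjoin_singleton _ _⟩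

variable (F z ρ) in
/-- The generator `ρ` of `F[Y]_{(N)}[ρ]`. -/
def localGen : localRing F z ρ := ⟨ρ, self_mem_localRing z ρ⟩

theorem aeval_resRing_X [Algebra F L] [IsScalarTower F F[X] L] (p : F[X]) :
    aeval (algebraMap F[X] (ResRing F z ρ) Polynomial.X) p = algebraMap F[X] (ResRing F z ρ) p := by
  rw [aeval_algebraMap_apply, aeval_X_left_apply]

variable [Algebra (RatFunc F) L] [IsScalarTower F[X] (RatFunc F) L]

theorem algebraMap_denom_mul (n : RatFunc F) : algebraMap F[X] L n.denom *
    algebraMap (RatFunc F) L n = algebraMap F[X] L n.num := by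
  rw [IsScalarTower.algebraMap_apply F[X] (RatFunc F) L n.denom, ← map_mul,
    IsScalarTower.algebraMap_apply F[X] (RatFunc F) L n.num]
  congr 1
  have h2 := RatFunc.num_div_denom n
  rw [div_eq_iff (by
    rw [Ne, map_eq_zero_iff _ (IsFractionRing.injective F[X] (RatFunc F))]
    exact n.denom_ne_zero)] at h2
  rw [h2, mul_comm]

theorem isUnit_localRing (ρ : L) {b : F[X]} (hb : aeval z b ≠ 0) :
    IsUnit (algebraMap F[X] (localRing F z ρ) b) := by
  have hb0 : algebraMap F[X] L b ≠ 0 := by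
    rw [Ne, map_eq_zero_iff _ algebraMap_injective_of_tower]
    rintro rfl
    exact hb (map_zero _)
  refine IsUnit.of_mul_eq_one ⟨(algebraMap F[X] L b)⁻¹, b, hb, ?_⟩
    (Subtype.ext (mul_inv_cancel₀ hb0))
  rw [mul_inv_cancel₀ hb0]
  exact one_mem _

variable {r : ℕ} {n : RatFunc F}

theorem denom_mul_localGen_pow (hρ : ρ ^ r = algebraMap (RatFunc F) L n) :
    algebraMap F[X] (localRing F z ρ) n.denom * localGen F z ρ ^ r =
      algebraMap F[X] (localRing F z ρ) n.num := by
  apply Subtype.ext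
  show algebraMap F[X] L n.denom * ρ ^ r = algebraMap F[X] L n.num
  rw [hρ, algebraMap_denom_mul]

theorem isUnit_localGen (hr : r ≠ 0) (hρ : ρ ^ r = algebraMap (RatFunc F) L n)
    (hnum : aeval z n.num ≠ 0) : IsUnit (localGen F z ρ) := by
  refine isUnit_of_dvd_unit ?_ (isUnit_localRing ρ hnum)
  rw [← denom_mul_localGen_pow hρ]
  exact (dvd_pow_self _ hr).mul_left _

/-- The generator causes no trouble, since `n.denom * ρ` has an `r`-th power in `F[Y]`; denominators
that do not vanish at `z` are then carried through sums and products. -/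
theorem exists_isIntegral_mul (hr : r ≠ 0) (hρ : ρ ^ r = algebraMap (RatFunc F) L n)
    (hden : aeval z n.denom ≠ 0) (x : localRing F z ρ) :
    ∃ b : F[X], aeval z b ≠ 0 ∧ IsIntegral F[X] (algebraMap F[X] L b * x) := by
  obtain ⟨x, b, hb, hx⟩ := x
  suffices h : ∃ c : F[X], aeval z c ≠ 0 ∧
      IsIntegral F[X] (algebraMap F[X] L c * (algebraMap F[X] L b * x)) by
    obtain ⟨c, hc, h⟩ := h
    refine ⟨c * b, by rw [map_mul]; exact mul_ne_zero hc hb, ?_⟩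
    rwa [map_mul, mul_assoc]
  refine Algebra.adjoin_induction (p := fun y _ => ∃ c : F[X], aeval z c ≠ 0 ∧
      IsIntegral F[X] (algebraMap F[X] L c * y)) ?_ ?_ ?_ ?_ hx
  · rintro y rfl
    refine ⟨n.denom, hden, IsIntegral.of_pow (Nat.pos_of_ne_zero hr) ?_⟩
    obtain ⟨k, rfl⟩ := Nat.exists_eq_succ_of_ne_zero hr
    rw [mul_pow, hρ, pow_succ, mul_assoc, algebraMap_denom_mul, ← map_pow, ← map_mul]
    exact isIntegral_algebraMap
  · intro p
    exact ⟨1, by simp, by rw [map_one, one_mul]; exact isIntegral_algebraMap⟩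
  · rintro x y _ _ ⟨c, hc, hx⟩ ⟨d, hd, hy⟩
    refine ⟨c * d, by rw [map_mul]; exact mul_ne_zero hc hd, ?_⟩
    have : algebraMap F[X] L (c * d) * (x + y) =
        algebraMap F[X] L d * (algebraMap F[X] L c * x) +
        algebraMap F[X] L c * (algebraMap F[X] L d * y) := by
      rw [map_mul]; ring
    rw [this]
    exact (isIntegral_algebraMap.mul hx).add (isIntegral_algebraMap.mul hy)
  · rintro x y _ _ ⟨c, hc, hx⟩ ⟨d, hd, hy⟩
    refine ⟨c * d, by rw [map_mul]; exact mul_ne_zero hc hd, ?_⟩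
    rw [map_mul, mul_mul_mul_comm]
    exact hx.mul hy

/-- That is, `N` lies in the Jacobson radical. If `x y = 1 + w N`, an integral equation for a
multiple of `w` shows that `x y` divides a polynomial in `Y` that is nonzero at `z`, hence a unit.
-/
theorem isUnit_of_isUnit_resMk (hr : r ≠ 0) (hρ : ρ ^ r = algebraMap (RatFunc F) L n)
    (hden : aeval z n.denom ≠ 0) {x : localRing F z ρ} (hx : IsUnit (resMk z ρ x)) :
    IsUnit x := by
  obtain ⟨y', hy'⟩ := hx.exists_right_inv
  obtain ⟨y, rfl⟩ := Ideal.Quotient.mk_surjective y'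
  have h1 : x * y - 1 ∈ Ideal.span {algebraMap F[X] (localRing F z ρ) (minpoly F z)} := by
    rw [← Ideal.Quotient.eq_zero_iff_mem, map_sub, sub_eq_zero, map_mul, map_one]
    exact hy'
  obtain ⟨w, hw⟩ := Ideal.mem_span_singleton'.1 h1
  refine isUnit_of_mul_isUnit_left (y := y) ?_
  obtain ⟨b, hb, p, hp, hpw⟩ := exists_isIntegral_mul hr hρ hden w
  set ι := algebraMap F[X] (localRing F z ρ)
  set N := minpoly F z
  have hpw' : aeval (ι b * w) p = 0 := Subtype.ext (by
    have := Polynomial.aeval_algHom_apply (localRing F z ρ).val (ι b * w) p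
    exact this.symm.trans hpw)
  -- Scaling the roots of `p` by `-N` gives a polynomial `P` that vanishes at `-N b w`. As `b x y =
  -- b - (-N b w)`, it divides `P(b) - P(-N b w) = P(b)`.
  have hroot : aeval (ι (-N) * (ι b * w)) (p.scaleRoots (-N)) = 0 :=
    scaleRoots_aeval_eq_zero hpw'
  have hdvd : ι b * (x * y) ∣ ι (eval b (p.scaleRoots (-N))) := by
    have h2 := Polynomial.sub_dvd_eval_sub (ι b) (ι (-N) * (ι b * w))
      ((p.scaleRoots (-N)).map ι)
    rw [eval_map_algebraMap, eval_map_algebraMap, hroot, sub_zero, aeval_algebraMap_apply,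
      coe_aeval_eq_eval] at h2
    have h3 : ι b * (x * y) = ι b - ι (-N) * (ι b * w) := by
      rw [map_neg, ← sub_add_cancel (x * y) 1, ← hw]; ring
    rw [h3]; exact h2
  -- At `z` the scaling factor `-N` becomes `0`, so `P` becomes a pure power and `P(b)` takes the
  -- value `b(z) ^ deg p`.
  have hval : aeval z (eval b (p.scaleRoots (-N))) ≠ 0 := by
    have h4 : aeval z (eval b (p.scaleRoots (-N))) =
        eval (aeval z b) ((p.scaleRoots (-N)).map (aeval z : F[X] →ₐ[F] Fs).toRingHom) := by
      rw [eval_map, ← Polynomial.coe_eval₂RingHom]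
      exact (Polynomial.hom_eval₂ _ (RingHom.id _) (aeval z : F[X] →ₐ[F] Fs).toRingHom b)
    have h5 : (aeval z : F[X] →ₐ[F] Fs).toRingHom (-N) = 0 := by
      show aeval z (-N) = 0
      rw [map_neg, minpoly.aeval, neg_zero]
    rw [h4, map_scaleRoots _ _ _ (by rw [hp.leadingCoeff, map_one]; exact one_ne_zero), h5,
      scaleRoots_zero, (hp.map _).leadingCoeff, one_smul, eval_pow, eval_X]
    exact pow_ne_zero _ hb
  exact isUnit_of_mul_isUnit_right (isUnit_of_dvd_unit hdvd (isUnit_localRing ρ hval))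

/-- Localising adds nothing modulo `N`: by Bézout, every `b` prime to `N` already has a polynomial
inverse. So the residue ring is generated over `F` by the classes of `Y` and `ρ`, which are
integral. -/
theorem finite_resRing [Algebra F L] [IsScalarTower F F[X] L] (hz : IsSeparable F z) (hr : r ≠ 0)
    (hρ : ρ ^ r = algebraMap (RatFunc F) L n) (hden : aeval z n.denom ≠ 0) :
    Module.Finite F (ResRing F z ρ) := by
  set y := algebraMap F[X] (ResRing F z ρ) Polynomial.X
  set g := resMk z ρ (localGen F z ρ)
  set A := Algebra.adjoin F {y, g}
  have hinv : ∀ b : F[X], aeval z b ≠ 0 → ∃ a : F[X],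
      algebraMap F[X] (ResRing F z ρ) a * algebraMap F[X] (ResRing F z ρ) b = 1 := by
    intro b hb
    have hcop : IsCoprime b (minpoly F z) := by
      refine (((minpoly.irreducible hz.isIntegral).coprime_iff_not_dvd).2 ?_).symm
      rintro ⟨q, rfl⟩
      exact hb (by simp)
    obtain ⟨a, c, h⟩ := hcop
    refine ⟨a, ?_⟩
    have := congrArg (algebraMap F[X] (ResRing F z ρ)) h
    rwa [map_add, map_mul, map_mul, algebraMap_resRing_minpoly, mul_zero, add_zero, map_one] at this
  have hpA : ∀ p : F[X], algebraMap F[X] (ResRing F z ρ) p ∈ A := by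
    intro p
    rw [← aeval_resRing_X]
    exact Algebra.adjoin_mono (by simp) (aeval_mem_adjoin_singleton F y (p := p))
  have hy : IsIntegral F y := ⟨minpoly F z, minpoly.monic hz.isIntegral, by
    rw [← aeval_def, aeval_resRing_X, algebraMap_resRing_minpoly]⟩
  have hpI : ∀ p : F[X], IsIntegral F (algebraMap F[X] (ResRing F z ρ) p) := by
    intro p
    rw [← aeval_resRing_X]
    exact adjoin_le_integralClosure hy (aeval_mem_adjoin_singleton F y (p := p))
  have hg : IsIntegral F g := by
    refine IsIntegral.of_pow (Nat.pos_of_ne_zero hr) ?_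
    obtain ⟨a, ha⟩ := hinv _ hden
    have h1 := congrArg (resMk z ρ) (denom_mul_localGen_pow (z := z) hρ)
    rw [map_mul, map_pow, AlgHom.commutes, AlgHom.commutes] at h1
    have h2 : g ^ r = algebraMap F[X] (ResRing F z ρ) (a * n.num) := by
      rw [map_mul, ← h1, ← mul_assoc, ha, one_mul]
    rw [h2]
    exact hpI _
  have htop : A = ⊤ := by
    rw [eq_top_iff]
    rintro e -
    obtain ⟨⟨x, hx⟩, rfl⟩ := Ideal.Quotient.mk_surjective e
    obtain ⟨b, hb, hbx⟩ := id hx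
    have h1 : ∃ h : algebraMap F[X] L b * x ∈ localRing F z ρ,
        resMk z ρ ⟨algebraMap F[X] L b * x, h⟩ ∈ A := by
      refine Algebra.adjoin_induction (p := fun y _ => ∃ h : y ∈ localRing F z ρ,
        resMk z ρ ⟨y, h⟩ ∈ A) ?_ ?_ ?_ ?_ hbx
      · rintro y rfl
        exact ⟨self_mem_localRing z _, Algebra.subset_adjoin (by simp [g, localGen])⟩
      · intro p
        refine ⟨Subalgebra.algebraMap_mem _ p, ?_⟩
        have : resMk z ρ (algebraMap F[X] (localRing F z ρ) p) ∈ A := by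
          rw [AlgHom.commutes]; exact hpA p
        exact this
      · rintro x y _ _ ⟨hx, hx'⟩ ⟨hy, hy'⟩
        refine ⟨add_mem hx hy, ?_⟩
        have := add_mem hx' hy'
        rwa [← map_add] at this
      · rintro x y _ _ ⟨hx, hx'⟩ ⟨hy, hy'⟩
        refine ⟨mul_mem hx hy, ?_⟩
        have := mul_mem hx' hy'
        rwa [← map_mul] at this
    obtain ⟨h, h1⟩ := h1
    obtain ⟨a, ha⟩ := hinv b hb
    have h2 : resMk z ρ ⟨algebraMap F[X] L b * x, h⟩ =
        algebraMap F[X] (ResRing F z ρ) b * resMk z ρ ⟨x, hx⟩ := by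
      rw [← (resMk z ρ).commutes, ← map_mul]; rfl
    rw [h2] at h1
    have h3 := mul_mem (hpA a) h1
    rw [← mul_assoc, ha, one_mul] at h3
    exact h3
  refine ⟨?_⟩
  rw [← Algebra.top_toSubmodule, ← htop]
  refine fg_adjoin_of_finite (Set.toFinite _) ?_
  rintro x (rfl | rfl)
  · exact hy
  · exact hg

theorem finite_maximalSpectrum_resRing [Algebra F L] [IsScalarTower F F[X] L]
    (hz : IsSeparable F z) (hr : r ≠ 0)
    (hρ : ρ ^ r = algebraMap (RatFunc F) L n) (hden : aeval z n.denom ≠ 0) :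
    Finite (MaximalSpectrum (ResRing F z ρ)) := by
  have := finite_resRing hz hr hρ hden
  have : IsArtinianRing (ResRing F z ρ) := IsArtinianRing.of_finite F _
  infer_instance

end LocalRing

end

end SkewRes

namespace SkewRes

noncomputable section

section BaseMap

variable {F K : Type*} [Field F] [Field K] [Algebra F K] {A B D : Type*} [CommRing A] [Algebra F A]
  [CommRing B] [Algebra F B] [CommRing D] [Algebra F D]

theorem baseMap_baseMap (g : A →ₐ[F] B) (h : B →ₐ[F] D) (x : A ⊗[F] K) :
    baseMap K h (baseMap K g x) = baseMap K (h.comp g) x := by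
  induction x using TensorProduct.induction_on with
  | zero => simp
  | add x y hx hy => simp only [map_add, hx, hy]
  | tmul b a => rfl

variable (K) in
theorem isUnit_tmul_one {a : A} (h : IsUnit a) : IsUnit (a ⊗ₜ[F] (1 : K)) :=
  h.map (Algebra.TensorProduct.includeLeft : A →ₐ[F] A ⊗[F] K)

theorem tmul_one_mul_tmul_one (a b : A) :
    (a ⊗ₜ[F] (1 : K)) * (b ⊗ₜ[F] (1 : K)) = (a * b) ⊗ₜ[F] (1 : K) := by
  rw [Algebra.TensorProduct.tmul_mul_tmul, one_mul]

end BaseMap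

/-! ### An invertible multiple of `U` over `F[Y]_{(N)}[ρ]` -/

section Local

variable {F K Fs L : Type*} [Field F] [Field K] [Algebra F K] [Field Fs] [Algebra F Fs]
  [Field L] [Algebra F L] [Algebra F[X] L] [IsScalarTower F F[X] L] {z : Fs} {ρ : L}

theorem localIncl_tmul (x : localRing F z ρ) (a : K) : localIncl K z ρ (x ⊗ₜ a) = (x : L) ⊗ₜ a :=
  rfl

theorem localRed_tmul (x : localRing F z ρ) (a : K) :
    localRed K z ρ (x ⊗ₜ a) = resMk z ρ x ⊗ₜ a := rfl

theorem localIncl_injective : Function.Injective (localIncl (F := F) K z ρ) :=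
  baseMap_injective _ Subtype.val_injective

theorem localIncl_galAct (θ : K ≃ₐ[F] K) (x : localRing F z ρ ⊗[F] K) :
    localIncl K z ρ (galAct _ θ x) = galAct L θ (localIncl K z ρ x) :=
  (galAct_baseMap θ _ x).symm

theorem localRed_galAct (θ : K ≃ₐ[F] K) (x : localRing F z ρ ⊗[F] K) :
    localRed K z ρ (galAct _ θ x) = galAct _ θ (localRed K z ρ x) :=
  (galAct_baseMap θ _ x).symm

theorem localIncl_baseMap (x : F[X] ⊗[F] K) :
    localIncl K z ρ (baseMap K (IsScalarTower.toAlgHom F F[X] (localRing F z ρ)) x) =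
      baseMap K (IsScalarTower.toAlgHom F F[X] L) x := by
  rw [localIncl, baseMap_baseMap]
  congr 1

theorem localRed_baseMap (x : F[X] ⊗[F] K) :
    localRed K z ρ (baseMap K (IsScalarTower.toAlgHom F F[X] (localRing F z ρ)) x) =
      baseMap K (IsScalarTower.toAlgHom F F[X] (ResRing F z ρ)) x := by
  rw [localRed, baseMap_baseMap]
  congr 1

variable [Algebra (RatFunc F) L] [IsScalarTower F (RatFunc F) L] [IsScalarTower F[X] (RatFunc F) L]

/-- An element of `F(Y) ⊗_F K` that can be reduced at `z` comes from `F[Y]_{(N)}[ρ] ⊗_F K`,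
compatibly with the reduction. -/
theorem IsReduction.exists_local {C : RatFunc F ⊗[F] K} {c : ResField F z ⊗[F] K}
    (h : IsReduction z C c) (ρ : L) : ∃ D : localRing F z ρ ⊗[F] K,
      localIncl K z ρ D = baseMap K (IsScalarTower.toAlgHom F (RatFunc F) L) C ∧
      localRed K z ρ D = baseMap K ((resMap z ρ).restrictScalars F) c := by
  obtain ⟨b, a, hb, h1, h2⟩ := h
  have hu := isUnit_localRing ρ hb
  obtain ⟨e, he⟩ := hu.exists_left_inv
  -- The fraction `a / b` makes sense over the local ring, where `b` is invertible. Both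
  -- compatibilities are checked after multiplication by `b`.
  set D := (e ⊗ₜ 1) * baseMap K (IsScalarTower.toAlgHom F F[X] (localRing F z ρ)) a with hD
  have hbD : (algebraMap F[X] (localRing F z ρ) b ⊗ₜ 1) * D =
      baseMap K (IsScalarTower.toAlgHom F F[X] (localRing F z ρ)) a := by
    rw [hD, ← mul_assoc, tmul_one_mul_tmul_one, mul_comm, mul_comm _ e, he,
      ← Algebra.TensorProduct.one_def, mul_one]
  refine ⟨D, ?_, ?_⟩
  · refine (isUnit_tmul_one (F := F) K (hu.map (localRing F z ρ).val)).mul_left_cancel ?_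
    have h3 := congrArg (localIncl K z ρ) hbD
    have h4 := congrArg (baseMap K (IsScalarTower.toAlgHom F (RatFunc F) L)) h1
    rw [map_mul, localIncl_baseMap, localIncl_tmul] at h3
    rw [map_mul, baseMap_baseMap, baseMap_tmul] at h4
    refine h3.trans (Eq.trans ?_ (h4.symm.trans ?_))
    · refine congrArg (fun g => baseMap K g a) (AlgHom.ext fun p => ?_)
      exact IsScalarTower.algebraMap_apply F[X] (RatFunc F) L p
    · congr 2
      exact (IsScalarTower.algebraMap_apply F[X] (RatFunc F) L b).symm
  · refine (isUnit_tmul_one (F := F) K (hu.map (resMk z ρ))).mul_left_cancel ?_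
    have h3 := congrArg (localRed K z ρ) hbD
    have h4 := congrArg (baseMap K ((resMap z ρ).restrictScalars F)) h2
    rw [map_mul, localRed_baseMap, localRed_tmul] at h3
    rw [map_mul, baseMap_baseMap, baseMap_tmul] at h4
    refine h3.trans (Eq.trans ?_ (h4.symm.trans ?_))
    · congr 1
    · rfl

variable [IsSepClosure F Fs] {θ : K ≃ₐ[F] K} {C : RatFunc F ⊗[F] K} {n : RatFunc F}

/-- Hilbert's Theorem 90 for the norm one element `ρ⁻¹ C` of `F[Y]_{(N)}[ρ] ⊗_F K`. -/
theorem exists_unit_localRing (hfix : ∀ a : K, θ a = a → a ∈ Set.range (algebraMap F K))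
    (hr : (orderOf θ : F) ≠ 0) (hn : galNorm θ C = n ⊗ₜ 1)
    (hρ : ρ ^ orderOf θ = algebraMap (RatFunc F) L n)
    (hz : z ≠ 0) (hreg : IsGammaRegular z C n) :
    ∃ V : (localRing F z ρ ⊗[F] K)ˣ, galAct L θ (localIncl K z ρ V) =
      (ρ⁻¹ ⊗ₜ 1) * baseMap K (IsScalarTower.toAlgHom F (RatFunc F) L) C * localIncl K z ρ V := by
  have hr0 := orderOf_ne_zero_of_cast θ hr
  have hsep := isSeparable_of_isSepClosure (F := F) z
  have hden := hreg.denom_norm_ne_zero hz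
  obtain ⟨c, hc⟩ := hreg.exists_reduction
  obtain ⟨D, hD, -⟩ := hc.exists_local ρ
  obtain ⟨g, hg⟩ := isUnit_localGen hr0 hρ hreg.num_norm_ne_zero
  have hρ0 : ρ ≠ 0 := by
    have := g.isUnit.map (localRing F z ρ).val
    rw [hg] at this
    exact this.ne_zero
  have hginv : (((g⁻¹ : (localRing F z ρ)ˣ) : localRing F z ρ) : L) = ρ⁻¹ := by
    refine eq_inv_of_mul_eq_one_left ?_
    have := congrArg (localRing F z ρ).val g.inv_mul
    rwa [hg, map_mul, map_one] at this
  obtain ⟨d, hdL⟩ : ∃ d, localIncl K z ρ d =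
      (ρ⁻¹ ⊗ₜ 1) * baseMap K (IsScalarTower.toAlgHom F (RatFunc F) L) C :=
    ⟨((g⁻¹ : (localRing F z ρ)ˣ) : localRing F z ρ) ⊗ₜ (1 : K) * D, by
      rw [map_mul, hD, localIncl_tmul, hginv]⟩
  -- The norm is `ρ^{-r} n = 1`; the computation takes place in `L ⊗ K`, into which `F[Y]_{(N)}[ρ] ⊗
  -- K` embeds by flatness.
  have hdn : galNorm θ d = 1 := by
    apply localIncl_injective
    have h1 : localIncl K z ρ (galNorm θ d) = galNorm θ (localIncl K z ρ d) :=
      baseMap_galNorm _ _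
    rw [h1, hdL, galNorm_mul, galNorm_tmul_one, ← baseMap_galNorm, hn, baseMap_tmul,
      tmul_one_mul_tmul_one, map_one, inv_pow, hρ, Algebra.TensorProduct.one_def]
    refine congrArg (fun x : L => x ⊗ₜ[F] (1 : K)) (inv_mul_cancel₀ ?_)
    rw [← hρ]
    exact pow_ne_zero _ hρ0
  have := finite_maximalSpectrum_resRing hsep hr0 hρ hden
  obtain ⟨f, hf, hfu⟩ : ∃ f : localRing F z ρ →+* ResRing F z ρ, Function.Surjective f ∧
      ∀ x, IsUnit (f x) → IsUnit x :=
    ⟨(resMk z ρ).toRingHom, Ideal.Quotient.mk_surjective,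
      fun x hx => isUnit_of_isUnit_resMk hr0 hρ hden hx⟩
  obtain ⟨V, hV⟩ := exists_unit_galAct_eq_mul hfix hr hf hfu hdn
  refine ⟨V, ?_⟩
  rw [← localIncl_galAct, hV, map_mul, hdL]

/-- Two solutions of `θ(U) = d U` differ by a scalar. -/
theorem exists_eq_tmul_mul {B : Type*} [Field B] [Algebra F B]
    (hfix : ∀ a : K, θ a = a → a ∈ Set.range (algebraMap F K))
    (hr : (orderOf θ : F) ≠ 0) {d V : B ⊗[F] K} {U : (B ⊗[F] K)ˣ} (hVu : IsUnit V)
    (hU : galAct B θ U = d * (U : B ⊗[F] K)) (hV : galAct B θ V = d * V) :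
    ∃ l : Bˣ, V = ((l : B) ⊗ₜ 1) * (U : B ⊗[F] K) := by
  -- The quotient of two solutions is invariant under `id ⊗ θ`, hence a scalar.
  set q : B ⊗[F] K := V * ((U⁻¹ : (B ⊗[F] K)ˣ) : B ⊗[F] K) with hq
  have hqU : q * U = V := by rw [hq, mul_assoc, Units.inv_mul, mul_one]
  have hqfix : galAct B θ q = q := by
    refine (U.isUnit.map (galAct B θ)).mul_right_cancel ?_
    rw [← map_mul, hqU, hV, hU, ← hqU]
    ring
  have hq1 := eq_baseAverage_tmul_one hfix hr hqfix
  have hqu : IsUnit q := hVu.mul (Units.isUnit _)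
  have hl : baseAverage θ B hfix q ≠ 0 := by
    intro h0
    rw [h0, TensorProduct.zero_tmul] at hq1
    rw [hq1, isUnit_zero_iff] at hqu
    have := baseAverage_one hfix hr (B := B)
    rw [← hqu, map_zero] at this
    exact zero_ne_one this
  refine ⟨Units.mk0 _ hl, ?_⟩
  rw [← hqU, Units.val_mk0, ← hq1]

end Local

end

end SkewRes

namespace SkewRes

noncomputable section

/-! ### Change of variable in residues of Laurent series -/

section Residue

variable {E : Type*} [CommRing E]

theorem map_powerSeries_derivative {A B : Type*} [CommRing A] [CommRing B] (f : A →+* B)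
    (p : PowerSeries A) : PowerSeries.map f (PowerSeries.derivative A p) =
      PowerSeries.derivative B (PowerSeries.map f p) := by
  ext n
  simp [PowerSeries.coeff_derivative]

/-- An identity which follows from `(x ^ (m + 1))' = (m + 1) x ^ m x'` over torsion-free rings, and
hence holds over all rings. -/
theorem coeff_pow_eq_coeff_pow_mul_derivative (x : PowerSeries E) (m : ℕ) :
    PowerSeries.coeff (m + 1) (x ^ (m + 1)) =
      PowerSeries.coeff m (x ^ m * PowerSeries.derivative E x) := by
  -- The generic series, with indeterminate coefficients over `ℤ`: there the factor `m + 1` can be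
  -- cancelled, and specialising the indeterminates gives the identity over `E`, whatever its
  -- characteristic.
  let y : PowerSeries (MvPolynomial ℕ ℤ) := PowerSeries.mk fun i => MvPolynomial.X i
  have hy : PowerSeries.coeff (m + 1) (y ^ (m + 1)) =
      PowerSeries.coeff m (y ^ m * PowerSeries.derivative _ y) := by
    have h1 := congrArg (PowerSeries.coeff m) (PowerSeries.derivative_pow y (m + 1))
    rw [PowerSeries.coeff_derivative, mul_assoc, ← map_natCast (PowerSeries.C (R := MvPolynomial ℕ ℤ)),
      PowerSeries.coeff_C_mul, mul_comm] at h1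
    push_cast at h1
    have h2 : ((m : MvPolynomial ℕ ℤ) + 1) ≠ 0 := by exact_mod_cast Nat.succ_ne_zero m
    exact mul_left_cancel₀ h2 h1
  let f : MvPolynomial ℕ ℤ →+* E := MvPolynomial.eval₂Hom (Int.castRingHom E)
    (fun i => PowerSeries.coeff i x)
  have hf : PowerSeries.map f y = x := by
    ext n
    simp [y, f]
  have h := congrArg f hy
  rwa [← PowerSeries.coeff_map, ← PowerSeries.coeff_map, map_mul (PowerSeries.map f), map_pow (PowerSeries.map f),
    map_pow (PowerSeries.map f), map_powerSeries_derivative, hf] at h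

theorem coeff_single_neg_mul_ofPowerSeries (m : ℕ) (p : PowerSeries E) :
    ((HahnSeries.single (-1 : ℤ) (1 : E)) ^ (m + 1) * HahnSeries.ofPowerSeries ℤ E p).coeff (-1) =
      PowerSeries.coeff m p := by
  rw [HahnSeries.single_pow, one_pow]
  have h := HahnSeries.coeff_single_mul_add (r := (1 : E)) (x := HahnSeries.ofPowerSeries ℤ E p)
    (a := (m : ℤ)) (b := (m + 1) • (-1 : ℤ))
  have h2 : (m : ℤ) + (m + 1) • (-1 : ℤ) = -1 := by
    rw [nsmul_eq_mul]; push_cast; ring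
  rw [h2, one_mul] at h
  exact h.trans (HahnSeries.ofPowerSeries_apply_coeff p m)

theorem single_neg_mul_ofPowerSeries_X : HahnSeries.single (-1 : ℤ) (1 : E) *
    HahnSeries.ofPowerSeries ℤ E PowerSeries.X = 1 := by
  rw [HahnSeries.ofPowerSeries_X, HahnSeries.single_mul_single]
  simp

/-- The residue of `S⁻ᵐ⁻¹ dS`, where `S = v T` and `x = v⁻¹`. -/
theorem coeff_residue_pow {x v : PowerSeries E} (h : x * v = 1) (m : ℕ) :
    PowerSeries.coeff m (x ^ (m + 1) * PowerSeries.derivative E (PowerSeries.X * v)) =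
      if m = 0 then 1 else 0 := by
  have hd : PowerSeries.derivative E (PowerSeries.X * v) =
      v + PowerSeries.X * PowerSeries.derivative E v := by
    rw [Derivation.leibniz, PowerSeries.derivative_X, smul_eq_mul, smul_eq_mul]; ring
  have hx : PowerSeries.derivative E x * v + x * PowerSeries.derivative E v = 0 := by
    have := congrArg (PowerSeries.derivative E) h
    rw [Derivation.leibniz, PowerSeries.derivative_one, smul_eq_mul, smul_eq_mul] at this
    rw [← this]; ring
  cases m with
  | zero =>
    rw [hd, if_pos rfl, zero_add, pow_one, mul_add, h, map_add, mul_left_comm,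
      PowerSeries.coeff_zero_X_mul, add_zero, PowerSeries.coeff_zero_one]
  | succ m =>
    -- Since `x v = 1` gives `x' v + x v' = 0`, the factor `v'` is eliminated; the two remaining
    -- terms have the same coefficient by `coeff_pow_eq_coeff_pow_mul_derivative`.
    have h1 : x ^ (m + 1 + 1) * PowerSeries.derivative E (PowerSeries.X * v) =
        x ^ (m + 1) - PowerSeries.X * (x ^ m * PowerSeries.derivative E x) := by
      rw [hd]
      linear_combination (x ^ (m + 1) - PowerSeries.X * x ^ m * PowerSeries.derivative E x) * h +
        PowerSeries.X * x ^ (m + 1) * hx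
    rw [h1, map_sub, PowerSeries.coeff_succ_X_mul, coeff_pow_eq_coeff_pow_mul_derivative, sub_self,
      if_neg (Nat.succ_ne_zero m)]

theorem eq_C_add_X_mul (p : PowerSeries E) : ∃ q, p =
    PowerSeries.C (PowerSeries.constantCoeff p) + PowerSeries.X * q := by
  obtain ⟨q, hq⟩ := (PowerSeries.X_dvd_iff (φ := p - PowerSeries.C (PowerSeries.constantCoeff p))).2
    (by simp)
  exact ⟨q, by rw [← hq]; ring⟩

/-- Substitution `T ↦ S` in Laurent series preserves residues of differential forms, for a series
`S` with zero constant coefficient and invertible linear coefficient. -/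
theorem exists_laurent_subst {S : PowerSeries E} (h0 : PowerSeries.constantCoeff S = 0)
    (h1 : IsUnit (PowerSeries.coeff 1 S)) :
    ∃ (σ : LaurentSeries E →+* LaurentSeries E) (σ₀ : PowerSeries E →ₐ[E] PowerSeries E),
      σ₀ PowerSeries.X = S ∧
      (∀ p, σ (HahnSeries.ofPowerSeries ℤ E p) = HahnSeries.ofPowerSeries ℤ E (σ₀ p)) ∧
      (∀ p, PowerSeries.constantCoeff (σ₀ p) = PowerSeries.constantCoeff p) ∧
      ∀ H, (σ H * HahnSeries.ofPowerSeries ℤ E (PowerSeries.derivative E S)).coeff (-1) =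
        H.coeff (-1) := by
  obtain ⟨v, rfl⟩ := PowerSeries.X_dvd_iff.2 h0
  have hv : IsUnit v := by
    rw [PowerSeries.isUnit_iff_constantCoeff]
    rwa [show (1 : ℕ) = 0 + 1 from rfl, PowerSeries.coeff_succ_X_mul,
      PowerSeries.coeff_zero_eq_constantCoeff_apply] at h1
  obtain ⟨x, hx⟩ := hv.exists_left_inv
  have hS : PowerSeries.HasSubst (PowerSeries.X * v : PowerSeries E) :=
    PowerSeries.HasSubst.of_constantCoeff_zero' h0
  let σ₀ : PowerSeries E →ₐ[E] PowerSeries E := PowerSeries.substAlgHom hS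
  have hσX : σ₀ PowerSeries.X = PowerSeries.X * v := PowerSeries.substAlgHom_X hS
  set t : LaurentSeries E := HahnSeries.single (-1 : ℤ) (1 : E) with ht
  set ι := HahnSeries.ofPowerSeries ℤ E with hι
  have htX : t * ι PowerSeries.X = 1 := single_neg_mul_ofPowerSeries_X
  have htS : t * ι x * ι (PowerSeries.X * v) = 1 := by
    rw [map_mul, mul_mul_mul_comm, htX, one_mul, ← map_mul, hx, map_one]
  -- Laurent series are power series with `T` inverted, and the image `T v` of `T` is invertible,
  -- with inverse `t x`.
  let σ : LaurentSeries E →+* LaurentSeries E :=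
    IsLocalization.lift (M := Submonoid.powers (PowerSeries.X : PowerSeries E))
      (g := ι.comp σ₀.toRingHom) (by
        rintro ⟨-, k, rfl⟩
        rw [map_pow]
        refine IsUnit.pow _ ?_
        show IsUnit (ι (σ₀ PowerSeries.X))
        rw [hσX]
        exact IsUnit.of_mul_eq_one_right _ htS)
  have hσ : ∀ p, σ (ι p) = ι (σ₀ p) := fun p => by
    have := IsLocalization.lift_eq (M := Submonoid.powers (PowerSeries.X : PowerSeries E))
      (S := LaurentSeries E) (g := ι.comp σ₀.toRingHom) (by
        rintro ⟨-, k, rfl⟩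
        rw [map_pow]
        refine IsUnit.pow _ ?_
        show IsUnit (ι (σ₀ PowerSeries.X))
        rw [hσX]
        exact IsUnit.of_mul_eq_one_right _ htS) p
    exact this
  have hσC : ∀ a, σ₀ (PowerSeries.C a) = PowerSeries.C a := fun a => σ₀.commutes a
  have hσt : σ t = t * ι x := by
    have h2 : σ t * ι (PowerSeries.X * v) = 1 := by
      rw [← hσX, ← hσ, ← map_mul, htX, map_one]
    calc σ t = σ t * (t * ι x * ι (PowerSeries.X * v)) := by rw [htS, mul_one]
      _ = (σ t * ι (PowerSeries.X * v)) * (t * ι x) := by ring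
      _ = t * ι x := by rw [h2, one_mul]
  refine ⟨σ, σ₀, hσX, hσ, fun p => ?_, fun H => ?_⟩
  · obtain ⟨q, hq⟩ := eq_C_add_X_mul p
    rw [hq, map_add, map_mul, hσX, hσC]
    simp
  · obtain ⟨⟨p, ⟨-, m, rfl⟩⟩, hp⟩ := IsLocalization.surj
      (M := Submonoid.powers (PowerSeries.X : PowerSeries E)) H
    have hp' : H * ι PowerSeries.X ^ m = ι p := by
      rw [← map_pow]; exact hp
    clear hp
    -- Here `m` bounds the order of the pole. Power series have residue `0`, before and after
    -- substitution.
    induction m generalizing H p with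
    | zero =>
      rw [pow_zero, mul_one] at hp'
      rw [hp', hσ, ← map_mul, coeff_ofPowerSeries_neg _ (by norm_num),
        coeff_ofPowerSeries_neg _ (by norm_num)]
    | succ m ih =>
      obtain ⟨q, hq⟩ := eq_C_add_X_mul p
      set a := PowerSeries.constantCoeff p
      have h2 := ih (t ^ m * ι q) q (by
        rw [mul_right_comm, ← mul_pow, htX, one_pow, one_mul])
      -- The leading polar term is split off; what remains has a pole of order at most `m`. The
      -- split term is handled by the residue of `S^{-m-1} dS`.
      have hH : H = ι (PowerSeries.C a) * t ^ (m + 1) + t ^ m * ι q := by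
        calc H = H * (t * ι PowerSeries.X) ^ (m + 1) := by rw [htX, one_pow, mul_one]
          _ = (H * ι PowerSeries.X ^ (m + 1)) * t ^ (m + 1) := by rw [mul_pow]; ring
          _ = ι (PowerSeries.C a) * t ^ (m + 1) + (t * ι PowerSeries.X) * (t ^ m * ι q) := by
              rw [hp', hq, map_add, map_mul]; ring
          _ = _ := by rw [htX, one_mul]
      have h3 : (ι (PowerSeries.C a) * t ^ (m + 1)).coeff (-1) =
          a * (if m = 0 then 1 else 0) := by
        rw [hι, HahnSeries.ofPowerSeries_C, HahnSeries.C_apply, HahnSeries.coeff_single_zero_mul]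
        congr 1
        have := coeff_single_neg_mul_ofPowerSeries (E := E) m 1
        rw [map_one (HahnSeries.ofPowerSeries ℤ E), mul_one, PowerSeries.coeff_one] at this
        exact this
      have h4 : (σ (ι (PowerSeries.C a) * t ^ (m + 1)) *
          ι (PowerSeries.derivative E (PowerSeries.X * v))).coeff (-1) =
          a * (if m = 0 then 1 else 0) := by
        have h5 : σ (ι (PowerSeries.C a) * t ^ (m + 1)) *
            ι (PowerSeries.derivative E (PowerSeries.X * v)) =
            HahnSeries.single 0 a * (t ^ (m + 1) *
              ι (x ^ (m + 1) * PowerSeries.derivative E (PowerSeries.X * v))) := by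
          rw [map_mul σ, map_pow, hσt, hσ, hσC, mul_pow, ← map_pow ι, hι,
            HahnSeries.ofPowerSeries_C, HahnSeries.C_apply, map_mul _ (x ^ (m + 1))]
          ring
        rw [h5, HahnSeries.coeff_single_zero_mul, coeff_single_neg_mul_ofPowerSeries,
          coeff_residue_pow hx]
      rw [hH, map_add, add_mul, HahnSeries.coeff_add, HahnSeries.coeff_add, h2, h3, h4]

end Residue

/-! ### Taylor expansion of rational functions and their derivatives -/

section Shift

variable {F E : Type*} [Field F] [CommRing E] [Algebra F[X] E]

theorem derivative_shift (p : F[X]) :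
    PowerSeries.derivative E (shift E p) = shift E (derivative p) := by
  induction p using Polynomial.induction_on with
  | C a => rw [shift_C, PowerSeries.derivative_C, derivative_C, map_zero]
  | add p q hp hq => rw [map_add, map_add, hp, hq, map_add, map_add]
  | monomial n a _ =>
    rw [map_mul, map_pow, shift_C, shift_X, Derivation.leibniz, PowerSeries.derivative_C,
      Derivation.leibniz_pow, map_add, PowerSeries.derivative_C, PowerSeries.derivative_X,
      derivative_C_mul_X_pow, map_mul, map_pow, shift_X, C_mul, map_mul, shift_C, C_eq_natCast, map_natCast]
    simp only [smul_eq_mul, nsmul_eq_mul, mul_zero, add_zero, zero_add, mul_one]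
    rw [Nat.add_sub_cancel]
    ring

/-- The expansion at a regular point of a rational function and of its derivative. -/
theorem exists_ratTaylor_eq {N : F[X]} (hN : algebraMap F[X] E N = 0) (hirr : Irreducible N)
    (hsep : N.Separable) (f : RatFunc F) (hQ : IsUnit (algebraMap F[X] E f.denom)) :
    ∃ s : PowerSeries E, ratTaylor hN hirr hsep f = HahnSeries.ofPowerSeries ℤ E s ∧
      algebraMap F[X] E f.denom * PowerSeries.constantCoeff s = algebraMap F[X] E f.num ∧
      algebraMap F[X] E f.denom ^ 2 * PowerSeries.coeff 1 s =
        algebraMap F[X] E (derivative f.num * f.denom - f.num * derivative f.denom) ∧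
      ratTaylor hN hirr hsep (ratDeriv f) =
        HahnSeries.ofPowerSeries ℤ E (PowerSeries.derivative E s) := by
  have hu : IsUnit (shift E f.denom) := by
    rw [PowerSeries.isUnit_iff_constantCoeff, constantCoeff_shift]; exact hQ
  obtain ⟨w, hw⟩ := hu.exists_left_inv
  have hden : algebraMap F[X] (RatFunc F) f.denom ≠ 0 := by
    rw [Ne, map_eq_zero_iff _ (IsFractionRing.injective F[X] (RatFunc F))]
    exact f.denom_ne_zero
  have h1 : algebraMap F[X] (RatFunc F) f.denom * f = algebraMap F[X] (RatFunc F) f.num := by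
    have h2 := RatFunc.num_div_denom f
    rw [div_eq_iff hden] at h2
    rw [h2, mul_comm]
  have hQs : shift E f.denom * (w * shift E f.num) = shift E f.num := by
    rw [← mul_assoc, mul_comm _ w, hw, one_mul]
  set s := w * shift E f.num
  -- The quotient rule, obtained by differentiating the product `f.denom * s = f.num` so that no
  -- division is needed.
  have hder : shift E f.denom ^ 2 * PowerSeries.derivative E s =
      shift E (derivative f.num * f.denom - f.num * derivative f.denom) := by
    have h3 := congrArg (PowerSeries.derivative E) hQs
    rw [Derivation.leibniz, derivative_shift, derivative_shift, smul_eq_mul, smul_eq_mul] at h3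
    rw [map_sub (shift E), map_mul (shift E), map_mul (shift E)]
    linear_combination shift E f.denom * h3 - shift E (derivative f.denom) * hQs
  refine ⟨s, ?_, ?_, ?_, ?_⟩
  · refine (hu.map (HahnSeries.ofPowerSeries ℤ E)).mul_left_cancel ?_
    rw [← map_mul, hQs, ← ratTaylor_algebraMap hN hirr hsep,
      ← ratTaylor_algebraMap hN hirr hsep f.num, ← map_mul, h1]
  · have := congrArg PowerSeries.constantCoeff hQs
    rwa [map_mul, constantCoeff_shift, constantCoeff_shift] at this
  · have := congrArg PowerSeries.constantCoeff hder
    rw [map_mul, map_pow, constantCoeff_shift, constantCoeff_shift,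
      ← PowerSeries.coeff_zero_eq_constantCoeff_apply, PowerSeries.coeff_derivative] at this
    simpa using this
  · refine ((hu.pow 2).map (HahnSeries.ofPowerSeries ℤ E)).mul_left_cancel ?_
    rw [← map_mul, hder, map_pow, ← ratTaylor_algebraMap hN hirr hsep,
      ← ratTaylor_algebraMap hN hirr hsep, ← map_pow, ← map_mul]
    congr 1
    unfold ratDeriv
    field_simp

end Shift

end

end SkewRes

namespace SkewRes

noncomputable section

/-! ### Uniqueness of morphisms and of `r`-th roots -/

section RingHom

variable {F : Type*} [Field F]

/-- Ring homomorphisms from `F(Y)` to a possibly noncommutative ring are determined by their values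
on `F` and on `Y`. -/
theorem ratFunc_ringHom_ext {R : Type*} [Ring R] {α β : RatFunc F →+* R}
    (hC : ∀ a, α (algebraMap F[X] (RatFunc F) (C a)) = β (algebraMap F[X] (RatFunc F) (C a)))
    (hX : α (algebraMap F[X] (RatFunc F) Polynomial.X) =
      β (algebraMap F[X] (RatFunc F) Polynomial.X)) : α = β := by
  have h : ∀ p, α (algebraMap F[X] (RatFunc F) p) = β (algebraMap F[X] (RatFunc F) p) := by
    have : α.comp (algebraMap F[X] (RatFunc F)) = β.comp (algebraMap F[X] (RatFunc F)) :=
      Polynomial.ringHom_ext hC hX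
    exact fun p => DFunLike.congr_fun this p
  refine RingHom.ext fun f => ?_
  obtain ⟨p, q, hq, rfl⟩ := IsFractionRing.div_surjective F[X] f
  have hq0 : algebraMap F[X] (RatFunc F) q ≠ 0 := by
    rw [Ne, map_eq_zero_iff _ (IsFractionRing.injective F[X] (RatFunc F))]
    exact nonZeroDivisors.ne_zero hq
  refine ((Units.mk0 _ hq0).isUnit.map β).mul_right_cancel ?_
  have h1 := congrArg α (div_mul_cancel₀ (algebraMap F[X] (RatFunc F) p) hq0)
  rw [map_mul, h q, h p] at h1
  rw [Units.val_mk0, h1, ← map_mul, div_mul_cancel₀ _ hq0]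

/-- In `a^r - b^r = (∑ a^i b^{r-1-i})(a - b)` the sum has constant coefficient `r`, hence is a unit.
Pushing this factorisation through `g` requires neither injectivity of `g` nor commutativity of its
target. The unit `u` is there because the powers are compared after multiplication by the value of
`Y`. -/
theorem eq_of_map_pow_mul_eq {E R : Type*} [CommRing E] [Ring R] (g : PowerSeries E →+* R) {r : ℕ}
    (hr : IsUnit (r : E)) {a b u : PowerSeries E} (ha : PowerSeries.constantCoeff a = 1)
    (hb : PowerSeries.constantCoeff b = 1) (hu : IsUnit u) (h : g (a ^ r * u) = g (b ^ r * u)) :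
    g a = g b := by
  have h1 : IsUnit (∑ i ∈ Finset.range r, a ^ i * b ^ (r - 1 - i)) := by
    rw [PowerSeries.isUnit_iff_constantCoeff, map_sum]
    simpa [ha, hb] using hr
  have h2 : g ((∑ i ∈ Finset.range r, a ^ i * b ^ (r - 1 - i)) * u) * g (a - b) = 0 := by
    rw [← map_mul, mul_right_comm, geom_sum₂_mul, sub_mul, map_sub, h, sub_self]
  rw [((h1.mul hu).map g).mul_right_eq_zero, map_sub, sub_eq_zero] at h2
  exact h2

end RingHom

/-! ### Rigidity of canonical Taylor morphisms and comparison of residues -/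

section Taylor

variable {F K : Type*} [Field F] [Field K] [Algebra F K] {θ : K ≃ₐ[F] K} {E : Type*} [CommRing E]
  [Algebra F[X] E]

theorem laurentMap_inl_commute (e : LaurentSeries E) (a : BC E θ) :
    Commute (laurentMap (BC.inl E θ) e) (HahnSeries.C a) :=
  laurentMap_commute_C _ _ _ fun b => BC.inl_commute b a

theorem laurentMap_mul_C_pow (e : LaurentSeries E) (a : BC E θ) (i : ℕ) :
    (laurentMap (BC.inl E θ) e * HahnSeries.C a) ^ i =
      laurentMap (BC.inl E θ) (e ^ i) * HahnSeries.C (a ^ i) := by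
  rw [(laurentMap_inl_commute e a).mul_pow, map_pow, map_pow]

theorem coeff_laurentMap_mul_C (e : LaurentSeries E) (a : BC E θ) (i : ℤ) :
    (laurentMap (BC.inl E θ) e * HahnSeries.C a).coeff i = BC.inl E θ (e.coeff i) * a := by
  rw [HahnSeries.C_apply, HahnSeries.coeff_mul_single_zero]; rfl

theorem isUnit_orderOf (E : Type*) [CommRing E] [Algebra F[X] E] (hr : (orderOf θ : F) ≠ 0) :
    IsUnit ((orderOf θ : ℕ) : E) := by
  have := (IsUnit.mk0 _ hr).map ((algebraMap F[X] E).comp Polynomial.C)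
  rwa [map_natCast] at this

theorem exists_canonical_root (hr : (orderOf θ : F) ≠ 0)
    (hy : IsUnit (algebraMap F[X] E Polynomial.X)) : ∃ c : PowerSeries E,
      PowerSeries.constantCoeff c = 1 ∧
      c ^ orderOf θ * PowerSeries.C (algebraMap F[X] E Polynomial.X) =
        PowerSeries.C (algebraMap F[X] E Polynomial.X) + PowerSeries.X := by
  obtain ⟨y, hy⟩ := hy
  obtain ⟨c, hc, hcr⟩ := exists_root (orderOf θ) (isUnit_orderOf E hr)
    (1 + PowerSeries.C ((y⁻¹ : Eˣ) : E) * PowerSeries.X) (by simp)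
  refine ⟨c, hc, ?_⟩
  rw [hcr, ← hy, add_mul, one_mul, mul_right_comm, ← map_mul, Units.inv_mul, map_one, one_mul]

namespace IsCanonicalTaylor

variable {L : Type*} [CommRing L] [Algebra F[X] L] {τ : BC L θ →+* LaurentSeries (BC E θ)}

theorem map_C (h : IsCanonicalTaylor L E θ τ) (a : F) :
    τ (BC.inl L θ (algebraMap F[X] L (C a))) =
      HahnSeries.C (BC.inl E θ (algebraMap F[X] E (C a))) := by
  rw [BC.inl_C, BC.inl_C, h.map_const]

theorem map_inl_algebraMap (h : IsCanonicalTaylor L E θ τ) (p : F[X]) :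
    τ (BC.inl L θ (algebraMap F[X] L p)) =
      laurentMap (BC.inl E θ) (HahnSeries.ofPowerSeries ℤ E (shift E p)) := by
  have : (τ.comp (BC.inl L θ)).comp (algebraMap F[X] L) =
      ((laurentMap (BC.inl E θ)).comp (HahnSeries.ofPowerSeries ℤ E)).comp (shift E) := by
    refine Polynomial.ringHom_ext (fun a => ?_) ?_
    · simp only [RingHom.comp_apply]
      rw [h.map_C, shift_C, HahnSeries.ofPowerSeries_C, laurentMap_C]
    · simp only [RingHom.comp_apply]
      rw [h.map_Y, shift_X, map_add, map_add, HahnSeries.ofPowerSeries_C, laurentMap_C,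
        laurentMap_ofPowerSeries, PowerSeries.map_X, HahnSeries.ofPowerSeries_X]
  exact DFunLike.congr_fun this p

/-- A canonical Taylor morphism extends the expansion of rational functions. -/
theorem map_inl_ratFunc {N : F[X]} (hN : algebraMap F[X] E N = 0) (hirr : Irreducible N)
    (hsep : N.Separable) [Algebra (RatFunc F) L] [IsScalarTower F[X] (RatFunc F) L]
    (h : IsCanonicalTaylor L E θ τ) (f : RatFunc F) :
    τ (BC.inl L θ (algebraMap (RatFunc F) L f)) =
      laurentMap (BC.inl E θ) (ratTaylor hN hirr hsep f) := by
  have h1 : ∀ p : F[X], τ (BC.inl L θ (algebraMap (RatFunc F) L (algebraMap F[X] (RatFunc F) p))) =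
      laurentMap (BC.inl E θ) (ratTaylor hN hirr hsep (algebraMap F[X] (RatFunc F) p)) := by
    intro p
    rw [← IsScalarTower.algebraMap_apply, h.map_inl_algebraMap, ratTaylor_algebraMap]
  have : (τ.comp (BC.inl L θ)).comp (algebraMap (RatFunc F) L) =
      (laurentMap (BC.inl E θ)).comp (ratTaylor hN hirr hsep) :=
    ratFunc_ringHom_ext (fun a => h1 _) (h1 _)
  exact DFunLike.congr_fun this f

/-- A canonical Taylor morphism maps `X` to `c X`, where `c` is the canonical `r`-th root of
`(Y + T) / Y`. -/
theorem map_X_eq (h : IsCanonicalTaylor L E θ τ) (hr : (orderOf θ : F) ≠ 0)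
    (hy : IsUnit (algebraMap F[X] E Polynomial.X)) {c : PowerSeries E}
    (hc : PowerSeries.constantCoeff c = 1)
    (hcr : c ^ orderOf θ * PowerSeries.C (algebraMap F[X] E Polynomial.X) =
        PowerSeries.C (algebraMap F[X] E Polynomial.X) + PowerSeries.X) :
    τ (BC.X L θ) = laurentMap (BC.inl E θ) (HahnSeries.ofPowerSeries ℤ E c) *
      HahnSeries.C (BC.X E θ : BC E θ) := by
  obtain ⟨d, hd, hX⟩ := h.map_X
  rw [← laurentMap_ofPowerSeries] at hX
  have h1 : ((laurentMap (BC.inl E θ)).comp (HahnSeries.ofPowerSeries ℤ E)) d =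
      ((laurentMap (BC.inl E θ)).comp (HahnSeries.ofPowerSeries ℤ E)) c := by
    refine eq_of_map_pow_mul_eq _ (isUnit_orderOf E hr) hd hc (hy.map PowerSeries.C) ?_
    -- Applying `τ` to `Y = X ^ r` shows that `d ^ r Y` and `Y + T` have the same image.
    have h2 := congrArg τ (BC.inl_Y (B := L) (θ := θ))
    rw [h.map_inl_algebraMap, map_pow, hX, laurentMap_mul_C_pow, ← BC.inl_Y, ← laurentMap_C,
      ← HahnSeries.ofPowerSeries_C, ← map_mul, ← map_pow, ← map_mul, shift_X] at h2
    rw [hcr]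
    exact h2.symm
  rw [hX]
  exact congrArg (· * _) h1

end IsCanonicalTaylor

/-- Comparison of residues of a morphism `τ` and of a morphism `Φ` that is obtained from it by a
morphism `g` of coefficient rings and a change of variables `σ`. -/
theorem map_coeff_eq_coeff_mul {E' : Type*} [CommRing E'] [Algebra F[X] E'] (hr : orderOf θ ≠ 0)
    {τ : SkewFrac θ →+* LaurentSeries (BC E θ)} {Φ : SkewFrac θ →+* LaurentSeries (BC E' θ)}
    {g : BC E θ →+* BC E' θ} {κ : E →+* E'} (hg : ∀ e, g (BC.inl E θ e) = BC.inl E' θ (κ e))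
    {T : RatFunc F → LaurentSeries E} {c : LaurentSeries E}
    {σ : LaurentSeries E' →+* LaurentSeries E'} {s : LaurentSeries E'}
    (hσ : ∀ H, (σ H * s).coeff (-1) = H.coeff (-1))
    (hτinl : ∀ h, τ (BC.inl (RatFunc F) θ h) = laurentMap (BC.inl E θ) (T h))
    (hτconst : ∀ a, τ (BC.const (RatFunc F) θ a) = HahnSeries.C (BC.const E θ a))
    (hτX : τ (BC.X (RatFunc F) θ) = laurentMap (BC.inl E θ) c * HahnSeries.C (BC.X E θ : BC E θ))
    (hΦinl : ∀ h, Φ (BC.inl (RatFunc F) θ h) =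
      laurentMap (BC.inl E' θ) (σ (laurentMap κ (T h))))
    (hΦconst : ∀ a, Φ (BC.const (RatFunc F) θ a) = HahnSeries.C (g (BC.const E θ a)))
    (hΦX : Φ (BC.X (RatFunc F) θ) = laurentMap (BC.inl E' θ) (σ (laurentMap κ c)) *
      HahnSeries.C (g (BC.X E θ : BC E θ))) (f : SkewFrac θ) :
    g ((τ f).coeff (-1)) = (Φ f * laurentMap (BC.inl E' θ) s).coeff (-1) := by
  -- Both sides are additive in `f`. On a term `h a X^i` the series with central coefficients can be
  -- collected on the left, leaving a constant factor on the right, and the claim becomes the scalar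
  -- residue formula `hσ`.
  refine SkewFrac.additive_induction hr (P := fun f =>
    g ((τ f).coeff (-1)) = (Φ f * laurentMap (BC.inl E' θ) s).coeff (-1)) ?_ ?_ ?_ f
  · rw [map_zero, map_zero, zero_mul, HahnSeries.coeff_zero, HahnSeries.coeff_zero, map_zero]
  · intro f f' hf hf'
    rw [map_add, map_add, add_mul, HahnSeries.coeff_add, HahnSeries.coeff_add, map_add, hf, hf']
  · intro h a i _
    have h1 : τ (BC.inl (RatFunc F) θ h * BC.const (RatFunc F) θ a *
        (BC.X (RatFunc F) θ : SkewFrac θ) ^ i) =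
        laurentMap (BC.inl E θ) (T h * c ^ i) *
          HahnSeries.C (BC.const E θ a * (BC.X E θ : BC E θ) ^ i) := by
      rw [map_mul, map_mul, map_pow, hτinl, hτconst, hτX, laurentMap_mul_C_pow, map_mul, map_mul,
        mul_assoc, ← mul_assoc (HahnSeries.C _), ← (laurentMap_inl_commute _ _).eq]
      simp only [mul_assoc]
    have h2 : Φ (BC.inl (RatFunc F) θ h * BC.const (RatFunc F) θ a *
        (BC.X (RatFunc F) θ : SkewFrac θ) ^ i) * laurentMap (BC.inl E' θ) s =
        laurentMap (BC.inl E' θ) (σ (laurentMap κ (T h * c ^ i)) * s) *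
          HahnSeries.C (g (BC.const E θ a * (BC.X E θ : BC E θ) ^ i)) := by
      rw [map_mul, map_mul, map_pow, hΦinl, hΦconst, hΦX, laurentMap_mul_C_pow, map_mul g,
        map_mul (HahnSeries.C), map_mul (laurentMap κ), map_mul σ, map_mul (laurentMap _),
        map_mul (laurentMap _), map_pow (laurentMap κ), map_pow σ, map_pow g]
      rw [mul_assoc (laurentMap _ _) (HahnSeries.C _), ← mul_assoc (HahnSeries.C _),
        ← (laurentMap_inl_commute _ _).eq]
      have h3 := (laurentMap_inl_commute (θ := θ) s (g (BC.const E θ a))).eq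
      have h4 := (laurentMap_inl_commute (θ := θ) s (g (BC.X E θ : BC E θ) ^ i)).eq
      simp only [mul_assoc]
      rw [← h4, ← mul_assoc (HahnSeries.C _) (laurentMap _ s), ← h3]
      simp only [mul_assoc]
    rw [h1, h2, coeff_laurentMap_mul_C, coeff_laurentMap_mul_C, map_mul g, hg, hσ]
    rfl

end Taylor

end

end SkewRes

namespace SkewRes

noncomputable section

section Map

variable {F K : Type*} [Field F] [Field K] [Algebra F K] {θ : K ≃ₐ[F] K} {B B' : Type*}
  [CommRing B] [Algebra F[X] B] [CommRing B'] [Algebra F[X] B']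

theorem BC.map_inl (g : B →ₐ[F[X]] B') (b : B) : BC.map θ g (BC.inl B θ b) = BC.inl B' θ (g b) :=
  rfl

theorem BC.map_inr (g : B →ₐ[F[X]] B') (f : SkewLaurent θ) :
    BC.map θ g (BC.inr B θ f) = BC.inr B' θ f := by
  show (g 1 ⊗ₜ f : BC B' θ) = 1 ⊗ₜ f
  rw [map_one]

theorem BC.map_const (g : B →ₐ[F[X]] B') (a : K) :
    BC.map θ g (BC.const B θ a) = BC.const B' θ a := BC.map_inr _ _

theorem BC.map_X (g : B →ₐ[F[X]] B') :
    BC.map θ g (BC.X B θ : BC B θ) = (BC.X B' θ : BC B' θ) := BC.map_inr _ _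

theorem BC.map_comm [Algebra F B] [IsScalarTower F F[X] B] [Algebra F B'] [IsScalarTower F F[X] B']
    (g : B →ₐ[F[X]] B') (x : B ⊗[F] K) :
    BC.map θ g (BC.comm B θ x) = BC.comm B' θ (baseMap K (g.restrictScalars F) x) := by
  induction x using TensorProduct.induction_on with
  | zero => simp
  | add x y hx hy => simp only [map_add, hx, hy]
  | tmul b a => rw [BC.comm_tmul, map_mul, BC.map_inl, BC.map_const, baseMap_tmul, BC.comm_tmul]; rfl

end Map

/-! ### The map between residue algebras on the centre -/

section Induced

variable {F K Fs : Type*} [Field F] [Field K] [Algebra F K] [Field Fs] [Algebra F Fs]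

theorem ResField.lift_aeval_injective (z : Fs) : Function.Injective
    (ResField.lift (aeval z) (minpoly.aeval F z) : ResField F z →ₐ[F] Fs) := by
  rw [injective_iff_map_eq_zero]
  intro a ha
  obtain ⟨p, rfl⟩ := Ideal.Quotient.mk_surjective a
  exact Ideal.Quotient.eq_zero_iff_mem.2 (Ideal.mem_span_singleton.2 (minpoly.dvd F z ha))

/-- The map of residue fields `Y ↦ f(Y)`, from the point `f(z)` to the point `z`. -/
theorem exists_resField_map {z : Fs} (hz : IsSeparable F z) {f : RatFunc F}
    (hden : aeval z f.denom ≠ 0) : ∃ κ : ResField F (evalAt z f) →ₐ[F] ResField F z,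
      algebraMap F[X] (ResField F z) f.denom *
        κ (algebraMap F[X] (ResField F (evalAt z f)) Polynomial.X) =
        algebraMap F[X] (ResField F z) f.num := by
  obtain ⟨d, hd⟩ := isUnit_resField hz hden
  set y : ResField F z := ((d⁻¹ : (ResField F z)ˣ) : ResField F z) *
    algebraMap F[X] (ResField F z) f.num with hy
  have hdy : algebraMap F[X] (ResField F z) f.denom * y = algebraMap F[X] (ResField F z) f.num := by
    rw [hy, ← hd, Units.mul_inv_cancel_left]
  let v : ResField F z →ₐ[F] Fs := ResField.lift (aeval z) (minpoly.aeval F z)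
  have hv : ∀ p : F[X], v (algebraMap F[X] (ResField F z) p) = aeval z p := fun p => rfl
  have hvy : v y = evalAt z f := by
    have h1 := congrArg v hdy
    rw [map_mul, hv, hv] at h1
    rw [evalAt, eq_div_iff hden, ← h1, mul_comm]
  let ev : F[X] →ₐ[F] ResField F z := aeval y
  refine ⟨ResField.lift ev ?_, ?_⟩
  · apply ResField.lift_aeval_injective z
    have h1 : v (ev (minpoly F (evalAt z f))) = aeval (v y) (minpoly F (evalAt z f)) :=
      (Polynomial.aeval_algHom_apply v y _).symm
    refine h1.trans ?_
    rw [hvy, minpoly.aeval, map_zero]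
  · rw [ResField.lift_algebraMap]
    show _ * aeval y Polynomial.X = _
    rw [aeval_X, hdy]

theorem IsReduction.tmul_one {z : Fs} {f : RatFunc F} {y : ResField F z}
    (hden : aeval z f.denom ≠ 0) (hy : algebraMap F[X] (ResField F z) f.denom * y =
      algebraMap F[X] (ResField F z) f.num) :
    IsReduction z (f ⊗ₜ (1 : K)) (y ⊗ₜ (1 : K)) := by
  refine ⟨f.denom, f.num ⊗ₜ 1, hden, ?_, ?_⟩
  · rw [tmul_one_mul_tmul_one, baseMap_tmul]
    have h := algebraMap_denom_mul (L := RatFunc F) f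
    exact congrArg (fun x : RatFunc F => x ⊗ₜ[F] (1 : K)) h
  · rw [tmul_one_mul_tmul_one, baseMap_tmul, hy]
    rfl

/-- A residue map is prescribed on `K` and on `X` only. Its effect on the centre follows from `Y = X
^ r`: the power `(c X) ^ r` is the norm of `c` times `Y`, which is the reduction of `n Y = γ(Y)`. -/
theorem IsResidueMap.map_inl {θ : K ≃ₐ[F] K} {z : Fs} (hsep : IsSeparable F z)
    {C : RatFunc F ⊗[F] K} {n : RatFunc F} (hn : galNorm θ C = n ⊗ₜ 1)
    (hden : aeval z (n * RatFunc.X).denom ≠ 0) {c : ResField F z ⊗[F] K} (hc : IsReduction z C c)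
    {g : BC (ResField F (pushPoint z n)) θ →+* BC (ResField F z) θ} (hg : IsResidueMap θ c g) :
    ∃ κ : ResField F (pushPoint z n) →ₐ[F] ResField F z,
      algebraMap F[X] (ResField F z) (n * RatFunc.X).denom *
        κ (algebraMap F[X] (ResField F (pushPoint z n)) Polynomial.X) =
        algebraMap F[X] (ResField F z) (n * RatFunc.X).num ∧
      ∀ e, g (BC.inl (ResField F (pushPoint z n)) θ e) = BC.inl (ResField F z) θ (κ e) := by
  obtain ⟨κ, hκ⟩ := exists_resField_map hsep hden
  refine ⟨κ, hκ, fun e => ?_⟩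
  obtain ⟨p, rfl⟩ := Ideal.Quotient.mk_surjective e
  have h : (g.comp (BC.inl (ResField F (pushPoint z n)) θ)).comp
      (algebraMap F[X] (ResField F (pushPoint z n))) =
      ((BC.inl (ResField F z) θ).comp (κ : _ →+* ResField F z)).comp
        (algebraMap F[X] (ResField F (pushPoint z n))) := by
    refine Polynomial.ringHom_ext (fun a => ?_) ?_
    · show g (BC.inl _ θ (algebraMap F[X] (ResField F (pushPoint z n)) (Polynomial.C a))) =
        BC.inl _ θ (κ (algebraMap F[X] (ResField F (pushPoint z n)) (Polynomial.C a)))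
      have h1 : κ (algebraMap F[X] (ResField F (pushPoint z n)) (Polynomial.C a)) =
          algebraMap F[X] (ResField F z) (Polynomial.C a) := κ.commutes a
      rw [h1, BC.inl_C, BC.inl_C, hg.map_const]
    · show g (BC.inl _ θ (algebraMap F[X] (ResField F (pushPoint z n)) Polynomial.X)) =
        BC.inl _ θ (κ (algebraMap F[X] (ResField F (pushPoint z n)) Polynomial.X))
      rw [BC.inl_Y, map_pow, hg.map_X, BC.comm_mul_X_pow, ← BC.inl_Y, ← BC.comm_tmul_one,
        ← BC.comm_tmul_one, ← map_mul]
      congr 1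
      -- The norm of `c` times `Y` and the value given by `κ` are both reductions of `n Y`.
      refine IsReduction.unique hsep (x := (n * RatFunc.X) ⊗ₜ (1 : K)) ?_
        (IsReduction.tmul_one hden hκ)
      rw [← tmul_one_mul_tmul_one, ← hn]
      refine (hc.galNorm θ).mul (IsReduction.tmul_one ?_ ?_)
      · simp
      · simp
  exact DFunLike.congr_fun h p

end Induced

end

end SkewRes

namespace SkewRes

noncomputable section

section Conj

/-- Conjugation `x ↦ u x u⁻¹` by a unit of a ring. -/
def conjHom {R : Type*} [Ring R] (u : Rˣ) : R →+* R where
  toFun x := u * x * (u⁻¹ : Rˣ)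
  map_one' := by rw [mul_one, Units.mul_inv]
  map_mul' x y := by
    rw [mul_assoc _ _ (u * y * (u⁻¹ : Rˣ) : R), mul_assoc (u : R) y, Units.inv_mul_cancel_left]
    simp only [mul_assoc]
  map_zero' := by rw [mul_zero, zero_mul]
  map_add' x y := by rw [mul_add, add_mul]

theorem conjHom_eq_iff {R : Type*} [Ring R] {u : Rˣ} {x y : R} :
    conjHom u x = y ↔ (u : R) * x = y * u :=
  Units.mul_inv_eq_iff_eq_mul u

theorem conjHom_eq_self {R : Type*} [Ring R] {u : Rˣ} {x : R} (h : Commute (u : R) x) :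
    conjHom u x = x := conjHom_eq_iff.2 h.eq

end Conj

/-! ### Nonvanishing of the derivative -/

section Deriv

variable {F K Fs : Type*} [Field F] [Field K] [Algebra F K] [Field Fs] [Algebra F Fs]

/-- Regularity is phrased with the reduced fraction of the derivative, whereas Taylor expansion
produces the unreduced numerator of the quotient rule. Cross-multiplication relates the two, as
`f.denom` does not vanish at `z`. -/
theorem aeval_deriv_ne_zero {z : Fs} {f : RatFunc F} (h : evalAt z (ratDeriv f) ≠ 0)
    (hden : aeval z f.denom ≠ 0) :
    aeval z (derivative f.num * f.denom - f.num * derivative f.denom) ≠ 0 := by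
  set A := derivative f.num * f.denom - f.num * derivative f.denom with hA
  have hden0 : algebraMap F[X] (RatFunc F) f.denom ≠ 0 := by
    rw [Ne, map_eq_zero_iff _ (IsFractionRing.injective F[X] (RatFunc F))]
    exact f.denom_ne_zero
  have h1 : (ratDeriv f).denom * A = (ratDeriv f).num * f.denom ^ 2 := by
    apply IsFractionRing.injective F[X] (RatFunc F)
    rw [map_mul, map_mul, map_pow]
    have h2 := algebraMap_denom_mul (L := RatFunc F) (ratDeriv f)
    rw [← h2, Algebra.algebraMap_self_apply, ratDeriv, ← hA, mul_assoc, div_mul_cancel₀]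
    exact pow_ne_zero 2 hden0
  intro h0
  have h3 := congrArg (aeval z) h1
  rw [map_mul, map_mul, map_pow, h0, mul_zero] at h3
  have h4 : aeval z (ratDeriv f).num ≠ 0 := fun h5 => h (by rw [evalAt, h5, zero_div])
  exact mul_ne_zero h4 (pow_ne_zero 2 hden) h3.symm

end Deriv

/-! ### Conjugating the Taylor morphism by `V` and its reduction -/

section Conjugated

variable {F K Fs : Type*} [Field F] [Field K] [Algebra F K] [Field Fs] [Algebra F Fs]
  {θ : K ≃ₐ[F] K} {L : Type*} [Field L] [Algebra F L] [Algebra F[X] L] [IsScalarTower F F[X] L]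
  {z : Fs} {ρ : L}

variable (θ) in
/-- The unit of `L ⊗ K[X^{±1}; θ]` given by a unit of `F[Y]_{(N)}[ρ] ⊗_F K`. -/
def inclUnit (V : (localRing F z ρ ⊗[F] K)ˣ) : (BC L θ)ˣ :=
  Units.map (BC.comm L θ : L ⊗[F] K →* BC L θ)
    (Units.map (localIncl (F := F) K z ρ : localRing F z ρ ⊗[F] K →* L ⊗[F] K) V)

variable (θ) in
/-- The unit of the residue algebra given by a unit of `F[Y]_{(N)}[ρ] ⊗_F K`. -/
def redUnit (V : (localRing F z ρ ⊗[F] K)ˣ) : (BC (ResRing F z ρ) θ)ˣ :=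
  Units.map (BC.comm (ResRing F z ρ) θ : ResRing F z ρ ⊗[F] K →* BC (ResRing F z ρ) θ)
    (Units.map (localRed (F := F) K z ρ : localRing F z ρ ⊗[F] K →* ResRing F z ρ ⊗[F] K) V)

variable [Algebra (RatFunc F) L] [IsScalarTower F[X] (RatFunc F) L]

/-- The composition of the endomorphism `γ`, conjugation by `V`, a Taylor morphism `τ`, and
conjugation by the inverse of the reduction of `V`. -/
def conjugatedTaylor (γ : SkewFrac θ →+* SkewFrac θ)
    (τ : BC L θ →+* LaurentSeries (BC (ResRing F z ρ) θ)) (V : (localRing F z ρ ⊗[F] K)ˣ) :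
    SkewFrac θ →+* LaurentSeries (BC (ResRing F z ρ) θ) :=
  (conjHom (Units.map (HahnSeries.C (Γ := ℤ) : BC (ResRing F z ρ) θ →+* _).toMonoidHom
    (redUnit θ V)⁻¹)).comp (τ.comp ((conjHom (inclUnit θ V)).comp
      ((BC.map θ (IsScalarTower.toAlgHom F[X] (RatFunc F) L)).comp γ)))

variable {γ : SkewFrac θ →+* SkewFrac θ} {τ : BC L θ →+* LaurentSeries (BC (ResRing F z ρ) θ)}
  {V : (localRing F z ρ ⊗[F] K)ˣ} {C : RatFunc F ⊗[F] K} {n : RatFunc F}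

/-- The three stages are evaluated separately, and the last conjugation is stated as an intertwining
relation so that the inverse of the reduction of `V` disappears. -/
theorem conjugatedTaylor_eq {f : SkewFrac θ} {x : BC L θ}
    {y y' : LaurentSeries (BC (ResRing F z ρ) θ)}
    (hx : conjHom (inclUnit θ V)
      (BC.map θ (IsScalarTower.toAlgHom F[X] (RatFunc F) L) (γ f)) = x)
    (hy : τ x = y)
    (hy' : y * HahnSeries.C (redUnit θ V : BC (ResRing F z ρ) θ) =
      HahnSeries.C (redUnit θ V : BC (ResRing F z ρ) θ) * y') :
    conjugatedTaylor γ τ V f = y' := by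
  show conjHom _ (τ (conjHom (inclUnit θ V)
    (BC.map θ (IsScalarTower.toAlgHom F[X] (RatFunc F) L) (γ f)))) = y'
  rw [hx, hy, conjHom_eq_iff, map_inv]
  refine (Units.inv_mul_eq_iff_eq_mul _).2 ?_
  rw [← mul_assoc]
  refine (Units.eq_mul_inv_iff_mul_eq _).2 ?_
  exact hy'

theorem conjugatedTaylor_const (hτ : IsCanonicalTaylor L (ResRing F z ρ) θ τ)
    (hγ : ∀ a : K, γ (BC.const (RatFunc F) θ a) = BC.const (RatFunc F) θ a) (a : K) :
    conjugatedTaylor γ τ V (BC.const (RatFunc F) θ a) =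
      HahnSeries.C (BC.const (ResRing F z ρ) θ a) := by
  refine conjugatedTaylor_eq (x := BC.const L θ a) ?_ (hτ.map_const a) ?_
  · rw [hγ, BC.map_const]
    exact conjHom_eq_self (BC.const_commute_comm a _).symm
  · rw [← map_mul, ← map_mul]
    exact congrArg HahnSeries.C (BC.const_commute_comm a _).eq

theorem conjugatedTaylor_inl {h h' : RatFunc F} {e : LaurentSeries (ResRing F z ρ)}
    (hγ : γ (BC.inl (RatFunc F) θ h) = BC.inl (RatFunc F) θ h')
    (hτ : τ (BC.inl L θ (algebraMap (RatFunc F) L h')) = laurentMap (BC.inl _ θ) e) :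
    conjugatedTaylor γ τ V (BC.inl (RatFunc F) θ h) = laurentMap (BC.inl _ θ) e := by
  refine conjugatedTaylor_eq ?_ hτ ?_
  · rw [hγ, BC.map_inl]
    exact conjHom_eq_self (BC.inl_commute _ _).symm
  · exact (laurentMap_inl_commute _ _).eq

/-- The residue of a conjugate, in terms of `conjugatedTaylor`. -/
theorem conj_coeff_eq {U : (L ⊗[F] K)ˣ} {l : Lˣ}
    (hV : localIncl K z ρ V = ((l : L) ⊗ₜ 1) * (U : L ⊗[F] K)) {d : L}
    {s : LaurentSeries (ResRing F z ρ)} (hd : τ (BC.inl L θ d) = laurentMap (BC.inl _ θ) s)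
    (f : SkewFrac θ) :
    BC.comm (ResRing F z ρ) θ (localRed K z ρ ((V⁻¹ : (localRing F z ρ ⊗[F] K)ˣ) :)) *
      (τ (BC.comm L θ U * BC.map θ (IsScalarTower.toAlgHom F[X] (RatFunc F) L) (γ f) *
        BC.comm L θ ((U⁻¹ : (L ⊗[F] K)ˣ) :) * BC.inl L θ d)).coeff (-1) *
      BC.comm (ResRing F z ρ) θ (localRed K z ρ V) =
    (conjugatedTaylor γ τ V f * laurentMap (BC.inl _ θ) s).coeff (-1) := by
  set x := BC.map θ (IsScalarTower.toAlgHom F[X] (RatFunc F) L) (γ f) with hx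
  -- The scalar `l` is central, so conjugation by `V` is conjugation by `U`.
  have h1 : conjHom (inclUnit θ V) x =
      BC.comm L θ U * x * BC.comm L θ ((U⁻¹ : (L ⊗[F] K)ˣ) :) := by
    rw [conjHom_eq_iff]
    show BC.comm L θ (localIncl K z ρ V) * x = _ * BC.comm L θ (localIncl K z ρ V)
    rw [hV, map_mul, BC.comm_tmul_one, ← mul_assoc, ← (BC.inl_commute _ _).eq, mul_assoc _ _ (BC.comm L θ U),
      mul_assoc _ _ (BC.comm L θ U), ← map_mul, Units.inv_mul, map_one, mul_one, mul_assoc]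
  have h2 : conjugatedTaylor γ τ V f = HahnSeries.C (BC.comm (ResRing F z ρ) θ
      (localRed K z ρ ((V⁻¹ : (localRing F z ρ ⊗[F] K)ˣ) :))) * τ (conjHom (inclUnit θ V) x) *
      HahnSeries.C (BC.comm (ResRing F z ρ) θ (localRed K z ρ V)) := by
    refine conjugatedTaylor_eq rfl rfl ?_
    rw [← mul_assoc, ← mul_assoc, ← map_mul]
    have h3 : (redUnit θ V : BC (ResRing F z ρ) θ) * BC.comm (ResRing F z ρ) θ
        (localRed K z ρ ((V⁻¹ : (localRing F z ρ ⊗[F] K)ˣ) :)) = 1 := by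
      show BC.comm _ θ (localRed K z ρ V) * _ = 1
      rw [← map_mul, ← map_mul, Units.mul_inv, map_one, map_one]
    rw [h3, map_one, one_mul]
    rfl
  rw [h2, h1, mul_assoc, mul_assoc (HahnSeries.C _ * _), ← (laurentMap_inl_commute _ _).eq, map_mul τ, hd, ← mul_assoc,
    mul_assoc (HahnSeries.C _),
    HahnSeries.C_apply, HahnSeries.C_apply, HahnSeries.coeff_single_zero_mul,
    ← mul_assoc (τ _), HahnSeries.coeff_mul_single_zero, mul_assoc]

variable [IsScalarTower F (RatFunc F) L]

/-- The reduction modulo `N` of the relation `ρ θ(V) = C V`. -/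
theorem tmul_mul_galAct_localRed {c : ResField F z ⊗[F] K} (hc : IsReduction z C c)
    (hV : (ρ ⊗ₜ 1) * galAct L θ (localIncl K z ρ V) =
      baseMap K (IsScalarTower.toAlgHom F (RatFunc F) L) C * localIncl K z ρ V) :
    (resMk z ρ (localGen F z ρ) ⊗ₜ 1) * galAct _ θ (localRed K z ρ V) =
      baseMap K ((resMap z ρ).restrictScalars F) c * localRed K z ρ V := by
  obtain ⟨D, hD, hD'⟩ := hc.exists_local ρ
  have h1 : (localGen F z ρ ⊗ₜ 1) * galAct _ θ (V : localRing F z ρ ⊗[F] K) = D * (V : localRing F z ρ ⊗[F] K) := by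
    apply localIncl_injective
    rw [map_mul, map_mul, hD, localIncl_galAct, ← hV]
    rfl
  have h2 := congrArg (localRed K z ρ) h1
  rwa [map_mul, map_mul, hD', localRed_galAct, localRed_tmul] at h2

/-- The relation `ρ θ(V) = C V` gives `V (C X) V⁻¹ = ρ X`. The Taylor morphism multiplies `X` by the
expansions of `ρ` and of `X / X(0)`, and the reduced relation turns `X` into `ρ̄⁻¹ c X` when the
reduction of `V` is conjugated away. The factor `ρ̄⁻¹` normalises the constant coefficient to `1`.
-/
theorem conjugatedTaylor_X (hτ : IsCanonicalTaylorExt θ z ρ τ)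
    (hγ : γ (BC.X (RatFunc F) θ : SkewFrac θ) =
        BC.comm (RatFunc F) θ C * (BC.X (RatFunc F) θ : SkewFrac θ))
    (hρ : IsUnit (localGen F z ρ)) {c : ResField F z ⊗[F] K} (hc : IsReduction z C c)
    (hV : (ρ ⊗ₜ 1) * galAct L θ (localIncl K z ρ V) =
      baseMap K (IsScalarTower.toAlgHom F (RatFunc F) L) C * localIncl K z ρ V) :
    ∃ s : PowerSeries (ResRing F z ρ), PowerSeries.constantCoeff s = 1 ∧
      conjugatedTaylor γ τ V (BC.X (RatFunc F) θ : SkewFrac θ) =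
        laurentMap (BC.inl _ θ) (HahnSeries.ofPowerSeries ℤ _ s) *
        HahnSeries.C (BC.comm _ θ (baseMap K ((resMap z ρ).restrictScalars F) c) *
          (BC.X (ResRing F z ρ) θ : BC (ResRing F z ρ) θ)) := by
  obtain ⟨t, ht, hτρ⟩ := hτ.reduces (localGen F z ρ)
  obtain ⟨d, hd, hτX⟩ := hτ.isCanonical.map_X
  rw [← laurentMap_ofPowerSeries] at hτρ hτX
  obtain ⟨e, he⟩ := (hρ.map (resMk z ρ)).exists_right_inv
  -- Here `t` expands `ρ`, `d` is the canonical series attached to `X`, and `e` is the inverse of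
  -- the reduction of `ρ`.
  refine ⟨t * d * PowerSeries.C e, by simp [ht, hd, he], ?_⟩
  refine conjugatedTaylor_eq (x := BC.inl L θ (localGen F z ρ : L) * (BC.X L θ : BC L θ))
    (y := laurentMap (BC.inl _ θ) (HahnSeries.ofPowerSeries ℤ _ (t * d)) *
      HahnSeries.C (BC.X (ResRing F z ρ) θ : BC (ResRing F z ρ) θ)) ?_ ?_ ?_
  · rw [hγ, map_mul, BC.map_X, BC.map_comm, conjHom_eq_iff]
    show BC.comm L θ (localIncl K z ρ V) * _ =
      _ * _ * BC.comm L θ (localIncl K z ρ V)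
    rw [mul_assoc (BC.inl L θ _), BC.X_mul_comm, ← mul_assoc, ← mul_assoc, ← map_mul,
      ← BC.comm_tmul_one, ← map_mul]
    exact congrArg (fun x => BC.comm L θ x * (BC.X L θ : BC L θ)) ((mul_comm _ _).trans hV.symm)
  · rw [map_mul, hτρ, hτX, ← mul_assoc, ← map_mul, ← map_mul]
  · have h1 : (BC.X (ResRing F z ρ) θ : BC (ResRing F z ρ) θ) * (redUnit θ V : BC (ResRing F z ρ) θ) =
        BC.inl _ θ e * ((redUnit θ V : BC (ResRing F z ρ) θ) *
          (BC.comm _ θ (baseMap K ((resMap z ρ).restrictScalars F) c) *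
          (BC.X (ResRing F z ρ) θ : BC (ResRing F z ρ) θ))) := by
      show _ * BC.comm _ θ (localRed K z ρ V) = _ * (BC.comm _ θ (localRed K z ρ V) * _)
      have h0 : localRed K z ρ V * baseMap K ((resMap z ρ).restrictScalars F) c =
          (resMk z ρ (localGen F z ρ) ⊗ₜ 1) * galAct _ θ (localRed K z ρ V) :=
        (mul_comm _ _).trans (tmul_mul_galAct_localRed hc hV).symm
      rw [BC.X_mul_comm, ← mul_assoc (BC.comm _ θ _), ← map_mul, h0, map_mul, BC.comm_tmul_one, ← mul_assoc, ← mul_assoc,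
        ← map_mul, mul_comm e, he, map_one, one_mul]
    rw [mul_assoc, ← map_mul, h1, map_mul (HahnSeries.C), ← laurentMap_C, ← mul_assoc, ← map_mul,
      ← HahnSeries.ofPowerSeries_C, ← map_mul, map_mul (HahnSeries.C), ← mul_assoc,
      (laurentMap_inl_commute _ _).eq, mul_assoc]

end Conjugated

end

end SkewRes

namespace SkewRes

noncomputable section

/-! ### The residue formula -/

section Main

variable {F K Fs : Type*} [Field F] [Field K] [Algebra F K] [Field Fs] [Algebra F Fs]
  [IsSepClosure F Fs] {θ : K ≃ₐ[F] K} {L : Type*} [Field L] [Algebra F L] [Algebra F[X] L]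
  [IsScalarTower F F[X] L] {z : Fs} {ρ : L} {C : RatFunc F ⊗[F] K} {n : RatFunc F}

/-- The map induced by `γ` on residue algebras, on constants, on `Y` and on `X`. -/
theorem inducedMap_resMap (hr : (orderOf θ : F) ≠ 0) (hz : z ≠ 0) (hn : galNorm θ C = n ⊗ₜ 1)
    (hreg : IsGammaRegular z C n) (ρ : L) :
    ∃ (κ : ResField F (pushPoint z n) →ₐ[F] ResRing F z ρ) (c : ResField F z ⊗[F] K),
      IsReduction z C c ∧
      algebraMap F[X] (ResRing F z ρ) (n * RatFunc.X).denom *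
        κ (algebraMap F[X] (ResField F (pushPoint z n)) Polynomial.X) =
        algebraMap F[X] (ResRing F z ρ) (n * RatFunc.X).num ∧
      (∀ e, BC.map θ (resMap z ρ) (inducedMap hr hz hn hreg
        (BC.inl (ResField F (pushPoint z n)) θ e)) = BC.inl (ResRing F z ρ) θ (κ e)) ∧
      (∀ a, BC.map θ (resMap z ρ) (inducedMap hr hz hn hreg
        (BC.const (ResField F (pushPoint z n)) θ a)) = BC.const (ResRing F z ρ) θ a) ∧
      BC.map θ (resMap z ρ) (inducedMap hr hz hn hreg
        (BC.X (ResField F (pushPoint z n)) θ : BC (ResField F (pushPoint z n)) θ)) =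
        BC.comm (ResRing F z ρ) θ (baseMap K ((resMap z ρ).restrictScalars F) c) *
          (BC.X (ResRing F z ρ) θ : BC (ResRing F z ρ) θ) := by
  obtain ⟨c, hc, hg⟩ := inducedMap_spec hr hz hn hreg
  obtain ⟨κ, hκ, hκinl⟩ :=
    hg.map_inl (isSeparable_of_isSepClosure z) hn hreg.denom_ne_zero hc
  refine ⟨((resMap z ρ).restrictScalars F).comp κ, c, hc, ?_, ?_, ?_, ?_⟩
  · have := congrArg (resMap z ρ) hκ
    rwa [map_mul, AlgHom.commutes, AlgHom.commutes] at this
  · intro e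
    rw [hκinl, BC.map_inl]; rfl
  · intro a
    rw [hg.map_const, BC.map_const]
  · rw [hg.map_X, map_mul, BC.map_comm, BC.map_X]

variable [Algebra (RatFunc F) L] [IsScalarTower F (RatFunc F) L]
  [IsScalarTower F[X] (RatFunc F) L]

/-- The residue formula for the conjugate of `γ` by a unit of `F[Y]_{(N)}[ρ] ⊗_F K`. -/
theorem map_sresCan_eq (hr : (orderOf θ : F) ≠ 0) {γ : SkewFrac θ →+* SkewFrac θ}
    (hγ : ∀ a : K, γ (BC.const (RatFunc F) θ a) = BC.const (RatFunc F) θ a)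
    (hn : galNorm θ C = n ⊗ₜ 1)
    (hγX : γ (BC.X (RatFunc F) θ : SkewFrac θ) =
        BC.comm (RatFunc F) θ C * (BC.X (RatFunc F) θ : SkewFrac θ))
    (hγY : γ (BC.inl (RatFunc F) θ RatFunc.X) = BC.inl (RatFunc F) θ (n * RatFunc.X))
    (hρ : ρ ^ orderOf θ = algebraMap (RatFunc F) L n)
    (hz : z ≠ 0) (hreg : IsGammaRegular z C n)
    {τ : BC L θ →+* LaurentSeries (BC (ResRing F z ρ) θ)} (hτ : IsCanonicalTaylorExt θ z ρ τ)
    {V : (localRing F z ρ ⊗[F] K)ˣ}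
    (hV : (ρ ⊗ₜ 1) * galAct L θ (localIncl K z ρ V) =
      baseMap K (IsScalarTower.toAlgHom F (RatFunc F) L) C * localIncl K z ρ V) :
    ∃ s : LaurentSeries (ResRing F z ρ),
      τ (BC.inl L θ (algebraMap (RatFunc F) L (ratDeriv (n * RatFunc.X)))) =
        laurentMap (BC.inl _ θ) s ∧
      ∀ f, BC.map θ (resMap z ρ) (inducedMap hr hz hn hreg
          (sresCan θ hr hreg.pushPoint_ne_zero f)) =
        (conjugatedTaylor γ τ V f * laurentMap (BC.inl _ θ) s).coeff (-1) := by
  have hr0 := orderOf_ne_zero_of_cast θ hr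
  have hsep := isSeparable_of_isSepClosure (F := F) z
  have hsepw : (minpoly F (pushPoint z n)).Separable :=
    isSeparable_of_isSepClosure (F := F) (pushPoint z n)
  have hden := hreg.denom_ne_zero
  have hw := hreg.pushPoint_ne_zero
  have hQ := isUnit_resRing hsep ρ hden
  have hN := algebraMap_resRing_minpoly (F := F) z ρ
  have hirr := minpoly.irreducible hsep.isIntegral
  obtain ⟨κ, c, hc, hκY, hκinl, hκconst, hκX⟩ := inducedMap_resMap hr hz hn hreg ρ
  obtain ⟨s, hs, hs0, hs1, hsd⟩ := exists_ratTaylor_eq hN hirr hsep (n * RatFunc.X) hQ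
  have hκs := hQ.mul_left_cancel (hκY.trans hs0.symm)
  -- The value of `γ(Y)` at `z` is `κ(Y)`, so `γ(Y)` expands as `κ(Y) + S`: the substitution `T ↦ S`
  -- carries the parameter at `γ_⋆ z` to the parameter at `z`.
  set S := s - PowerSeries.C (PowerSeries.constantCoeff s) with hS
  have hdS : PowerSeries.derivative _ S = PowerSeries.derivative _ s := by
    rw [hS, map_sub, PowerSeries.derivative_C, sub_zero]
  obtain ⟨σ, σ₀, hσX, hσ, hσ0, hres⟩ := exists_laurent_subst (S := S) (by simp [hS]) (by
    have h1 : PowerSeries.coeff 1 S = PowerSeries.coeff 1 s := by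
      rw [hS, map_sub, PowerSeries.coeff_C, if_neg one_ne_zero, sub_zero]
    rw [h1]
    -- Up to the square of the denominator, the linear coefficient of `S` is the numerator of the
    -- derivative of `γ(Y)` at `z`, nonzero by regularity.
    refine isUnit_of_mul_isUnit_right (x := algebraMap F[X] (ResRing F z ρ)
      (n * RatFunc.X).denom ^ 2) ?_
    rw [hs1]
    exact isUnit_resRing hsep ρ (aeval_deriv_ne_zero hreg.deriv_ne_zero hden))
  rw [hdS] at hres
  have hσC : ∀ a, σ₀ (PowerSeries.C a) = PowerSeries.C a := fun a => σ₀.commutes a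
  have hyw : IsUnit (algebraMap F[X] (ResField F (pushPoint z n)) Polynomial.X) :=
    isUnit_resField hsepw (by rwa [aeval_X])
  obtain ⟨c₀, hc₀, hcr⟩ := exists_canonical_root (θ := θ) hr hyw
  have hτw := canonicalTaylor_spec θ hr hw
  set Φ := conjugatedTaylor γ τ V with hΦ
  have hΦY : Φ (BC.inl (RatFunc F) θ RatFunc.X) =
      laurentMap (BC.inl _ θ) (HahnSeries.ofPowerSeries ℤ _ s) :=
    conjugatedTaylor_inl hγY (by rw [hτ.isCanonical.map_inl_ratFunc hN hirr hsep, hs])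
  have hσs : σ₀ (PowerSeries.map (κ : _ →+* ResRing F z ρ)
      (PowerSeries.C (algebraMap F[X] (ResField F (pushPoint z n)) Polynomial.X) +
        PowerSeries.X)) = s := by
    rw [map_add, PowerSeries.map_C, PowerSeries.map_X, map_add, hσC, hσX, hS]
    have : (κ : _ →+* ResRing F z ρ) (algebraMap F[X] (ResField F (pushPoint z n)) Polynomial.X) =
        PowerSeries.constantCoeff s := hκs
    rw [this, add_sub_cancel]
  have hΦC : ∀ a : F, Φ (BC.inl (RatFunc F) θ (algebraMap F[X] (RatFunc F) (Polynomial.C a))) =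
      HahnSeries.C (BC.inl _ θ (algebraMap F[X] (ResRing F z ρ) (Polynomial.C a))) := by
    intro a
    rw [BC.inl_C, BC.inl_C]
    exact conjugatedTaylor_const hτ.isCanonical hγ _
  have hNw := algebraMap_resField_minpoly (F := F) (pushPoint z n)
  have hirrw := minpoly.irreducible (IsSeparable.isIntegral hsepw)
  have hσκ : ∀ p : PowerSeries (ResField F (pushPoint z n)),
      σ (laurentMap (κ : _ →+* ResRing F z ρ) (HahnSeries.ofPowerSeries ℤ _ p)) =
      HahnSeries.ofPowerSeries ℤ _ (σ₀ (PowerSeries.map (κ : _ →+* ResRing F z ρ) p)) :=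
    fun p => by rw [laurentMap_ofPowerSeries, hσ]
  have hΦinl : ∀ h, Φ (BC.inl (RatFunc F) θ h) = laurentMap (BC.inl _ θ)
      (σ (laurentMap (κ : _ →+* ResRing F z ρ) (ratTaylor hNw hirrw hsepw h))) := by
    have : Φ.comp (BC.inl (RatFunc F) θ) = (laurentMap (BC.inl _ θ)).comp
        (σ.comp ((laurentMap (κ : _ →+* ResRing F z ρ)).comp (ratTaylor hNw hirrw hsepw))) := by
      refine ratFunc_ringHom_ext (fun a => ?_) ?_
      · simp only [RingHom.comp_apply]
        rw [hΦC, ratTaylor_algebraMap, shift_C, laurentMap_ofPowerSeries, PowerSeries.map_C, hσ,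
          hσC, HahnSeries.ofPowerSeries_C, laurentMap_C]
        refine congrArg (fun x => HahnSeries.C (BC.inl _ θ x)) ?_
        have := κ.commutes a
        rw [IsScalarTower.algebraMap_apply F F[X] (ResField F (pushPoint z n)),
          IsScalarTower.algebraMap_apply F F[X] (ResRing F z ρ)] at this
        exact this.symm
      · simp only [RingHom.comp_apply]
        rw [RatFunc.algebraMap_X, hΦY, ← RatFunc.algebraMap_X, ratTaylor_algebraMap, shift_X,
          hσκ, hσs]
    exact fun h => DFunLike.congr_fun this h
  obtain ⟨c₁, hc₁, hΦX⟩ := conjugatedTaylor_X hτ hγX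
    (isUnit_localGen hr0 hρ hreg.num_norm_ne_zero) hc hV
  set c₂ := σ₀ (PowerSeries.map (κ : _ →+* ResRing F z ρ) c₀) with hc₂
  have hc₂r : c₂ ^ orderOf θ * PowerSeries.C
      (κ (algebraMap F[X] (ResField F (pushPoint z n)) Polynomial.X)) = s := by
    rw [← hσs, ← hcr, map_mul, map_pow, map_mul, map_pow, PowerSeries.map_C, hσC]
    rfl
  -- Both `c₁` and `c₂` have constant coefficient `1`, and their `r`-th powers times `κ(Y)` have the
  -- image of `s`, the expansion of `γ(Y)`.
  have hroot : ((laurentMap (BC.inl _ θ)).comp (HahnSeries.ofPowerSeries ℤ _)) c₁ =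
      ((laurentMap (BC.inl _ θ)).comp (HahnSeries.ofPowerSeries ℤ (ResRing F z ρ))) c₂ := by
    refine eq_of_map_pow_mul_eq _ (isUnit_orderOf (θ := θ) _ hr) hc₁ ?_
      ((hyw.map κ).map PowerSeries.C) ?_
    · rw [hc₂, hσ0, ← PowerSeries.coeff_zero_eq_constantCoeff_apply, PowerSeries.coeff_map,
        PowerSeries.coeff_zero_eq_constantCoeff_apply, hc₀, map_one]
    · have h2 : (BC.comm (ResRing F z ρ) θ (baseMap K ((resMap z ρ).restrictScalars F) c) *
          (BC.X (ResRing F z ρ) θ : BC (ResRing F z ρ) θ)) ^ orderOf θ = BC.inl _ θ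
          (κ (algebraMap F[X] (ResField F (pushPoint z n)) Polynomial.X)) := by
        rw [← hκX, ← hκinl, BC.inl_Y, map_pow, map_pow]
      have h1 := hΦY
      rw [SkewFrac.inl_X, map_pow, hΦX, laurentMap_mul_C_pow, h2, ← laurentMap_C,
        ← HahnSeries.ofPowerSeries_C, ← map_mul, ← map_pow, ← map_mul] at h1
      rw [hc₂r]
      exact h1
  refine ⟨HahnSeries.ofPowerSeries ℤ _ (PowerSeries.derivative _ s), ?_, fun f => ?_⟩
  · rw [hτ.isCanonical.map_inl_ratFunc hN hirr hsep, hsd]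
  · refine map_coeff_eq_coeff_mul hr0
      (g := (BC.map θ (resMap z ρ)).comp (inducedMap hr hz hn hreg))
      (κ := (κ : _ →+* ResRing F z ρ)) hκinl (T := ratTaylor hNw hirrw hsepw)
      (c := HahnSeries.ofPowerSeries ℤ _ c₀) hres
      (fun h => hτw.map_inl_ratFunc hNw hirrw hsepw h) hτw.map_const
      (hτw.map_X_eq hr hyw hc₀ hcr) hΦinl ?_ ?_ f
    · intro a
      refine (conjugatedTaylor_const hτ.isCanonical hγ a).trans ?_
      exact congrArg HahnSeries.C (hκconst a).symm
    · refine hΦX.trans ?_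
      rw [hσκ]
      exact congrArg₂ (· * ·) hroot (congrArg HahnSeries.C hκX.symm)

end Main

end

end SkewRes

/-- The elements `C` and `n` come before `L`, `ρ`, `U` and `z` because regularity and the induced
map refer to them. That `λ U` is invertible over `F[Y]_{(N)}[ρ] ⊗ K` is expressed by a unit `V` of
that ring whose image in `L ⊗ K` is `λ U`. -/
theorem mainTheorem4 {F K Fs : Type*} [Field F] [Field K] [Algebra F K]
    [Field Fs] [Algebra F Fs] [IsSepClosure F Fs] (θ : K ≃ₐ[F] K)
    (hfix : ∀ a : K, θ a = a → a ∈ Set.range (algebraMap F K))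
    (hr : (orderOf θ : F) ≠ 0)
    (γ : SkewFrac θ →+* SkewFrac θ)
    (hγ : ∀ a : K, γ (BC.const (RatFunc F) θ a) = BC.const (RatFunc F) θ a) :
    ∃ (C : RatFunc F ⊗[F] K) (n : RatFunc F) (hn : galNorm θ C = n ⊗ₜ 1),
      γ (BC.X (RatFunc F) θ : SkewFrac θ) =
        BC.comm (RatFunc F) θ C * (BC.X (RatFunc F) θ : SkewFrac θ) ∧
      γ (BC.inl (RatFunc F) θ RatFunc.X) = BC.inl (RatFunc F) θ (n * RatFunc.X) ∧
      ∀ (L : Type*) [Field L] [Algebra F L] [Algebra F[X] L] [Algebra (RatFunc F) L]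
        [IsScalarTower F F[X] L] [IsScalarTower F (RatFunc F) L]
        [IsScalarTower F[X] (RatFunc F) L]
        (ρ : L) (hρ : ρ ^ orderOf θ = algebraMap (RatFunc F) L n)
        (hgen : IntermediateField.adjoin (RatFunc F) {ρ} = ⊤)
        (U : (L ⊗[F] K)ˣ)
        (_ : galAct L θ U =
          (ρ⁻¹ ⊗ₜ 1) * baseMap K (IsScalarTower.toAlgHom F (RatFunc F) L) C * (U : L ⊗[F] K))
        (z : Fs) (hz : z ≠ 0) (hreg : IsGammaRegular z C n),
        (∃ (l : Lˣ) (V : (localRing F z ρ ⊗[F] K)ˣ),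
          localIncl K z ρ V = ((l : L) ⊗ₜ 1) * (U : L ⊗[F] K)) ∧
        ∀ (l : Lˣ) (V : (localRing F z ρ ⊗[F] K)ˣ),
          localIncl K z ρ V = ((l : L) ⊗ₜ 1) * (U : L ⊗[F] K) →
          ∀ f : SkewFrac θ,
            BC.map θ (resMap z ρ) (inducedMap hr hz hn hreg
              (sresCan θ hr hreg.pushPoint_ne_zero f)) =
            BC.comm (ResRing F z ρ) θ (localRed K z ρ ((V⁻¹ : (localRing F z ρ ⊗[F] K)ˣ) :)) *
              sresCanExt θ hr hz hreg hρ hgen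
                (BC.comm L θ U *
                  BC.map θ (IsScalarTower.toAlgHom F[X] (RatFunc F) L) (γ f) *
                  BC.comm L θ ((U⁻¹ : (L ⊗[F] K)ˣ) :) *
                  BC.inl L θ (algebraMap (RatFunc F) L (ratDeriv (n * RatFunc.X)))) *
              BC.comm (ResRing F z ρ) θ (localRed K z ρ V) := by
  obtain ⟨C, n, hn, hX, hY⟩ := exists_eq_comm_mul_X hfix hr γ hγ
  refine ⟨C, n, hn, hX, hY, ?_⟩
  intro L _ _ _ _ _ _ _ ρ hρ hgen U hU z hz hreg
  have hr0 := orderOf_ne_zero_of_cast θ hr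
  constructor
  -- The solution over the local ring and the given `U` satisfy the same equation over `L`, so they
  -- differ by a scalar of `L`.
  · obtain ⟨V, hV⟩ := exists_unit_localRing hfix hr hn hρ hz hreg
    obtain ⟨l, hl⟩ := exists_eq_tmul_mul hfix hr (V.isUnit.map (localIncl K z ρ)) hU hV
    exact ⟨l, V, hl⟩
  · intro l V hV f
    have hρ0 : ρ ≠ 0 := by
      have := (isUnit_localGen (F := F) (z := z) hr0 hρ hreg.num_norm_ne_zero).map
        (localRing F z ρ).subtype
      exact this.ne_zero
    -- The scalar `l` is fixed by `id ⊗ θ`, so `V` inherits the equation of `U`. It is rewritten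
    -- without `ρ⁻¹`, the form that is reduced modulo `N`.
    have hV' : (ρ ⊗ₜ 1) * galAct L θ (localIncl K z ρ V) =
        baseMap K (IsScalarTower.toAlgHom F (RatFunc F) L) C * localIncl K z ρ V := by
      have hl : galAct L θ ((l : L) ⊗ₜ 1) = (l : L) ⊗ₜ 1 := by simp [galAct]
      rw [hV, map_mul, hl, hU]
      have h1 : (ρ ⊗ₜ[F] (1 : K)) * (ρ⁻¹ ⊗ₜ 1) = 1 := by
        rw [tmul_one_mul_tmul_one, mul_inv_cancel₀ hρ0, Algebra.TensorProduct.one_def]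
      linear_combination (((l : L) ⊗ₜ[F] (1 : K)) *
        baseMap K (IsScalarTower.toAlgHom F (RatFunc F) L) C * (U : L ⊗[F] K)) * h1
    obtain ⟨s, hs, h⟩ := map_sresCan_eq hr hγ hn hX hY hρ hz hreg
      (canonicalTaylorExt_spec θ hr hz hreg hρ hgen) hV'
    rw [h f]
    exact (conj_coeff_eq hV hs f).symm
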